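/- **Notation and definitions.** *Field, unit, dimensions.* Let $K=\mathbb{Q}(\sqrt D)$ ($D>1$ squarefree) be a real quadratic field of discriminant $\Delta_0$, and let $\varepsilon$ be its smallest unit $>1$ of positive norm. For positive integers $j,m$ put $f_j=(\varepsilon^j-\varepsilon^{-j})/\sqrt{\Delta_0}$, $r_{j,m}=f_{jm}/f_j$, $d_{j,m}=r_{j,m+1}+r_{j,m}$, $d_j=d_{j,1}$ (all are positive integers, and $r_{j,1}=1$). A pair of integers $(d,r)$ is *admissible* if $0<r<\frac{d-1}{2}$ and $nr(d-r)=d^2-1$ for some integer $n>4$. *Tuples.* A form is a primitive, indefinite, irreducible integral binary quadratic form $Q=\langle a,b,c\rangle=ax^2+bxy+cy^2$; it has discriminant $\Delta=b^2-4ac$; its fundamental discriminant $\Delta_0(Q)$ is the discriminant of $\mathbb{Q}(\sqrt{\Delta})$, its conductor is $f=\sqrt{\Delta/\Delta_0(Q)}$, and $\rho_Q=\frac{-b+\sqrt{\Delta}}{2a}$. An *admissible tuple* is $t=(d,r,Q)\sim(K,j,m,Q)$ with $(d,r)$ admissible, $d=d_{j,m}$, $r=r_{j,m}$, $\Delta_0(Q)=\Delta_0$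 and $f\mid f_j$. Let $A_t$ be the generator of the (infinite cyclic) group of all $M\in \mathrm{SL}_2(\mathbb{Z})$ with $M\equiv I \pmod d$ and $M^{T}QM=Q$ whose lower left entry has the same sign as $a$. *Cocycle.* For $z\in\mathbb{C}$, $\operatorname{Im}\tau>0$ let $\varpi(z,\tau)=\prod_{k\ge0}(1-e^{2\pi i(z+k\tau)})$, and let $\varpi_n(z,\tau)=\prod_{k=0}^{n-1}(1-e^{2\pi i (z+k\tau)})$ for $n\ge0$, $\varpi_n(z,\tau)=\prod_{k=n}^{-1}(1-e^{2\pi i (z+k\tau)})^{-1}$ for $n<0$. For $M=\begin{pmatrix}\alpha&\beta\\\gamma&\delta\end{pmatrix}\in\mathrm{SL}_2(\mathbb{Z})$ write $j_M(\tau)=\gamma\tau+\delta$, $M\cdot\tau=(\alpha\tau+\beta)/(\gamma\tau+\delta)$, and let $\sigma_M(z,\tau)$ be the meromorphic continuation of $\varpi(z/j_M(\tau),M\cdot\tau)/\varpi(z,\tau)$ from the upper half plane in $\tau$ to the real $\tau$ with $j_M(\tau)>0$. For $\mathbf r\in\mathbb{Q}^2$ with $(M-I)\mathbf r\in\mathbb{Z}^2$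 put, with $\langle\mathbf r,\tau\rangle=r_2\tau-r_1$, $$\mathrm{sf}^{\mathbf r}_M(\tau)=\sigma_M(\langle\mathbf r,\tau\rangle,\tau)\Big/\varpi_{((I-M)\mathbf r)_2}\!\Big(\tfrac{\langle\mathbf r,\tau\rangle}{j_M(\tau)},M\cdot\tau\Big).$$ *Ghost overlaps.* Let $\xi_d=-e^{\pi i/d}$, $\omega_d=e^{2\pi i/d}$, $\bar d=d$ for $d$ odd and $\bar d=2d$ for $d$ even, and let $\Psi$ be the Rademacher class invariant: $\Psi(M)=\beta/\delta$ if $\gamma=0$, and otherwise $\Psi(M)=\frac{\alpha+\delta}{\gamma}-3\,\mathrm{sgn}(\gamma(\alpha+\delta))-12\,\mathrm{sgn}(\gamma)\,\mathfrak{s}(\alpha,\gamma)$ with $\mathfrak{s}$ the Dedekind sum. For an admissible tuple $t$ and $\mathbf p\in\mathbb{Z}^2$ put $$\tilde\nu_t(\mathbf p)=(-1)^{d+(1+d)(1+p_1)(1+p_2)}\,e^{-\frac{\pi i}{12}\Psi(A_t)}\,\xi_d^{-\frac{f_{jm}}{f}Q(\mathbf p)}\,\mathrm{sf}^{d^{-1}\mathbf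 p}_{A_t}(\rho_Q),$$ $\tilde\mu_t(\mathbf p)=r$ if $\mathbf p\equiv\mathbf 0\pmod d$ and $\tilde\mu_t(\mathbf p)=\sqrt{\tfrac{r(d-r)}{d^2-1}}\,\tilde\nu_t(\mathbf p)$ otherwise. Let $E_t$ be the field generated over $\mathbb{Q}$ by $\xi_d$ and the $\tilde\mu_t(\mathbf p)$ with $0\le p_1,p_2<d$, $\mathbf p\ne\mathbf 0$, and let $\hat E_t\subseteq\mathbb{C}$ be the Galois closure over $\mathbb{Q}$ of $KE_t$ (with $\hat E_t=\mathbb{C}$ if $E_t$ contains transcendental numbers). *Shifts and fiducial data.* Let $L_t=\frac{d_j-1}{2}I+\frac{f_j}{f}\begin{pmatrix}0&-1\\1&0\end{pmatrix}\begin{pmatrix}a&b/2\\b/2&c\end{pmatrix}$ and $\langle\mathbf p,\mathbf q\rangle=p_2q_1-p_1q_2$. A class $\lambda\in\mathbb{Z}/d\mathbb{Z}$ is a *shift* for $t$ if $2\lambda+d_j-1$ is coprime to $d$ and, for all $\mathbf p\in\mathbb{Z}^2$ and every complete set $\mathcal I$ of representatives of $\mathbb{Z}^2/d\mathbb{Z}^2$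 containing $\mathbf 0$ and $\mathbf p$, the sum $\sum_{\mathbf q\in\mathcal I}\omega_d^{r\langle\mathbf p,(\lambda I+L_t)\mathbf q\rangle}\,\mathrm{sf}^{d^{-1}\mathbf q}_{A_t}(\rho_Q)\,\mathrm{sf}^{d^{-1}(\mathbf q-\mathbf p)}_{A_t^{-1}}(\rho_Q)$ equals $d^2$ if $\mathbf p\equiv\mathbf 0\pmod d$ and $0$ otherwise. A *fiducial datum* is $s=(t,G,g)$ with $t$ an admissible tuple, $G\in\mathrm{GL}_2(\mathbb{Z})$ such that $\det(G)\,r\,(2\lambda+d_j-1+d)\equiv1\pmod{\bar d}$ for some shift $\lambda$ of $t$, and $g\in\mathrm{Gal}(\hat E_t/\mathbb{Q})$ with $g(\sqrt{\Delta_0})=-\sqrt{\Delta_0}$. *Overlaps.* Let $X|k\rangle=|k+1 \bmod d\rangle$, $Z|k\rangle=\omega_d^k|k\rangle$ on $\mathbb{C}^d$ and $D_{\mathbf p}=\xi_d^{p_1p_2}X^{p_1}Z^{p_2}$. For a fiducial datum $s=(t,G,g)$ put $\tilde\Pi_s=\frac1d\sum_{\mathbf p\in\mathbb{Z}^2/d\mathbb{Z}^2}\tilde\mu_t(G\mathbf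 p)D_{\mathbf p}$ (the sum over $0\le p_1,p_2<d$), $\Pi_s=g(\tilde\Pi_s)$ (entrywise), $\mu_s(\mathbf p)=\mathrm{Tr}\big(\Pi_sD_{G^{-1}\mathbf p}^\dagger\big)$ and, for $\mathbf p\not\equiv\mathbf 0\pmod d$, the normalized overlap $\nu_s(\mathbf p)=\sqrt{\tfrac{d^2-1}{r(d-r)}}\;\mu_s(\mathbf p)$. **Theorem.** Let $t=(d_j,1,Q)\sim(K,j,1,Q)$ be a rank $1$ admissible tuple and let $n$ be a positive integer coprime to $3$. Put $t'=(d_{nj},1,Q)\sim(K,nj,1,Q)$ and $\kappa=d_{nj}/d_j$. Then $t'$ is an admissible tuple and $\kappa$ is an integer. Moreover, if $s=(t,G,g)$ and $s'=(t',G,g)$ are fiducial data with the same $G$ and the same $g$ (meaning that the automorphisms of $\hat E_t$ and of $\hat E_{t'}$ in the two data coincide on $\hat E_t\cap\hat E_{t'}$), then $$\nu_{s'}(\kappa\mathbf p)=(-1)^{\ell(\mathbf p)}\,\nu_s(\mathbf p)^n\qquad\text{for all }\mathbf p\in\mathbb{Z}^2,\ \mathbf p\not\equiv\mathbf 0\pmod{d_j},$$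 where $$\ell(\mathbf p)=\begin{cases}n+(1+p_1)(1+p_2)&\text{if } d_j \text{ is even and } n\equiv\pm2 \text{ or } \pm5\pmod{12},\\ n+1&\text{otherwise.}\end{cases}$$ -/

import Mathlib

open scoped MatrixGroups Topology NumberField

noncomputable section

namespace SICAlign

open Classical in
/-- Apply an automorphism `g` of a subfield `E ⊆ ℂ` to a complex number lying in `E`
(with the dummy value `0` outside `E`). -/
def galApply {E : IntermediateField ℚ ℂ} (g : E ≃ₐ[ℚ] E) (x : ℂ) : ℂ :=
  if h : x ∈ E then (g ⟨x, h⟩ : ℂ) else 0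

/-! ### The variant `q`-Pochhammer symbols and the Shintani–Faddeev cocycles -/

/-- `ϖ(z, τ) = ∏_{j ≥ 0} (1 - e^{2πi(z + jτ)})`, for `τ` in the upper half plane. -/
def qPoch (z τ : ℂ) : ℂ :=
  ∏' k : ℕ, (1 - Complex.exp (2 * Real.pi * Complex.I * (z + k * τ)))

/-- The finite symbol `ϖ_n(z, τ)` for `n ∈ ℤ`: the product over `0 ≤ k < n` if `n ≥ 0`
and the inverse of the product over `n ≤ k < 0` if `n < 0`. -/
def qPochFin (n : ℤ) (z τ : ℂ) : ℂ :=
  if 0 ≤ n then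
    ∏ k ∈ Finset.Ico 0 n, (1 - Complex.exp (2 * Real.pi * Complex.I * (z + k * τ)))
  else
    ∏ k ∈ Finset.Ico n 0, (1 - Complex.exp (2 * Real.pi * Complex.I * (z + k * τ)))⁻¹

/-- The denominator `j_M(τ) = γ τ + δ`. -/
def jden (M : SL(2, ℤ)) (τ : ℂ) : ℂ := (M 1 0 : ℂ) * τ + (M 1 1 : ℂ)

/-- The fractional linear action `M · τ = (α τ + β) / (γ τ + δ)`. -/
def moeb (M : SL(2, ℤ)) (τ : ℂ) : ℂ := ((M 0 0 : ℂ) * τ + (M 0 1 : ℂ)) / jden M τ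

/-- The Shintani–Faddeev Jacobi cocycle `σ_M(z, τ)`: on `ℂ × ℍ` it is the meromorphic function
`ϖ(z / j_M(τ), M·τ) / ϖ(z, τ)`, and it continues meromorphically to a neighbourhood of the real
points `τ` with `j_M(τ) > 0`. At a point `(z, τ)` of `ℂ × ℍ`, or with `τ` real and
`j_M(τ) > 0`, at which this meromorphic function is holomorphic, its value is the limit of the
quotient over the nearby points of `ℂ × ℍ` at which the denominator does not vanish; this covers
the removable singularities as well as the real points. -/
def sfJacobi (M : SL(2, ℤ)) (z τ : ℂ) : ℂ :=
  Filter.limUnder (𝓝[{w : ℂ × ℂ | 0 < w.2.im ∧ qPoch w.1 w.2 ≠ 0}] (z, τ))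
    (fun w : ℂ × ℂ => qPoch (w.1 / jden M w.2) (moeb M w.2) / qPoch w.1 w.2)

/-- `⟨r, τ⟩ = r₂ τ - r₁`. -/
def pairing (r : Fin 2 → ℚ) (τ : ℂ) : ℂ := (r 1 : ℂ) * τ - (r 0 : ℂ)

/-- The Shintani–Faddeev modular cocycle of `M` with characteristic `r`, for `(M - 1) r ∈ ℤ²`
(so that the floor below is the integer `((1 - M) r)₂` itself). -/
def sfModular (r : Fin 2 → ℚ) (M : SL(2, ℤ)) (τ : ℂ) : ℂ :=
  sfJacobi M (pairing r τ) τ /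
    qPochFin ⌊((1 - M.1.map (Int.cast : ℤ → ℚ)).mulVec r) 1⌋
      (pairing r τ / jden M τ) (moeb M τ)

/-! ### The Rademacher class invariant -/

/-- The sawtooth function `((x))`. -/
def sawtooth (x : ℚ) : ℚ := if Int.fract x = 0 then 0 else Int.fract x - 1 / 2

/-- The Dedekind sum `s(a, b)`. -/
def dedekindSum (a b : ℤ) : ℚ :=
  ∑ n ∈ Finset.Ico (1 : ℤ) |b|, sawtooth ((n : ℚ) / b) * sawtooth ((n : ℚ) * a / b)

/-- The Rademacher class invariant of `M = (α β; γ δ)`. -/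
def rademacher (M : SL(2, ℤ)) : ℚ :=
  if M 1 0 = 0 then (M 0 1 : ℚ) / (M 1 1 : ℚ)
  else
    ((M 0 0 + M 1 1 : ℤ) : ℚ) / (M 1 0 : ℚ) - 3 * ((M 1 0 * (M 0 0 + M 1 1)).sign : ℚ)
      - 12 * ((M 1 0).sign : ℚ) * dedekindSum (M 0 0) (M 1 0)

/-! ### Binary quadratic forms -/

/-- The integral binary quadratic form `a x² + b x y + c y²`. -/
structure QForm where
  a : ℤ
  b : ℤ
  c : ℤ

namespace QForm

variable (Q : QForm)

def disc : ℤ := Q.b ^ 2 - 4 * Q.a * Q.c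

/-- Primitive, indefinite and irreducible over `ℚ`. -/
def IsForm : Prop :=
  Int.gcd (Int.gcd Q.a Q.b) Q.c = 1 ∧ 0 < Q.disc ∧ ¬ IsSquare Q.disc

def eval (p : Fin 2 → ℤ) : ℤ := Q.a * p 0 ^ 2 + Q.b * p 0 * p 1 + Q.c * p 1 ^ 2

/-- Half the Hessian matrix of the form. -/
def toMatrix : Matrix (Fin 2) (Fin 2) ℚ :=
  !![(Q.a : ℚ), (Q.b : ℚ) / 2; (Q.b : ℚ) / 2, (Q.c : ℚ)]

/-- The root `ρ_{Q,+} = (-b + √Δ) / (2a)`. -/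
def rootPlus : ℝ := (-(Q.b : ℝ) + √(Q.disc : ℝ)) / (2 * (Q.a : ℝ))

/-- The stability group `S(Q)`: the `M ∈ GL₂(ℤ)` with `det(M) Mᵀ Q M = Q`. -/
def stab : Set (GL (Fin 2) ℤ) :=
  {M | ((M.1.det : ℤ) : ℚ) •
      ((M.1.map (Int.cast : ℤ → ℚ)).transpose * Q.toMatrix * M.1.map (Int.cast : ℤ → ℚ))
        = Q.toMatrix}

/-- `S_d(Q) = S(Q) ∩ Γ(d)`. -/
def stabLevel (d : ℕ) : Set SL(2, ℤ) :=
  {A | A ∈ CongruenceSubgroup.Gamma d ∧ (A : GL (Fin 2) ℤ) ∈ Q.stab}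

end QForm

/-- The sign of a matrix: the sign of `γ`, or that of `δ` if `γ = 0`. -/
def matSign (M : SL(2, ℤ)) : ℤ := if M 1 0 = 0 then (M 1 1).sign else (M 1 0).sign

/-- The associated stabilizer: the generator `A` of `S_d(Q)` with `sgn(A) = sgn(Q)`. -/
def assocStab (d : ℕ) (Q : QForm) : SL(2, ℤ) :=
  Classical.epsilon fun A =>
    (Subgroup.zpowers A : Set SL(2, ℤ)) = Q.stabLevel d ∧ matSign A = Q.a.sign

/-! ### Real quadratic fields, units, conductors, dimension grids -/

/-- The discriminant of `ℚ(√D)`, for `D` squarefree. -/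
def fundDisc (D : ℕ) : ℕ := if D % 4 = 1 then D else 4 * D

/-- The squarefree part of a positive integer. -/
def sqfreePart (N : ℕ) : ℕ := ∏ p ∈ N.primeFactors with Odd (N.factorization p), p

/-- The fundamental discriminant of a form. -/
def QForm.fundDisc (Q : QForm) : ℕ := SICAlign.fundDisc (sqfreePart Q.disc.toNat)

/-- The conductor `√(Δ / Δ₀)` of a form (an integer). -/
def QForm.conductor (Q : QForm) : ℕ := Nat.sqrt (Q.disc.toNat / Q.fundDisc)

/-- The real quadratic field `K = ℚ(√D)`, as a subfield of `ℝ`. -/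
def quadField (D : ℕ) : IntermediateField ℚ ℝ := IntermediateField.adjoin ℚ {√(D : ℝ)}

/-- The units of the ring of integers of `K` that are greater than `1` and have positive norm. -/
def posNormUnits (D : ℕ) : Set ℝ :=
  {x | 1 < x ∧ ∃ u : (𝓞 (quadField D))ˣ,
    (((u : 𝓞 (quadField D)) : quadField D) : ℝ) = x ∧
      0 < Algebra.norm ℚ ((u : 𝓞 (quadField D)) : quadField D)}

/-- The fundamental totally positive unit `ε`: the smallest unit `> 1` of positive norm. -/
def fundUnit (D : ℕ) : ℝ := sInf (posNormUnits D)

/-- The sequence of conductors `f_j = (ε^j - ε^{-j}) / √Δ₀`. These numbers are integers, so the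
floor only serves to view them in `ℕ`. -/
def condSeq (D j : ℕ) : ℕ :=
  ⌊(fundUnit D ^ j - (fundUnit D ^ j)⁻¹) / √(fundDisc D : ℝ)⌋₊

/-- The rank grid `r_{j,m} = f_{jm} / f_j` (the division is exact). -/
def rankGrid (D j m : ℕ) : ℕ := condSeq D (j * m) / condSeq D j

/-- The dimension grid `d_{j,m} = r_{j,m+1} + r_{j,m}`. -/
def dimGrid (D j m : ℕ) : ℕ := rankGrid D j (m + 1) + rankGrid D j m

/-- The dimension tower `d_j = d_{j,1}`. -/
def dimTower (D j : ℕ) : ℕ := dimGrid D j 1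

/-! ### Admissible tuples -/

/-- The pair `(d, r)` is admissible. -/
def IsAdmissiblePair (d r : ℤ) : Prop :=
  ∃ n : ℤ, 4 < n ∧ 0 < r ∧ 2 * r < d - 1 ∧ n * r * (d - r) = d ^ 2 - 1

/-- The data of a tuple `(d, r, Q) ∼ (K, j, m, Q)`, with `K = ℚ(√D)`. -/
structure QTuple where
  d : ℕ
  r : ℕ
  D : ℕ
  j : ℕ
  m : ℕ
  Q : QForm

/-- `(d, r, Q) ∼ (K, j, m, Q)` is an admissible tuple. -/
structure QTuple.IsAdmissible (t : QTuple) : Prop where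
  one_lt_D : 1 < t.D
  squarefree_D : Squarefree t.D
  j_pos : 0 < t.j
  m_pos : 0 < t.m
  pair : IsAdmissiblePair t.d t.r
  d_eq : t.d = dimGrid t.D t.j t.m
  r_eq : t.r = rankGrid t.D t.j t.m
  isForm : t.Q.IsForm
  fundDisc_eq : t.Q.fundDisc = fundDisc t.D
  conductor_dvd : t.Q.conductor ∣ condSeq t.D t.j

/-- The rank one tuple `(d_j, 1, Q) ∼ (K, j, 1, Q)`. -/
def rankOneTuple (D j : ℕ) (Q : QForm) : QTuple where
  d := dimTower D j
  r := 1
  D := D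
  j := j
  m := 1
  Q := Q

/-! ### Displacement operators -/

/-- `ω_d = e^{2πi/d}`. -/
def omega (d : ℕ) : ℂ := Complex.exp (2 * Real.pi * Complex.I / d)

/-- `ξ_d = -e^{πi/d}`. -/
def xi (d : ℕ) : ℂ := -Complex.exp (Real.pi * Complex.I / d)

/-- `d̄ = d` for odd `d` and `d̄ = 2d` for even `d`. -/
def dbar (d : ℕ) : ℕ := if Even d then 2 * d else d

/-- The shift operator `X |k⟩ = |k + 1 mod d⟩`. -/
def shiftX (d : ℕ) : Matrix (Fin d) (Fin d) ℂ :=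
  Matrix.of fun i k => if (i : ℕ) = ((k : ℕ) + 1) % d then 1 else 0

/-- The phase operator `Z |k⟩ = ω_d^k |k⟩`. -/
def clockZ (d : ℕ) : Matrix (Fin d) (Fin d) ℂ :=
  Matrix.diagonal fun k => omega d ^ (k : ℕ)

/-- The displacement operator `D_p = ξ_d^{p₁p₂} X^{p₁} Z^{p₂}`, `p ∈ ℤ²`. -/
def displacement (d : ℕ) (p : Fin 2 → ℤ) : Matrix (Fin d) (Fin d) ℂ :=
  xi d ^ (p 0 * p 1) • (shiftX d ^ p 0 * clockZ d ^ p 1)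

/-- `p ≡ 0 (mod d)`. -/
def VecZeroMod (d : ℕ) (p : Fin 2 → ℤ) : Prop := ∀ i, (d : ℤ) ∣ p i

/-! ### The Shintani–Faddeev phase and the ghost overlaps -/

namespace QTuple

variable (t : QTuple)

/-- The associated stabilizer `A_t`. -/
def A : SL(2, ℤ) := assocStab t.d t.Q

/-- `ρ_t = ρ_{Q,+}`. -/
def rho : ℂ := (t.Q.rootPlus : ℂ)

/-- The vector `d⁻¹ p`. -/
def scaled (p : Fin 2 → ℤ) : Fin 2 → ℚ := fun i => (p i : ℚ) / (t.d : ℚ)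

/-- The Shintani–Faddeev phase
`(-1)^{s_d(p)} e^{-πi Ψ(A_t)/12} ξ_d^{-(f_{jm}/f) Q(p)}`, with
`s_d(p) = d + (1 + d)(1 + p₁)(1 + p₂)`. -/
def sfPhase (p : Fin 2 → ℤ) : ℂ :=
  (-1 : ℂ) ^ ((t.d : ℤ) + (1 + (t.d : ℤ)) * (1 + p 0) * (1 + p 1))
    * Complex.exp (-(Real.pi * Complex.I / 12) * (rademacher t.A : ℂ))
    * xi t.d ^ (-(((condSeq t.D (t.j * t.m) / t.Q.conductor : ℕ) : ℤ) * t.Q.eval p))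

/-- The candidate normalized ghost overlaps. -/
def normGhostOverlap (p : Fin 2 → ℤ) : ℂ :=
  t.sfPhase p * sfModular (t.scaled p) t.A t.rho

open Classical in
/-- The candidate ghost overlaps. -/
def ghostOverlap (p : Fin 2 → ℤ) : ℂ :=
  if VecZeroMod t.d p then (t.r : ℂ)
  else
    ((√((t.r : ℝ) * ((t.d : ℝ) - t.r) / ((t.d : ℝ) ^ 2 - 1)) : ℝ) : ℂ) * t.normGhostOverlap p

/-- The field `E_t` generated over `ℚ` by the ghost overlaps with `0 ≤ p₁, p₂ < d`, `p ≠ 0`,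
and by `ξ_d`. -/
def field : IntermediateField ℚ ℂ :=
  IntermediateField.adjoin ℚ
    ({xi t.d} ∪ t.ghostOverlap '' {p | p ≠ 0 ∧ ∀ i, 0 ≤ p i ∧ p i < (t.d : ℤ)})

/-- The compositum of `K = ℚ(√D)` and `E_t`. -/
def fieldK : IntermediateField ℚ ℂ :=
  IntermediateField.adjoin ℚ {((√(t.D : ℝ) : ℝ) : ℂ)} ⊔ t.field

open Classical in
/-- The Galois-closed field `Ê_t`: the Galois closure in `ℂ` of `K E_t`, with the convention
that it is `ℂ` if `E_t` contains transcendental numbers. -/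
def galField : IntermediateField ℚ ℂ :=
  if ∀ x ∈ t.field, IsAlgebraic ℚ x then IntermediateField.normalClosure ℚ t.fieldK ℂ else ⊤

/-! ### Shifts -/

/-- The matrix `L_{z,t} = ((d_j - 1)/2) I + (f_j / f) S Q` with `S = (0 -1; 1 0)`. -/
def zaunerGen : Matrix (Fin 2) (Fin 2) ℚ :=
  (((dimTower t.D t.j : ℚ) - 1) / 2) • (1 : Matrix (Fin 2) (Fin 2) ℚ) +
    ((condSeq t.D t.j : ℚ) / (t.Q.conductor : ℚ)) • (!![0, -1; 1, 0] * t.Q.toMatrix)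

/-- `⟨p, (l I + L_{z,t}) q⟩`, where `⟨p, w⟩ = p₂ w₁ - p₁ w₂` (an integer). -/
def shiftPairing (l : ℤ) (p q : Fin 2 → ℤ) : ℚ :=
  let w : Fin 2 → ℚ :=
    ((l : ℚ) • (1 : Matrix (Fin 2) (Fin 2) ℚ) + t.zaunerGen).mulVec fun i => (q i : ℚ)
  (p 1 : ℚ) * w 0 - (p 0 : ℚ) * w 1

open Classical in
/-- The integer `l` represents a shift for `t` (an element of `ℤ/dℤ`). A complete set of coset
representatives of `ℤ²/dℤ²` is a finite set `I` that meets every coset exactly once. -/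
def IsShift (l : ℤ) : Prop :=
  IsCoprime (2 * l + (dimTower t.D t.j : ℤ) - 1) (t.d : ℤ) ∧
  ∀ (p : Fin 2 → ℤ) (I : Finset (Fin 2 → ℤ)),
    (∀ v : Fin 2 → ℤ, ∃! q, q ∈ I ∧ VecZeroMod t.d (v - q)) → 0 ∈ I → p ∈ I →
    ∑ q ∈ I,
      omega t.d ^ ((t.r : ℤ) * ⌊t.shiftPairing l p q⌋)
        * sfModular (t.scaled q) t.A t.rho
        * sfModular (t.scaled (q - p)) t.A⁻¹ t.rho
      = if VecZeroMod t.d p then (t.d : ℂ) ^ 2 else 0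

end QTuple

/-! ### Fiducial data and overlaps -/

/-- A fiducial datum `s = (t, G, g)` containing the tuple `t`. -/
structure FiducialDatum (t : QTuple) where
  G : GL (Fin 2) ℤ
  g : t.galField ≃ₐ[ℚ] t.galField
  admissible : t.IsAdmissible
  twist : ∃ l : ℤ, t.IsShift l ∧
    G.1.det * t.r * (2 * l + (dimTower t.D t.j : ℤ) - 1 + t.d) ≡ 1 [ZMOD (dbar t.d : ℤ)]
  galois : ∃ x : t.galField, (x : ℂ) = ((√(t.Q.fundDisc : ℝ) : ℝ) : ℂ) ∧ g x = -x

namespace FiducialDatum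

variable {t : QTuple} (s : FiducialDatum t)

/-- The candidate ghost fiducial `(1/d) ∑_p μ̃_t(G p) D_p`, the sum being over `0 ≤ p₁, p₂ < d`. -/
def ghostFiducial : Matrix (Fin t.d) (Fin t.d) ℂ :=
  (1 / (t.d : ℂ)) • ∑ k : Fin t.d × Fin t.d,
    t.ghostOverlap (s.G.1.mulVec ![(k.1 : ℤ), (k.2 : ℤ)]) •
      displacement t.d ![(k.1 : ℤ), (k.2 : ℤ)]

/-- The candidate fiducial `Π_s = g(Π̃_s)` (entrywise). -/
def fiducial : Matrix (Fin t.d) (Fin t.d) ℂ := s.ghostFiducial.map (galApply s.g)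

/-- The candidate overlaps `Tr(Π_s D_{G⁻¹p}†)`. -/
def overlap (p : Fin 2 → ℤ) : ℂ :=
  (s.fiducial * (displacement t.d ((s.G⁻¹).1.mulVec p)).conjTranspose).trace

/-- The normalized candidate overlaps `√((d² - 1)/(r(d - r))) · μ_s(p)`. -/
def normOverlap (p : Fin 2 → ℤ) : ℂ :=
  ((√(((t.d : ℝ) ^ 2 - 1) / ((t.r : ℝ) * ((t.d : ℝ) - t.r))) : ℝ) : ℂ) * s.overlap p

end FiducialDatum

/-- Two fiducial data `s = (t, G, g)` and `s' = (t', G, g)` with the same `G` and `g`. As `g` acts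
on `Ê_t` and on `Ê_{t'}`, having the same `g` means that the two automorphisms coincide on the
numbers on which both act. -/
def SameTwistAndGalois {t t' : QTuple} (s : FiducialDatum t) (s' : FiducialDatum t') : Prop :=
  s'.G = s.G ∧ ∀ x ∈ t.galField ⊓ t'.galField, galApply s'.g x = galApply s.g x

/-- The exponent `ℓ(p)`. -/
def signExp (d n : ℕ) (p : Fin 2 → ℤ) : ℤ :=
  if Even d ∧ (n % 12 = 2 ∨ n % 12 = 10 ∨ n % 12 = 5 ∨ n % 12 = 7) then
    (n : ℤ) + (1 + p 0) * (1 + p 1)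
  else (n : ℤ) + 1

end SICAlign

end

open SICAlign

noncomputable section

namespace SICAlign

/-! Write d = d_j, d' = d_{nj} = κd, x = ε^j and T = x + 1/x = d - 1. The power relation is first
proved for ghost overlaps, factor by factor, and then transported by the Galois automorphism.

The cocycle factor. The matrix A_t is the automorph of Q with eigenvalue x³
(`LevelData.assocStab_spec`), so A_{t'} = A_tⁿ. The characteristics κp/d' and p/d coincide. At a
real fixed point ρ of M the value sf_M^r(ρ) is the limit of ϖ_r(M·τ)/ϖ_r(τ) as τ → ρ from the upper
half plane, where ϖ_r(τ) = ϖ(⟨r,τ⟩,τ) (`tendsto_sfModular`); this quotient telescopes along powers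
of M, whence sf_{Aⁿ} = sf_Aⁿ (`sfModular_pow`). The limits must first be shown to exist
(`hasLim_of_pos`). For M = S, the logarithmic derivative in z of ϖ(z/τ,-1/τ)/ϖ(z,τ) differs from an
explicit lattice sum plus a linear term by a doubly periodic holomorphic function, which is constant
by the maximum principle. The duplication formula determines this constant, and the constant of
integration up to a cube root of unity, by expressions that stay finite at positive real τ. Euclid's
algorithm in SL(2,ℤ) reduces general M to S and T.

The Rademacher factor. Dedekind reciprocity gives the composition law of Φ (`dedekindPhi_mul`). For
powers of a hyperbolic matrix of positive trace its sign correction is exactly absorbed by the term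
that turns Φ into Ψ, so Ψ(Aⁿ) = nΨ(A) (`rademacher_pow`).

The root of unity. With V_n = xⁿ + x⁻ⁿ and U_n = (xⁿ - x⁻ⁿ)/(x - x⁻¹) one has d' = V_n + 1 and
f_{nj} = f_j U_n, while ξ_{d'}^κ = ±ξ_d; so everything depends on κU_n modulo d, or modulo 2d for d
even. Since T = d - 1, V_3 = T³ - 3T ≡ 2 mod d², so along n, n + 3, n + 6, ... both sequences are
arithmetic progressions modulo d². This yields d ∣ d' and κU_n ≡ n mod d when n is prime to 3. For
even d, working modulo 2d² adds a triangular number, whose parity depends on n mod 12; this produces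
the exceptional sign in ℓ(p) (`ratio_mul_lucU_even`, `LevelData.ghostNu_mul`).

The Galois step. If g(ξ_d) = ξ_d^e and ef ≡ 1, orthogonality of the displacement operators shows
that the overlap at p is the g-conjugate of the single ghost overlap at G diag(1,f) G⁻¹p
(`overlap_eq`). The same e and f serve at both levels because ξ_d is ± a power of ξ_{d'}. Finally d'
+ 1 = V_n + 2 is a square times (d + 1)ⁿ up to rational squares, so the normalizations differ by a
rational number, which g fixes (`exists_rat_sqrt`, `normOverlap_tower`). -/

section Analysis

open Filter Complex

/-! ### The infinite product `ϖ` -/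

/-- `e(w) = exp(2πiw)`. -/
def ex (w : ℂ) : ℂ := Complex.exp (2 * Real.pi * Complex.I * w)

lemma ex_add (a b : ℂ) : ex (a + b) = ex a * ex b := by
  simp only [ex, ← Complex.exp_add]; ring_nf

lemma ex_one : ex 1 = 1 := by simp [ex, Complex.exp_two_pi_mul_I]

lemma ex_intCast (n : ℤ) : ex n = 1 := by
  unfold ex; rw [Complex.exp_eq_one_iff]; exact ⟨n, by ring⟩

lemma ex_half : ex (1 / 2) = -1 := by
  unfold ex; rw [← Complex.exp_pi_mul_I]; congr 1; ring

lemma ex_eq_one_iff (w : ℂ) : ex w = 1 ↔ ∃ n : ℤ, w = n := by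
  unfold ex
  rw [Complex.exp_eq_one_iff]
  refine exists_congr fun n => ?_
  have h : (2 * Real.pi * Complex.I : ℂ) ≠ 0 := Complex.two_pi_I_ne_zero
  rw [mul_comm (n : ℂ)]
  exact ⟨fun h' => mul_left_cancel₀ h h', fun h' => by rw [h']⟩

lemma norm_ex (w : ℂ) : ‖ex w‖ = Real.exp (-(2 * Real.pi * w.im)) := by
  simp [ex, Complex.norm_exp]

@[fun_prop]
lemma differentiable_ex : Differentiable ℂ ex := by unfold ex; fun_prop

@[fun_prop]
lemma continuous_ex : Continuous ex := differentiable_ex.continuous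

lemma hasDerivAt_ex (w : ℂ) : HasDerivAt ex (2 * Real.pi * Complex.I * ex w) w := by
  have := ((hasDerivAt_id w).const_mul (2 * Real.pi * Complex.I : ℂ)).cexp
  refine this.congr_deriv ?_
  simp only [ex, id, mul_one]; ring

lemma qPoch_eq (z τ : ℂ) : qPoch z τ = ∏' k : ℕ, (1 + -ex (z + k * τ)) := by
  simp [qPoch, ex, sub_eq_add_neg]

lemma norm_ex_term_le {z τ : ℂ} {B δ : ℝ} (hz : -B ≤ z.im) (hτ : δ ≤ τ.im) (k : ℕ) :
    ‖-ex (z + k * τ)‖ ≤ Real.exp (2 * Real.pi * B) * Real.exp (-(2 * Real.pi * δ)) ^ k := by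
  rw [norm_neg, norm_ex, ← Real.exp_nat_mul, ← Real.exp_add]
  apply Real.exp_le_exp.2
  have him : (z + k * τ).im = z.im + k * τ.im := by simp
  rw [him]
  have h1 : (k : ℝ) * δ ≤ k * τ.im := by gcongr
  have := Real.pi_pos
  nlinarith [mul_le_mul_of_nonneg_left (add_le_add hz h1) (by positivity : (0:ℝ) ≤ 2 * Real.pi)]

lemma summable_ex_bound (B : ℝ) {δ : ℝ} (hδ : 0 < δ) :
    Summable fun k : ℕ => Real.exp (2 * Real.pi * B) * Real.exp (-(2 * Real.pi * δ)) ^ k := by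
  refine (summable_geometric_of_lt_one (Real.exp_nonneg _) ?_).mul_left _
  rw [Real.exp_lt_one_iff]
  have := Real.pi_pos
  have : 0 < 2 * Real.pi * δ := by positivity
  linarith

lemma summable_norm_ex (z : ℂ) {τ : ℂ} (hτ : 0 < τ.im) :
    Summable fun k : ℕ => ‖-ex (z + k * τ)‖ :=
  Summable.of_nonneg_of_le (fun _ => norm_nonneg _)
    (fun k => norm_ex_term_le (B := -z.im) (by simp) le_rfl k) (summable_ex_bound _ hτ)

lemma multipliable_qPoch (z : ℂ) {τ : ℂ} (hτ : 0 < τ.im) :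
    Multipliable fun k : ℕ => (1 + -ex (z + k * τ)) :=
  multipliable_one_add_of_summable (summable_norm_ex z hτ)

lemma qPoch_ne_zero {z τ : ℂ} (hτ : 0 < τ.im) (h : ∀ (k : ℕ) (m : ℤ), z + k * τ ≠ m) :
    qPoch z τ ≠ 0 := by
  rw [qPoch_eq]
  refine tprod_one_add_ne_zero_of_summable (fun k hk => ?_) (summable_norm_ex z hτ)
  have : ex (z + k * τ) = 1 := by linear_combination -hk
  obtain ⟨m, hm⟩ := (ex_eq_one_iff _).1 this
  exact h k m hm

lemma qPoch_add_one (z τ : ℂ) : qPoch (z + 1) τ = qPoch z τ := by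
  simp only [qPoch_eq]
  congr 1; ext k
  rw [show z + 1 + k * τ = (z + k * τ) + 1 by ring, ex_add, ex_one, mul_one]

lemma qPoch_add_intCast (z τ : ℂ) (n : ℤ) : qPoch (z + n) τ = qPoch z τ := by
  simp only [qPoch_eq]
  congr 1; ext k
  rw [show z + n + k * τ = (z + k * τ) + n by ring, ex_add, ex_intCast, mul_one]

lemma qPoch_eq_mul (z : ℂ) {τ : ℂ} (hτ : 0 < τ.im) :
    qPoch z τ = (1 - ex z) * qPoch (z + τ) τ := by
  rw [qPoch_eq, qPoch_eq, tprod_eq_zero_mul']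
  · simp only [Nat.cast_zero, zero_mul, add_zero, ← sub_eq_add_neg]
    congr 1; refine tprod_congr fun k => ?_
    rw [show z + ((k + 1 : ℕ) : ℂ) * τ = z + τ + k * τ by push_cast; ring]
  · refine (multipliable_qPoch (z + τ) hτ).congr fun k => ?_
    rw [show z + ((k + 1 : ℕ) : ℂ) * τ = z + τ + k * τ by push_cast; ring]

/-- Near a given point the factors differ from 1 by at most the terms of a fixed geometric series,
so the product converges locally uniformly in both variables jointly. -/
lemma continuousOn_qPoch :
    ContinuousOn (fun w : ℂ × ℂ => qPoch w.1 w.2) {w | 0 < w.2.im} := by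
  intro w hw
  have hw : 0 < w.2.im := hw
  set K : Set (ℂ × ℂ) := {v | -(1 - w.1.im) < v.1.im ∧ w.2.im / 2 < v.2.im} with hKdef
  have hK : IsOpen K := by
    exact (isOpen_lt continuous_const (Complex.continuous_im.comp continuous_fst)).inter
      (isOpen_lt continuous_const (Complex.continuous_im.comp continuous_snd))
  have hwK : w ∈ K := ⟨by simp, by simpa using hw⟩
  have := Summable.hasProdLocallyUniformlyOn_nat_one_add (R := ℂ)
    (f := fun (k : ℕ) (v : ℂ × ℂ) => -ex (v.1 + k * v.2)) hK
    (summable_ex_bound (1 - w.1.im) (half_pos hw))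
    (Eventually.of_forall fun n v hv => norm_ex_term_le hv.1.le hv.2.le n)
    (fun n => Continuous.continuousOn (by fun_prop))
  have hc : ContinuousOn (fun v : ℂ × ℂ => ∏' k : ℕ, (1 + -ex (v.1 + k * v.2))) K := by
    refine this.tendstoLocallyUniformlyOn_finsetRange.continuousOn (Frequently.of_forall fun n => ?_)
    exact Continuous.continuousOn (by fun_prop)
  simp only [qPoch_eq]
  exact (hc.continuousAt (hK.mem_nhds hwK)).continuousWithinAt

lemma differentiable_qPoch {τ : ℂ} (hτ : 0 < τ.im) : Differentiable ℂ fun z => qPoch z τ := by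
  intro z
  set K : Set ℂ := {v | -(1 - z.im) < v.im} with hKdef
  have hK : IsOpen K := isOpen_lt continuous_const (by fun_prop)
  have hwK : z ∈ K := by simp [hKdef]
  have := Summable.hasProdLocallyUniformlyOn_nat_one_add (R := ℂ)
    (f := fun (k : ℕ) (v : ℂ) => -ex (v + k * τ)) hK
    (summable_ex_bound (1 - z.im) hτ)
    (Eventually.of_forall fun n v hv => norm_ex_term_le (le_of_lt hv) le_rfl n)
    (fun n => Continuous.continuousOn (by fun_prop))
  have hc : DifferentiableOn ℂ (fun v : ℂ => ∏' k : ℕ, (1 + -ex (v + k * τ))) K := by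
    refine this.tendstoLocallyUniformlyOn_finsetRange.differentiableOn
      (Eventually.of_forall fun n => ?_) hK
    exact DifferentiableOn.fun_finsetProd fun i _ => by fun_prop
  simp only [qPoch_eq]
  exact hc.differentiableAt (hK.mem_nhds hwK)

/-- Duplication: `ϖ(2z, τ)` is the product of `ϖ` over the translates by half periods. -/
lemma qPoch_two_mul (z : ℂ) {τ : ℂ} (hτ : 0 < τ.im) :
    qPoch (2 * z) τ = qPoch z τ * qPoch (z + 1 / 2) τ * qPoch (z + τ / 2) τ *
      qPoch (z + 1 / 2 + τ / 2) τ := by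
  have hm := fun w => multipliable_qPoch w hτ
  -- From (1 - e(w))(1 - e(w + 1/2)) = 1 - e(2w). Translating by τ/2 then supplies the odd-indexed
  -- factors of ϖ(2z, τ).
  have h2 : ∀ (w : ℂ) (k : ℕ), (1 + -ex (w + k * τ)) * (1 + -ex (w + 1 / 2 + k * τ)) =
      1 + -ex (2 * (w + k * τ)) := by
    intro w k
    rw [show w + 1 / 2 + k * τ = (w + k * τ) + 1 / 2 by ring, ex_add (w + k * τ) (1 / 2), ex_half,
      two_mul, ex_add (w + k * τ) (w + k * τ)]
    ring
  have hmul : ∀ w : ℂ, Multipliable fun k : ℕ => (1 + -ex (2 * (w + k * τ))) := fun w =>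
    ((hm w).mul (hm (w + 1 / 2))).congr fun k => h2 w k
  have key : ∀ w : ℂ, qPoch w τ * qPoch (w + 1 / 2) τ = ∏' k : ℕ, (1 + -ex (2 * (w + k * τ))) := by
    intro w
    rw [qPoch_eq, qPoch_eq, ← (hm _).tprod_mul (hm _)]
    exact tprod_congr fun k => h2 w k
  have hev : ∀ k : ℕ, 1 + -ex (2 * (z + k * τ)) = 1 + -ex (2 * z + ((2 * k : ℕ) : ℂ) * τ) := by
    intro k
    rw [show 2 * (z + k * τ) = 2 * z + ((2 * k : ℕ) : ℂ) * τ by push_cast; ring]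
  have hod : ∀ k : ℕ, 1 + -ex (2 * (z + τ / 2 + k * τ)) =
      1 + -ex (2 * z + ((2 * k + 1 : ℕ) : ℂ) * τ) := by
    intro k
    rw [show 2 * (z + τ / 2 + k * τ) = 2 * z + ((2 * k + 1 : ℕ) : ℂ) * τ by push_cast; ring]
  rw [show z + 1 / 2 + τ / 2 = z + τ / 2 + 1 / 2 by ring, mul_assoc, key, key, qPoch_eq,
    tprod_congr hev, tprod_congr hod]
  exact (tprod_even_mul_odd (f := fun k : ℕ => 1 + -ex (2 * z + (k : ℂ) * τ))
    ((hmul z).congr hev) ((hmul _).congr hod)).symm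

/-! ### Lattice sums over a quadrant -/

/-- The points `(k + 1/2) + (m + 1/2) τ` of the shifted quadrant. -/
def lam (τ : ℂ) (p : ℕ × ℕ) : ℂ := ((p.1 : ℂ) + 1 / 2) + ((p.2 : ℂ) + 1 / 2) * τ

/-- The logarithmic derivative in `u` of `(1 - u/λ) (1 + u/λ)⁻¹ e^{2u/λ}`. -/
def latTerm (u τ : ℂ) (p : ℕ × ℕ) : ℂ := 1 / (u - lam τ p) - 1 / (u + lam τ p) + 2 / lam τ p

def latSum (u τ : ℂ) : ℂ := ∑' p : ℕ × ℕ, latTerm u τ p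

def latLogTerm (u τ : ℂ) (p : ℕ × ℕ) : ℂ :=
  Complex.log (1 - u / lam τ p) - Complex.log (1 + u / lam τ p) + 2 * (u / lam τ p)

def latLog (u τ : ℂ) : ℂ := ∑' p : ℕ × ℕ, latLogTerm u τ p

def quadWeight (p : ℕ × ℕ) : ℝ := 1 / ((p.1 : ℝ) + p.2 + 1) ^ 3

lemma quadWeight_nonneg (p : ℕ × ℕ) : 0 ≤ quadWeight p := by unfold quadWeight; positivity

/-- Since (k + m + 1)² ≥ (k + 1)(m + 1), the weight is at most a product of two terms of the
convergent series with exponent 3/2. -/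
lemma summable_quadWeight : Summable quadWeight := by
  have h : Summable fun n : ℕ => 1 / ((n : ℝ) + 1) ^ (3 / 2 : ℝ) := by
    have := (summable_nat_add_iff 1).2 (Real.summable_one_div_nat_rpow.2 (by norm_num : (1:ℝ) < 3 / 2))
    simpa using this
  refine Summable.of_nonneg_of_le quadWeight_nonneg (fun p => ?_)
    (h.mul_of_nonneg h (fun n => by positivity) (fun n => by positivity))
  rw [one_div_mul_one_div, ← Real.mul_rpow (by positivity) (by positivity)]
  unfold quadWeight
  have h3 : ((p.1 : ℝ) + p.2 + 1) ^ 3 = ((((p.1 : ℝ) + p.2 + 1)) ^ 2) ^ (3 / 2 : ℝ) := by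
    rw [← Real.rpow_natCast _ 2, ← Real.rpow_mul (by positivity), ← Real.rpow_natCast]
    norm_num
  rw [h3]
  apply one_div_le_one_div_of_le (by positivity)
  apply Real.rpow_le_rpow (by positivity) _ (by norm_num)
  have h1 : (0:ℝ) ≤ p.1 := by positivity
  have h2 : (0:ℝ) ≤ p.2 := by positivity
  nlinarith [mul_nonneg h1 h2]

lemma le_re_lam {τ : ℂ} {δ : ℝ} (hδ1 : δ ≤ 1) (hτ : δ ≤ τ.re) (p : ℕ × ℕ) :
    δ * ((p.1 : ℝ) + p.2 + 1) ≤ (lam τ p).re := by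
  have h : (lam τ p).re = ((p.1 : ℝ) + 1 / 2) + ((p.2 : ℝ) + 1 / 2) * τ.re := by simp [lam]
  rw [h]
  have h1 : ((p.1 : ℝ) + 1 / 2) * δ ≤ ((p.1 : ℝ) + 1 / 2) * 1 := by gcongr
  have h2 : ((p.2 : ℝ) + 1 / 2) * δ ≤ ((p.2 : ℝ) + 1 / 2) * τ.re := by gcongr
  linarith

lemma half_le_re_lam {τ : ℂ} {δ : ℝ} (hδ : 0 ≤ δ) (hτ : δ ≤ τ.re) (p : ℕ × ℕ) :
    (1 + δ) / 2 ≤ (lam τ p).re := by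
  have h : (lam τ p).re = ((p.1 : ℝ) + 1 / 2) + ((p.2 : ℝ) + 1 / 2) * τ.re := by simp [lam]
  rw [h]
  have h2 : (1 / 2) * δ ≤ ((p.2 : ℝ) + 1 / 2) * τ.re := by
    gcongr; linarith [(by positivity : (0:ℝ) ≤ p.2)]
  linarith [(by positivity : (0:ℝ) ≤ p.1)]

lemma lam_ne_zero {τ : ℂ} (hτ : 0 < τ.re) (p : ℕ × ℕ) : lam τ p ≠ 0 := by
  intro h
  have := half_le_re_lam le_rfl hτ.le p
  rw [h] at this; norm_num at this

/-- The constant in the bound for the terms of `latSum`. -/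
def latConst (R η δ : ℝ) : ℝ := 2 * R ^ 2 / (min (1 / 2) (η / (2 * R)) ^ 2 * δ ^ 3)

/-- The three fractions combine to 2u²/(λ(u - λ)(u + λ)), of cubic decay. Both |u ± λ| are at least
min(1/2, η/(2R))·|λ|: for |λ| ≥ 2R by the triangle inequality, and otherwise because they are at
least η. -/
lemma norm_latTerm_le {u τ : ℂ} {R η δ : ℝ} (hδ : 0 < δ) (hδ1 : δ ≤ 1) (hτ : δ ≤ τ.re)
    (hη : 0 < η) (hR : 0 < R) (hu : ‖u‖ ≤ R) (p : ℕ × ℕ) (h1 : η ≤ ‖u - lam τ p‖)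
    (h2 : η ≤ ‖u + lam τ p‖) : ‖latTerm u τ p‖ ≤ latConst R η δ * quadWeight p := by
  set l := lam τ p with hl
  have hl0 : l ≠ 0 := lam_ne_zero (hδ.trans_le hτ) p
  have hc : 0 < min (1 / 2) (η / (2 * R)) := by positivity
  set c := min (1 / 2) (η / (2 * R)) with hcdef
  have hN : δ * ((p.1 : ℝ) + p.2 + 1) ≤ ‖l‖ :=
    (le_re_lam hδ1 hτ p).trans (Complex.re_le_norm _)
  have aux : ∀ v : ℂ, η ≤ ‖v‖ → ‖l‖ - R ≤ ‖v‖ → c * ‖l‖ ≤ ‖v‖ := by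
    intro v hv1 hv2
    by_cases h : 2 * R ≤ ‖l‖
    · have : c * ‖l‖ ≤ (1 / 2) * ‖l‖ := by gcongr; exact min_le_left _ _
      linarith
    · push Not at h
      have : c * ‖l‖ ≤ (η / (2 * R)) * (2 * R) := by
        gcongr
        exact min_le_right _ _
      rw [div_mul_cancel₀ _ (by positivity)] at this
      linarith
  have hm : c * ‖l‖ ≤ ‖u - l‖ := aux _ h1 (by
    have := norm_sub_norm_le l u; rw [norm_sub_rev] at this; linarith)
  have hp : c * ‖l‖ ≤ ‖u + l‖ := aux _ h2 (by
    have := norm_sub_norm_le l (-u); rw [sub_neg_eq_add, add_comm l u, norm_neg] at this; linarith)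
  have hum : u - l ≠ 0 := by rw [← norm_pos_iff]; linarith
  have hup : u + l ≠ 0 := by rw [← norm_pos_iff]; linarith
  have hF : latTerm u τ p = 2 * u ^ 2 / (l * ((u - l) * (u + l))) := by
    unfold latTerm; rw [← hl]; field_simp; ring
  have hlpos : 0 < ‖l‖ := norm_pos_iff.2 hl0
  have hNpos : (0:ℝ) < (p.1 : ℝ) + p.2 + 1 := by positivity
  rw [hF, norm_div, norm_mul, norm_mul, norm_mul, norm_pow]
  calc ‖(2:ℂ)‖ * ‖u‖ ^ 2 / (‖l‖ * (‖u - l‖ * ‖u + l‖))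
      ≤ 2 * R ^ 2 / ((δ * ((p.1 : ℝ) + p.2 + 1)) * ((c * (δ * ((p.1 : ℝ) + p.2 + 1))) *
          (c * (δ * ((p.1 : ℝ) + p.2 + 1))))) := by
        have e1 : c * (δ * ((p.1 : ℝ) + p.2 + 1)) ≤ ‖u - l‖ := le_trans (by gcongr) hm
        have e2 : c * (δ * ((p.1 : ℝ) + p.2 + 1)) ≤ ‖u + l‖ := le_trans (by gcongr) hp
        have e0 : ‖(2:ℂ)‖ = 2 := by simp
        rw [e0]
        gcongr
    _ = latConst R η δ * quadWeight p := by
        unfold latConst quadWeight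
        rw [← hcdef]
        field_simp

/-- Telescoping in one variable of a double sum. -/
lemma tsum_telescope {Φ : ℕ × ℕ → ℂ} {a : ℕ → ℕ → ℂ} (hs : Summable Φ)
    (h : ∀ p, Φ p = a p.2 p.1 - a p.2 (p.1 + 1)) (ha : ∀ m, Tendsto (a m) atTop (𝓝 0)) :
    ∑' p, Φ p = ∑' m, a m 0 ∧ Summable fun m => a m 0 := by
  have hs' : Summable (Φ ∘ Prod.swap) := (Equiv.prodComm ℕ ℕ).summable_iff.2 hs
  have hfib : ∀ m, ∑' k, Φ (k, m) = a m 0 := by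
    intro m
    have h1 : Summable fun k => Φ (k, m) := hs'.prod_factor m
    refine tendsto_nhds_unique h1.hasSum.tendsto_sum_nat ?_
    have h2 : ∀ n, ∑ k ∈ Finset.range n, Φ (k, m) = a m 0 - a m n := by
      intro n
      rw [← Finset.sum_range_sub']
      exact Finset.sum_congr rfl fun k _ => h (k, m)
    simp only [h2]
    simpa using tendsto_const_nhds.sub (ha m)
  have e1 : ∑' p, Φ p = ∑' p, (Φ ∘ Prod.swap) p := ((Equiv.prodComm ℕ ℕ).tsum_eq Φ).symm
  constructor
  · rw [e1, hs'.tsum_prod]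
    exact tsum_congr hfib
  · exact hs'.prod.congr hfib

lemma tendsto_one_div_add_nat (c : ℂ) : Tendsto (fun k : ℕ => 1 / (c + k)) atTop (𝓝 0) := by
  have h : Tendsto (fun k : ℕ => ‖c + (k:ℂ)‖) atTop atTop := by
    refine tendsto_atTop_mono (f := fun k : ℕ => (k : ℝ) - ‖c‖) (fun k => ?_) ?_
    · have := norm_sub_norm_le (k : ℂ) (-c)
      rw [sub_neg_eq_add, add_comm, norm_neg] at this
      simpa using this
    · exact tendsto_atTop_add_const_right _ _ tendsto_natCast_atTop_atTop
  simp only [one_div]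
  exact tendsto_inv₀_cobounded.comp (tendsto_norm_atTop_iff_cobounded.1 h)

/-- The Mittag-Leffler expansion of the cotangent, with terms grouped asymmetrically. -/
lemma tsum_shifted_cot {x : ℂ} (hx : x ∈ Complex.integerComplement) :
    ∑' m : ℕ, (1 / (x - (m + 1)) + 1 / (x + m)) = Real.pi * Complex.cot (Real.pi * x) := by
  have h1 : HasSum (fun n : ℕ => cotTerm x n) (Real.pi * cot (Real.pi * x) - 1 / x) := by
    rw [cot_series_rep' hx]
    exact (summable_cotTerm hx).hasSum
  have hx0 := Complex.integerComplement_add_ne_zero hx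
  have h2 : Summable fun m : ℕ => (1 / (x + m) - 1 / (x + ((m + 1 : ℕ) : ℂ))) := by
    have hb : Summable fun m : ℕ => 1 / ((x + m) * (x + ((m + 1 : ℕ) : ℂ))) := by
      have := EisensteinSeries.summable_linear_right_add_one_mul_linear_right x 1 1
      have h' := this.comp_injective (i := fun n : ℕ => (n : ℤ)) Nat.cast_injective
      refine h'.congr fun m => ?_
      simp only [Function.comp]
      push_cast
      rw [one_div, mul_comm]
      congr 2 <;> ring
    refine hb.congr fun m => ?_
    have e1 : x + m ≠ 0 := by simpa using hx0 m
    have e2 : x + ((m + 1 : ℕ) : ℂ) ≠ 0 := by simpa using hx0 ((m + 1 : ℕ) : ℤ)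
    field_simp
    push_cast; ring
  have h3 : HasSum (fun m : ℕ => (1 / (x + m) - 1 / (x + ((m + 1 : ℕ) : ℂ)))) (1 / x) := by
    have := h2.hasSum
    convert this using 1
    refine tendsto_nhds_unique ?_ this.tendsto_sum_nat
    simp only [Finset.sum_range_sub' (fun m : ℕ => 1 / (x + (m:ℂ)))]
    simpa using (tendsto_const_nhds (x := 1 / x)).sub (tendsto_one_div_add_nat x)
  have := (h1.add h3).tsum_eq
  rw [sub_add_cancel] at this
  rw [← this]
  refine tsum_congr fun m => ?_
  simp only [cotTerm]
  push_cast; ring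

/-! ### The quotient `ϖ(z/τ, -1/τ) / ϖ(z, τ)` on the quadrant `Im z > 0`, `Im (z/τ) > 0` -/

/-- The open quadrant `{x + yτ : x < 0 < y}`. -/
def quadrant (τ : ℂ) : Set ℂ := {z | 0 < z.im ∧ 0 < (z / τ).im}

/-- The coordinate `u = z + 1/2 - τ/2` centered at the symmetry point. -/
def cen (z τ : ℂ) : ℂ := z + 1 / 2 - τ / 2

/-- `ϖ(z/τ, -1/τ) / ϖ(z, τ)`. -/
def sig (z τ : ℂ) : ℂ := qPoch (z / τ) (-1 / τ) / qPoch z τ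

lemma im_inv_neg {τ : ℂ} (hτ : 0 < τ.im) : (1 / τ).im < 0 := by
  have h0 : τ ≠ 0 := by rintro rfl; simp at hτ
  rw [one_div, Complex.inv_im]
  have := Complex.normSq_pos.2 h0
  exact div_neg_of_neg_of_pos (by linarith) this

lemma im_neg_inv_pos {τ : ℂ} (hτ : 0 < τ.im) : 0 < (-1 / τ).im := by
  have := im_inv_neg hτ
  rw [neg_div, Complex.neg_im]; linarith

lemma ne_zero_of_im {τ : ℂ} (hτ : 0 < τ.im) : τ ≠ 0 := by rintro rfl; simp at hτ

lemma isOpen_quadrant (τ : ℂ) : IsOpen (quadrant τ) :=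
  (isOpen_lt continuous_const Complex.continuous_im).inter
    (isOpen_lt continuous_const (Complex.continuous_im.comp (continuous_id.div_const τ)))

lemma convex_quadrant (τ : ℂ) : Convex ℝ (quadrant τ) := by
  intro x hx y hy a b ha hb hab
  have aux : ∀ p q : ℝ, 0 < p → 0 < q → 0 < a * p + b * q := by
    intro p q hp hq
    rcases ha.eq_or_lt with h | h
    · have : b = 1 := by linarith
      subst h; subst this; simpa using hq
    · have := mul_pos h hp
      have := mul_nonneg hb hq.le
      linarith
  constructor
  · have := aux _ _ hx.1 hy.1
    simpa using this
  · have := aux _ _ hx.2 hy.2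
    have e : ((a • x + b • y) / τ).im = a * (x / τ).im + b * (y / τ).im := by
      rw [add_div, smul_div_assoc, smul_div_assoc]; simp
    rw [e]; exact this

lemma quadrant_sub_one {z τ : ℂ} (hτ : 0 < τ.im) (hz : z ∈ quadrant τ) : z - 1 ∈ quadrant τ := by
  refine ⟨by simpa using hz.1, ?_⟩
  rw [sub_div, Complex.sub_im]
  have := im_inv_neg hτ
  have := hz.2
  linarith

lemma quadrant_add {z τ : ℂ} (hτ : 0 < τ.im) (hz : z ∈ quadrant τ) : z + τ ∈ quadrant τ := by
  refine ⟨by simpa using add_pos hz.1 hτ, ?_⟩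
  rw [add_div, div_self (ne_zero_of_im hτ)]
  simpa using hz.2

lemma cen_sub_lam (z τ : ℂ) (p : ℕ × ℕ) : cen z τ - lam τ p = z - p.1 - (p.2 + 1) * τ := by
  unfold cen lam; ring

lemma cen_add_lam (z τ : ℂ) (p : ℕ × ℕ) : cen z τ + lam τ p = z + (p.1 + 1) + p.2 * τ := by
  unfold cen lam; ring

lemma le_norm_cen_sub_lam {z τ : ℂ} (hτ : 0 < τ.im) (p : ℕ × ℕ) :
    ‖τ‖ * (z / τ).im ≤ ‖cen z τ - lam τ p‖ := by
  have h0 := ne_zero_of_im hτ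
  rw [cen_sub_lam]
  have h1 : z - p.1 - (p.2 + 1) * τ = τ * (z / τ - p.1 * (1 / τ) - (p.2 + 1)) := by
    field_simp
  rw [h1, norm_mul]
  gcongr
  refine le_trans ?_ (Complex.im_le_norm _)
  have h2 : (z / τ - p.1 * (1 / τ) - (p.2 + 1)).im = (z / τ).im - p.1 * (1 / τ).im := by
    simp
  rw [h2]
  have := im_inv_neg hτ
  have h3 : (p.1 : ℝ) * (1 / τ).im ≤ 0 := mul_nonpos_of_nonneg_of_nonpos (by positivity) this.le
  linarith

lemma le_norm_cen_add_lam {z τ : ℂ} (hτ : 0 < τ.im) (p : ℕ × ℕ) :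
    z.im ≤ ‖cen z τ + lam τ p‖ := by
  rw [cen_add_lam]
  refine le_trans ?_ (Complex.im_le_norm _)
  have h2 : (z + (p.1 + 1) + p.2 * τ).im = z.im + p.2 * τ.im := by simp
  rw [h2]
  have : 0 ≤ (p.2 : ℝ) * τ.im := by positivity
  linarith

lemma cen_sub_lam_ne {z τ : ℂ} (hτ : 0 < τ.im) (hz : z ∈ quadrant τ) (p : ℕ × ℕ) :
    cen z τ - lam τ p ≠ 0 := by
  rw [← norm_pos_iff]
  refine lt_of_lt_of_le ?_ (le_norm_cen_sub_lam hτ p)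
  exact mul_pos (norm_pos_iff.2 (ne_zero_of_im hτ)) hz.2

lemma cen_add_lam_ne {z τ : ℂ} (hτ : 0 < τ.im) (hz : z ∈ quadrant τ) (p : ℕ × ℕ) :
    cen z τ + lam τ p ≠ 0 := by
  rw [← norm_pos_iff]
  exact lt_of_lt_of_le hz.1 (le_norm_cen_add_lam hτ p)

lemma exists_latTerm_bound {z₀ τ : ℂ} (hτ : 0 < τ.im) (hτ' : 0 < τ.re) (hz : z₀ ∈ quadrant τ) :
    ∃ C : ℝ, ∀ᶠ z in 𝓝 z₀, ∀ p, ‖latTerm (cen z τ) τ p‖ ≤ C * quadWeight p := by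
  have hτ0 := norm_pos_iff.2 (ne_zero_of_im hτ)
  set η := min (z₀.im / 2) (‖τ‖ * ((z₀ / τ).im / 2)) with hη
  have hηpos : 0 < η := lt_min (half_pos hz.1) (mul_pos hτ0 (half_pos hz.2))
  refine ⟨latConst (‖cen z₀ τ‖ + 1) η (min 1 τ.re), ?_⟩
  have h1 : ∀ᶠ z in 𝓝 z₀, z₀.im / 2 < z.im :=
    (Complex.continuous_im.tendsto z₀).eventually_const_lt (half_lt_self hz.1)
  have h2 : ∀ᶠ z in 𝓝 z₀, (z₀ / τ).im / 2 < (z / τ).im :=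
    ((Complex.continuous_im.comp (continuous_id.div_const τ)).tendsto z₀).eventually_const_lt
      (half_lt_self hz.2)
  have h3 : ∀ᶠ z in 𝓝 z₀, ‖cen z τ‖ < ‖cen z₀ τ‖ + 1 := by
    have : Continuous fun z => ‖cen z τ‖ := by unfold cen; fun_prop
    exact (this.tendsto z₀).eventually_lt_const (by linarith)
  filter_upwards [h1, h2, h3] with z hz1 hz2 hz3 p
  refine norm_latTerm_le (lt_min one_pos hτ') (min_le_left _ _) (min_le_right _ _) hηpos
    (by positivity) hz3.le p ?_ ?_
  · refine le_trans (min_le_right _ _) (le_trans ?_ (le_norm_cen_sub_lam hτ p))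
    gcongr
  · exact le_trans (min_le_left _ _) (le_trans hz1.le (le_norm_cen_add_lam hτ p))

lemma summable_latTerm {z τ : ℂ} (hτ : 0 < τ.im) (hτ' : 0 < τ.re) (hz : z ∈ quadrant τ) :
    Summable (latTerm (cen z τ) τ) := by
  obtain ⟨C, hC⟩ := exists_latTerm_bound hτ hτ' hz
  exact Summable.of_norm_bounded (summable_quadWeight.mul_left C) hC.self_of_nhds

lemma differentiableAt_latSum {z τ : ℂ} (hτ : 0 < τ.im) (hτ' : 0 < τ.re) (hz : z ∈ quadrant τ) :
    DifferentiableAt ℂ (fun z => latSum (cen z τ) τ) z := by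
  obtain ⟨C, hC⟩ := exists_latTerm_bound hτ hτ' hz
  have hq := (isOpen_quadrant τ).mem_nhds hz
  obtain ⟨U, hU, hUo, hzU⟩ := eventually_nhds_iff.1 (hC.and hq)
  have : DifferentiableOn ℂ (fun z => ∑' p, latTerm (cen z τ) τ p) U := by
    refine differentiableOn_tsum_of_summable_norm (summable_quadWeight.mul_left C) (fun p => ?_) hUo
      (fun p w hw => (hU w hw).1 p)
    intro w hw
    have e1 := cen_sub_lam_ne hτ (hU w hw).2 p
    have e2 := cen_add_lam_ne hτ (hU w hw).2 p
    apply DifferentiableAt.differentiableWithinAt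
    unfold latTerm
    have hc : DifferentiableAt ℂ (fun z => cen z τ) w := by unfold cen; fun_prop
    exact (((differentiableAt_const _).div (hc.sub_const _) e1).sub
      ((differentiableAt_const _).div (hc.add_const _) e2)).add_const _
  exact this.differentiableAt (hUo.mem_nhds hzU)

lemma not_int_of_im_pos {x : ℂ} (hx : 0 < x.im) : x ∈ Complex.integerComplement := by
  rintro ⟨n, rfl⟩; simp at hx

/-- The unit shift of z moves the index k by one, so both families of poles telescope in k. The edge
k = 0 that remains is a cotangent series in (z + 1)/τ. -/
lemma latSum_add_one {z τ : ℂ} (hτ : 0 < τ.im) (hτ' : 0 < τ.re) (hz : z ∈ quadrant τ)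
    (hz1 : z + 1 ∈ quadrant τ) :
    latSum (cen (z + 1) τ) τ - latSum (cen z τ) τ =
      Real.pi * Complex.cot (Real.pi * ((z + 1) / τ)) / τ := by
  have h0 := ne_zero_of_im hτ
  have hs0 := summable_latTerm hτ hτ' hz
  have hs1 := summable_latTerm hτ hτ' hz1
  unfold latSum
  rw [← hs1.tsum_sub hs0]
  rw [(tsum_telescope (a := fun m k => 1 / (z + 1 - k - (m + 1) * τ) + 1 / (z + (k + 1) + m * τ))
    (hs1.sub hs0) ?_ ?_).1, ← tsum_shifted_cot (not_int_of_im_pos hz1.2), ← tsum_div_const]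
  · refine tsum_congr fun m => ?_
    have e1 : (z + 1) / τ - (m + 1) = (z + 1 - (m + 1) * τ) / τ := by field_simp
    have e2 : (z + 1) / τ + m = (z + 1 + m * τ) / τ := by field_simp
    rw [e1, e2, one_div_div, one_div_div, add_div, div_div_cancel_left' h0,
      div_div_cancel_left' h0]
    simp
  · intro p
    simp only [latTerm, cen_sub_lam, cen_add_lam]
    push_cast
    rw [show z + 1 - ((p.1 : ℂ) + 1) - (p.2 + 1) * τ = z - p.1 - (p.2 + 1) * τ by ring,
      show z + 1 + ((p.1 : ℂ) + 1) + p.2 * τ = z + ((p.1 : ℂ) + 1 + 1) + p.2 * τ by ring]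
    ring
  · intro m
    have t1 := (tendsto_one_div_add_nat (-(z + 1 - (m + 1) * τ))).neg
    have t2 := tendsto_one_div_add_nat (z + 1 + m * τ)
    have := t1.add t2
    rw [neg_zero, add_zero] at this
    refine this.congr fun k => ?_
    rw [← one_div_neg_eq_neg_one_div]
    congr 2 <;> ring

/-- Same telescoping as for the unit shift, now in the index m; the edge m = 0 is a cotangent series
in z. -/
lemma latSum_add {z τ : ℂ} (hτ : 0 < τ.im) (hτ' : 0 < τ.re) (hz : z ∈ quadrant τ) :
    latSum (cen (z + τ) τ) τ - latSum (cen z τ) τ =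
      Real.pi * Complex.cot (Real.pi * z) := by
  have h0 := ne_zero_of_im hτ
  have hs0 := summable_latTerm hτ hτ' hz
  have hs1 := summable_latTerm hτ hτ' (quadrant_add hτ hz)
  -- The asymmetric grouping of `tsum_shifted_cot` matches the remaining edge at the argument z + 1
  -- rather than z.
  have hcot : Complex.cot (Real.pi * z) = Complex.cot (Real.pi * (z + 1)) := by
    rw [Complex.cot_pi_eq_exp_ratio, Complex.cot_pi_eq_exp_ratio]
    have : Complex.exp (2 * Real.pi * I * (z + 1)) = Complex.exp (2 * Real.pi * I * z) := by
      have := ex_add z 1; rw [ex_one, mul_one] at this; exact this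
    rw [this]
  rw [hcot, ← tsum_shifted_cot (not_int_of_im_pos (x := z + 1) (by simpa using hz.1))]
  unfold latSum
  rw [← hs1.tsum_sub hs0]
  have hsw := (Equiv.prodComm ℕ ℕ).summable_iff.2 (hs1.sub hs0)
  rw [← (Equiv.prodComm ℕ ℕ).tsum_eq]
  rw [show (fun c => latTerm (cen (z + τ) τ) τ ((Equiv.prodComm ℕ ℕ) c) -
      latTerm (cen z τ) τ ((Equiv.prodComm ℕ ℕ) c)) = ((fun b => latTerm (cen (z + τ) τ) τ b -
      latTerm (cen z τ) τ b) ∘ (Equiv.prodComm ℕ ℕ)) from rfl]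
  rw [(tsum_telescope (a := fun k m => 1 / (z - k - m * τ) + 1 / (z + (k + 1) + m * τ))
    hsw ?_ ?_).1]
  · refine tsum_congr fun m => ?_
    push_cast
    congr 2 <;> ring
  · intro p
    simp only [latTerm, cen_sub_lam, cen_add_lam, Function.comp, Equiv.prodComm_apply,
      Prod.fst_swap, Prod.snd_swap]
    push_cast
    rw [show z + τ - (p.2 : ℂ) - (p.1 + 1) * τ = z - p.2 - p.1 * τ by ring,
      show z + τ + ((p.2 : ℂ) + 1) + p.1 * τ = z + ((p.2 : ℂ) + 1) + (p.1 + 1) * τ by ring]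
    ring
  · intro k
    have t1 := (tendsto_one_div_add_nat (-((z - k) / τ))).neg.div_const τ
    have t2 := (tendsto_one_div_add_nat ((z + (k + 1)) / τ)).div_const τ
    have := t1.add t2
    rw [neg_zero, zero_div, add_zero] at this
    refine this.congr fun m => ?_
    rw [← one_div_neg_eq_neg_one_div, div_div, div_div]
    congr 2
    · field_simp; ring
    · field_simp

lemma qPoch_ne_zero_of_im_pos {z τ : ℂ} (hτ : 0 < τ.im) (hz : 0 < z.im) : qPoch z τ ≠ 0 := by
  refine qPoch_ne_zero hτ fun k m h => ?_
  have := congrArg Complex.im h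
  simp at this
  have h2 : 0 ≤ (k : ℝ) * τ.im := by positivity
  linarith

lemma sig_ne_zero {z τ : ℂ} (hτ : 0 < τ.im) (hz : z ∈ quadrant τ) : sig z τ ≠ 0 :=
  div_ne_zero (qPoch_ne_zero_of_im_pos (im_neg_inv_pos hτ) hz.2) (qPoch_ne_zero_of_im_pos hτ hz.1)

lemma differentiableAt_sig {z τ : ℂ} (hτ : 0 < τ.im) (hz : z ∈ quadrant τ) :
    DifferentiableAt ℂ (fun z => sig z τ) z := by
  have h1 : Differentiable ℂ fun z => qPoch (z / τ) (-1 / τ) :=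
    (differentiable_qPoch (im_neg_inv_pos hτ)).comp (differentiable_id.div_const τ)
  exact (h1 z).div (differentiable_qPoch hτ z) (qPoch_ne_zero_of_im_pos hτ hz.1)

lemma sig_add_one (z : ℂ) {τ : ℂ} (hτ : 0 < τ.im) :
    sig (z + 1) τ = (1 - ex ((z + 1) / τ)) * sig z τ := by
  unfold sig
  rw [qPoch_add_one, qPoch_eq_mul ((z + 1) / τ) (im_neg_inv_pos hτ),
    show (z + 1) / τ + -1 / τ = z / τ by ring]
  ring

lemma sig_add {z τ : ℂ} (hτ : 0 < τ.im) (hz : ex z ≠ 1) :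
    sig (z + τ) τ = (1 - ex z) * sig z τ := by
  unfold sig
  have h : 1 - ex z ≠ 0 := sub_ne_zero.2 hz.symm
  rw [qPoch_eq_mul z hτ, add_div, div_self (ne_zero_of_im hτ), qPoch_add_one,
    mul_div_assoc', mul_div_mul_left _ _ h]

/-- Duplication of numerator and denominator involves the same four points, because dividing by τ
exchanges the half periods 1/2 and τ/2 up to sign. The points are written with -1/2 so that they
stay in the quadrant. -/
lemma sig_two_mul (z : ℂ) {τ : ℂ} (hτ : 0 < τ.im) :
    sig (2 * z) τ = sig z τ * sig (z + τ / 2) τ * sig (z - 1 / 2) τ *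
      sig (z + τ / 2 - 1 / 2) τ := by
  have h0 := ne_zero_of_im hτ
  unfold sig
  rw [mul_div_assoc, qPoch_two_mul _ (im_neg_inv_pos hτ), qPoch_two_mul _ hτ,
    ← qPoch_add_one (z - 1 / 2), ← qPoch_add_one (z + τ / 2 - 1 / 2),
    show z - 1 / 2 + 1 = z + 1 / 2 by ring, show z + τ / 2 - 1 / 2 + 1 = z + 1 / 2 + τ / 2 by ring,
    show (z + τ / 2) / τ = z / τ + 1 / 2 by field_simp,
    show (z - 1 / 2) / τ = z / τ + -1 / τ / 2 by field_simp; ring,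
    show (z + τ / 2 - 1 / 2) / τ = z / τ + 1 / 2 + -1 / τ / 2 by field_simp; ring]
  simp only [div_mul_div_comm]
  congr 1
  ring

lemma logDeriv_one_sub_ex {w : ℂ} (hw : ex w ≠ 1) :
    logDeriv (fun w => 1 - ex w) w = Real.pi * I + Real.pi * Complex.cot (Real.pi * w) := by
  have h : (1 - ex w) ≠ 0 := sub_ne_zero.2 hw.symm
  have hd : deriv (fun w => 1 - ex w) w = -(2 * Real.pi * I * ex w) :=
    ((hasDerivAt_ex w).const_sub 1).deriv
  rw [logDeriv_apply, hd, Complex.cot_pi_eq_exp_ratio]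
  change _ = _ + Real.pi * ((ex w + 1) / (I * (1 - ex w)))
  field_simp
  linear_combination -(1 + ex w) * I_sq

lemma ex_ne_one_of_im_pos {w : ℂ} (hw : 0 < w.im) : ex w ≠ 1 := by
  intro h
  obtain ⟨n, rfl⟩ := (ex_eq_one_iff w).1 h
  simp at hw

lemma logDeriv_shift (f : ℂ → ℂ) (z c : ℂ) : logDeriv (fun w => f (w + c)) z = logDeriv f (z + c) := by
  rw [logDeriv_apply, logDeriv_apply, deriv_comp_add_const]

lemma logDeriv_sig_add_one {z τ : ℂ} (hτ : 0 < τ.im) (hz : z ∈ quadrant τ)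
    (hz1 : z + 1 ∈ quadrant τ) :
    logDeriv (fun z => sig z τ) (z + 1) = logDeriv (fun z => sig z τ) z +
      (Real.pi * I + Real.pi * Complex.cot (Real.pi * ((z + 1) / τ))) / τ := by
  rw [← logDeriv_shift]
  have h1 : (fun w => sig (w + 1) τ) = fun w => (1 - ex ((w + 1) / τ)) * sig w τ :=
    funext fun w => sig_add_one w hτ
  have hne := ex_ne_one_of_im_pos hz1.2
  have hd : HasDerivAt (fun w => (w + 1) / τ) (1 / τ) z :=
    ((hasDerivAt_id z).add_const 1).div_const τ
  rw [h1, logDeriv_mul (f := fun w => 1 - ex ((w + 1) / τ)) (g := fun z => sig z τ) z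
    (sub_ne_zero.2 hne.symm) (sig_ne_zero hτ hz) (by fun_prop) (differentiableAt_sig hτ hz)]
  rw [show (fun w => 1 - ex ((w + 1) / τ)) = (fun w => 1 - ex w) ∘ (fun w => (w + 1) / τ) from rfl,
    logDeriv_comp (by fun_prop) hd.differentiableAt, hd.deriv, logDeriv_one_sub_ex hne]
  ring

lemma logDeriv_sig_add {z τ : ℂ} (hτ : 0 < τ.im) (hz : z ∈ quadrant τ) :
    logDeriv (fun z => sig z τ) (z + τ) = logDeriv (fun z => sig z τ) z +
      (Real.pi * I + Real.pi * Complex.cot (Real.pi * z)) := by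
  rw [← logDeriv_shift]
  have hne := ex_ne_one_of_im_pos hz.1
  have h1 : (fun w => sig (w + τ) τ) =ᶠ[𝓝 z] fun w => (1 - ex w) * sig w τ := by
    filter_upwards [(isOpen_quadrant τ).mem_nhds hz] with w hw
    exact sig_add hτ (ex_ne_one_of_im_pos hw.1)
  rw [logDeriv_apply, h1.deriv_eq, sig_add hτ hne,
    ← logDeriv_apply (fun w => (1 - ex w) * sig w τ),
    logDeriv_mul (f := fun w => 1 - ex w) (g := fun z => sig z τ) z
    (sub_ne_zero.2 hne.symm) (sig_ne_zero hτ hz) (by fun_prop) (differentiableAt_sig hτ hz),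
    logDeriv_one_sub_ex hne]
  ring

/-- The difference of the logarithmic derivatives, which turns out to be constant. -/
def logDiff (τ z : ℂ) : ℂ :=
  logDeriv (fun z => sig z τ) z - latSum (cen z τ) τ - Real.pi * I * cen z τ / τ

/-- The functional equation of `sig` contributes πi + π cot to the logarithmic derivative: the
cotangent is matched by `latSum` and the πi by the linear term πi·u/τ. The same happens for the
shift by τ. -/
lemma logDiff_sub_one {z τ : ℂ} (hτ : 0 < τ.im) (hτ' : 0 < τ.re) (hz : z ∈ quadrant τ) :
    logDiff τ (z - 1) = logDiff τ z := by
  have hz' := quadrant_sub_one hτ hz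
  have hz1 : z - 1 + 1 ∈ quadrant τ := by simpa using hz
  have h1 := logDeriv_sig_add_one hτ hz' hz1
  have h2 := latSum_add_one hτ hτ' hz' hz1
  rw [sub_add_cancel] at h1 h2
  unfold logDiff
  rw [h1]
  have h3 : cen z τ = cen (z - 1) τ + 1 := by unfold cen; ring
  have h4 : latSum (cen z τ) τ = latSum (cen (z - 1) τ) τ +
    Real.pi * Complex.cot (Real.pi * (z / τ)) / τ := by rw [← h2]; ring
  rw [h4, h3]; ring

lemma logDiff_add {z τ : ℂ} (hτ : 0 < τ.im) (hτ' : 0 < τ.re) (hz : z ∈ quadrant τ) :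
    logDiff τ (z + τ) = logDiff τ z := by
  have h0 := ne_zero_of_im hτ
  have h1 := logDeriv_sig_add hτ hz
  have h2 := latSum_add hτ hτ' hz
  unfold logDiff
  rw [h1]
  have h3 : cen (z + τ) τ = cen z τ + τ := by unfold cen; ring
  have h4 : latSum (cen (z + τ) τ) τ = latSum (cen z τ) τ +
    Real.pi * Complex.cot (Real.pi * z) := by rw [← h2]; ring
  rw [h4, h3]; field_simp; ring

lemma logDiff_translate {z τ : ℂ} (hτ : 0 < τ.im) (hτ' : 0 < τ.re) (hz : z ∈ quadrant τ)
    (a b : ℕ) : z - a + b * τ ∈ quadrant τ ∧ logDiff τ (z - a + b * τ) = logDiff τ z := by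
  have h1 : ∀ a : ℕ, z - a ∈ quadrant τ ∧ logDiff τ (z - a) = logDiff τ z := by
    intro a
    induction a with
    | zero => simpa using hz
    | succ a ih =>
      have e : z - ((a + 1 : ℕ) : ℂ) = z - a - 1 := by push_cast; ring
      rw [e]
      exact ⟨quadrant_sub_one hτ ih.1, (logDiff_sub_one hτ hτ' ih.1).trans ih.2⟩
  induction b with
  | zero => simpa using h1 a
  | succ b ih =>
    have e : z - a + ((b + 1 : ℕ) : ℂ) * τ = z - a + b * τ + τ := by push_cast; ring
    rw [e]
    exact ⟨quadrant_add hτ ih.1, (logDiff_add hτ hτ' ih.1).trans ih.2⟩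

/-- The quadrant is stable only under z ↦ z - 1 and z ↦ z + τ, so two congruent points are compared
by moving both to a common third point; the positive and negative parts of a and b give the numbers
of moves. -/
lemma logDiff_eq_of_lattice {z τ : ℂ} (hτ : 0 < τ.im) (hτ' : 0 < τ.re) (hz : z ∈ quadrant τ)
    (a b : ℤ) (hz' : z + a + b * τ ∈ quadrant τ) : logDiff τ (z + a + b * τ) = logDiff τ z := by
  have h1 := (logDiff_translate hτ hτ' hz' a.toNat (-b).toNat).2
  have h2 := (logDiff_translate hτ hτ' hz (-a).toNat b.toNat).2
  have ea : (a : ℂ) = (a.toNat : ℂ) - ((-a).toNat : ℂ) := by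
    have := Int.toNat_sub_toNat_neg a
    exact_mod_cast this.symm
  have eb : (b : ℂ) = (b.toNat : ℂ) - ((-b).toNat : ℂ) := by
    have := Int.toNat_sub_toNat_neg b
    exact_mod_cast this.symm
  rw [← h1, ← h2]
  congr 1
  rw [ea, eb]
  ring

lemma mem_quadrant_iff {τ : ℂ} (hτ : 0 < τ.im) (x y : ℝ) :
    (x + y * τ : ℂ) ∈ quadrant τ ↔ x < 0 ∧ 0 < y := by
  have h0 := ne_zero_of_im hτ
  have e1 : (x + y * τ : ℂ).im = y * τ.im := by simp
  have e2 : ((x + y * τ : ℂ) / τ).im = x * (1 / τ).im := by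
    rw [add_div, mul_div_assoc, div_self h0, div_eq_mul_one_div]
    simp
  unfold quadrant
  simp only [Set.mem_ofPred_eq, e1, e2]
  have h := im_inv_neg hτ
  constructor
  · rintro ⟨ha, hb⟩
    exact ⟨by by_contra hx; push Not at hx; nlinarith, pos_of_mul_pos_left ha hτ.le⟩
  · rintro ⟨ha, hb⟩
    exact ⟨mul_pos hb hτ, mul_pos_of_neg_of_neg ha h⟩

lemma exists_real_coords {τ : ℂ} (hτ : 0 < τ.im) (z : ℂ) : ∃ x y : ℝ, z = x + y * τ := by
  refine ⟨z.re - z.im / τ.im * τ.re, z.im / τ.im, ?_⟩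
  apply Complex.ext
  · simp
  · simp [div_mul_cancel₀ _ hτ.ne']

lemma differentiableAt_logDiff {z τ : ℂ} (hτ : 0 < τ.im) (hτ' : 0 < τ.re) (hz : z ∈ quadrant τ) :
    DifferentiableAt ℂ (logDiff τ) z := by
  have hd : DifferentiableOn ℂ (fun z => sig z τ) (quadrant τ) := fun w hw =>
    (differentiableAt_sig hτ hw).differentiableWithinAt
  have h1 : DifferentiableAt ℂ (logDeriv fun z => sig z τ) z :=
    ((hd.deriv (isOpen_quadrant τ)).differentiableAt ((isOpen_quadrant τ).mem_nhds hz)).div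
      (differentiableAt_sig hτ hz) (sig_ne_zero hτ hz)
  have hc : DifferentiableAt ℂ (fun z => Real.pi * I * cen z τ / τ) z := by unfold cen; fun_prop
  exact (h1.sub (differentiableAt_latSum hτ hτ' hz)).sub hc

/-- By the maximum principle, a periodic holomorphic function on the quadrant is constant. -/
lemma logDiff_const {z w τ : ℂ} (hτ : 0 < τ.im) (hτ' : 0 < τ.re) (hz : z ∈ quadrant τ)
    (hw : w ∈ quadrant τ) : logDiff τ z = logDiff τ w := by
  -- A closed period parallelogram contained in the open quadrant: by periodicity, the maximum of
  -- the modulus over it is the maximum over the whole quadrant.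
  set K : Set ℂ := (fun v : ℝ × ℝ => (v.1 + v.2 * τ : ℂ)) '' (Set.Icc (-2) (-1) ×ˢ Set.Icc 1 2)
  have hK : IsCompact K := (isCompact_Icc.prod isCompact_Icc).image (by fun_prop)
  have hKΩ : K ⊆ quadrant τ := by
    rintro _ ⟨⟨x, y⟩, ⟨hx, hy⟩, rfl⟩
    exact (mem_quadrant_iff hτ x y).2 ⟨by linarith [hx.2], by linarith [hy.1]⟩
  have hdiff : DifferentiableOn ℂ (logDiff τ) (quadrant τ) := fun v hv =>
    (differentiableAt_logDiff hτ hτ' hv).differentiableWithinAt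
  obtain ⟨c, hcK, hc⟩ := hK.exists_isMaxOn
    ⟨_, ⟨(-1, 1), ⟨by norm_num, by norm_num⟩, rfl⟩⟩ (hdiff.continuousOn.mono hKΩ).norm
  have hmax : IsMaxOn (norm ∘ logDiff τ) (quadrant τ) c := by
    intro v hv
    obtain ⟨x, y, rfl⟩ := exists_real_coords hτ v
    have hm : (x + y * τ : ℂ) + ((-⌊x⌋ - 2 : ℤ) : ℂ) + ((-⌊y⌋ + 1 : ℤ) : ℂ) * τ ∈ K := by
      refine ⟨(Int.fract x - 2, Int.fract y + 1), ⟨⟨?_, ?_⟩, ?_, ?_⟩, ?_⟩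
      · simp [Int.fract_nonneg]
      · have := (Int.fract_lt_one x).le; simp only; linarith
      · simp [Int.fract_nonneg]
      · have := (Int.fract_lt_one y).le; simp only; linarith
      · simp only [Int.fract]; push_cast; ring
    have := hc hm
    simp only [Set.mem_ofPred_eq, Function.comp] at this ⊢
    rwa [logDiff_eq_of_lattice hτ hτ' hv _ _ (hKΩ hm)] at this
  have := Complex.eqOn_of_isPreconnected_of_isMaxOn_norm (convex_quadrant τ).isPreconnected
    (isOpen_quadrant τ) hdiff (hKΩ hcK) hmax
  exact (this hz).trans (this hw).symm

/-! ### The continuation of `ϖ(z/τ, -1/τ) / ϖ(z, τ)` to positive real `τ` -/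

lemma le_norm_lam {τ : ℂ} {δ : ℝ} (hδ : 0 ≤ δ) (hτ : δ ≤ τ.re) (p : ℕ × ℕ) :
    (1 + δ) / 2 ≤ ‖lam τ p‖ := (half_le_re_lam hδ hτ p).trans (Complex.re_le_norm _)

lemma norm_latTerm_le_of_norm_lt {u τ : ℂ} {r δ : ℝ} (hδ : 0 < δ) (hτ : δ ≤ τ.re)
    (hr : r < (1 + δ) / 2) (hu : ‖u‖ < r) (p : ℕ × ℕ) :
    ‖latTerm u τ p‖ ≤ latConst r ((1 + δ) / 2 - r) (min 1 δ) * quadWeight p := by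
  have hl := le_norm_lam hδ.le hτ p
  have hr0 : 0 < r := (norm_nonneg u).trans_lt hu
  refine norm_latTerm_le (lt_min one_pos hδ) (min_le_left _ _) ((min_le_right _ _).trans hτ)
    (by linarith) hr0 hu.le p ?_ ?_
  · have := norm_sub_norm_le (lam τ p) u
    rw [norm_sub_rev] at this; linarith
  · have := norm_sub_norm_le (lam τ p) (-u)
    rw [sub_neg_eq_add, add_comm, norm_neg] at this; linarith

lemma norm_div_lam_lt_one {u τ : ℂ} {r δ : ℝ} (hδ : 0 < δ) (hτ : δ ≤ τ.re)
    (hr : r < (1 + δ) / 2) (hu : ‖u‖ < r) (p : ℕ × ℕ) : ‖u / lam τ p‖ < 1 := by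
  have hl := le_norm_lam hδ.le hτ p
  rw [norm_div, div_lt_one (by linarith)]; linarith

lemma slitPlane_one_sub {x : ℂ} (hx : ‖x‖ < 1) : 1 - x ∈ slitPlane := by
  rw [sub_eq_add_neg]; exact mem_slitPlane_of_norm_lt_one (by simpa using hx)

lemma hasDerivAt_latLogTerm {u τ : ℂ} {r δ : ℝ} (hδ : 0 < δ) (hτ : δ ≤ τ.re)
    (hr : r < (1 + δ) / 2) (hu : ‖u‖ < r) (p : ℕ × ℕ) :
    HasDerivAt (fun u => latLogTerm u τ p) (latTerm u τ p) u := by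
  have hl : lam τ p ≠ 0 := lam_ne_zero (hδ.trans_le hτ) p
  have hx := norm_div_lam_lt_one hδ hτ hr hu p
  have hd : HasDerivAt (fun u => u / lam τ p) (1 / lam τ p) u := (hasDerivAt_id u).div_const _
  have h1 := (hd.const_sub 1).clog (slitPlane_one_sub hx)
  have h2 := (hd.const_add 1).clog (mem_slitPlane_of_norm_lt_one hx)
  refine ((h1.sub h2).add (hd.const_mul 2)).congr_deriv ?_
  have e1 : 1 - u / lam τ p ≠ 0 := slitPlane_ne_zero (slitPlane_one_sub hx)
  have e2 : 1 + u / lam τ p ≠ 0 := slitPlane_ne_zero (mem_slitPlane_of_norm_lt_one hx)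
  have f1 : u - lam τ p = -((1 - u / lam τ p) * lam τ p) := by field_simp; ring
  have f2 : u + lam τ p = (1 + u / lam τ p) * lam τ p := by field_simp; ring
  unfold latTerm
  rw [f1, f2]
  field_simp

/-- The term vanishes at u = 0, so the mean value inequality on the disc turns the bound for its
derivative into one for the term itself. -/
lemma norm_latLogTerm_le {u τ : ℂ} {r δ : ℝ} (hδ : 0 < δ) (hτ : δ ≤ τ.re)
    (hr : r < (1 + δ) / 2) (hu : ‖u‖ < r) (p : ℕ × ℕ) :
    ‖latLogTerm u τ p‖ ≤ latConst r ((1 + δ) / 2 - r) (min 1 δ) * r * quadWeight p := by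
  have h0 : (0:ℂ) ∈ Metric.ball (0:ℂ) r := by
    simpa using (norm_nonneg u).trans_lt hu
  have := Convex.norm_image_sub_le_of_norm_hasDerivWithin_le (f := fun u => latLogTerm u τ p)
    (f' := fun u => latTerm u τ p) (s := Metric.ball 0 r) (x := 0) (y := u)
    (C := latConst r ((1 + δ) / 2 - r) (min 1 δ) * quadWeight p)
    (fun x hx => (hasDerivAt_latLogTerm hδ hτ hr (by simpa using hx) p).hasDerivWithinAt)
    (fun x hx => norm_latTerm_le_of_norm_lt hδ hτ hr (by simpa using hx) p)
    (convex_ball 0 r) h0 (by simpa using hu)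
  have h00 : latLogTerm 0 τ p = 0 := by simp [latLogTerm]
  simp only [h00, sub_zero] at this
  refine this.trans ?_
  have hc : 0 ≤ latConst r ((1 + δ) / 2 - r) (min 1 δ) * quadWeight p :=
    (norm_nonneg _).trans (norm_latTerm_le_of_norm_lt hδ hτ hr hu p)
  calc _ ≤ latConst r ((1 + δ) / 2 - r) (min 1 δ) * quadWeight p * r := by gcongr
    _ = _ := by ring

lemma hasDerivAt_latLog {u τ : ℂ} {r δ : ℝ} (hδ : 0 < δ) (hτ : δ ≤ τ.re)
    (hr : r < (1 + δ) / 2) (hu : ‖u‖ < r) :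
    HasDerivAt (fun u => latLog u τ) (latSum u τ) u := by
  refine hasDerivAt_tsum_of_isPreconnected (t := Metric.ball (0:ℂ) r)
    (summable_quadWeight.mul_left (latConst r ((1 + δ) / 2 - r) (min 1 δ))) Metric.isOpen_ball
    (convex_ball 0 r).isPreconnected
    (fun p y hy => hasDerivAt_latLogTerm hδ hτ hr (by simpa using hy) p)
    (fun p y hy => norm_latTerm_le_of_norm_lt hδ hτ hr (by simpa using hy) p)
    (y₀ := u) (by simpa using hu) ?_ (by simpa using hu)
  exact Summable.of_norm_bounded (summable_quadWeight.mul_left _)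
    (fun p => norm_latLogTerm_le hδ hτ hr hu p)

lemma latLog_neg (u τ : ℂ) : latLog (-u) τ = -latLog u τ := by
  unfold latLog
  rw [← tsum_neg]
  refine tsum_congr fun p => ?_
  unfold latLogTerm
  rw [neg_div, sub_neg_eq_add, ← sub_eq_add_neg]; ring

lemma latLog_zero (τ : ℂ) : latLog 0 τ = 0 := by simp [latLog, latLogTerm]

lemma latSum_zero (τ : ℂ) : latSum 0 τ = 0 := by
  have h : ∀ p, latTerm 0 τ p = 0 := by
    intro p
    unfold latTerm
    rw [zero_sub, zero_add, one_div_neg_eq_neg_one_div]; ring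
  simp [latSum, h]

lemma continuous_lam (p : ℕ × ℕ) : Continuous fun τ => lam τ p := by unfold lam; fun_prop

lemma continuousOn_latLog {r δ : ℝ} (hδ : 0 < δ) (hr : r < (1 + δ) / 2) :
    ContinuousOn (fun w : ℂ × ℂ => latLog w.1 w.2) {w | ‖w.1‖ < r ∧ δ < w.2.re} := by
  refine continuousOn_tsum (fun p w hw => ?_) (summable_quadWeight.mul_left _)
    (fun p w hw => norm_latLogTerm_le hδ hw.2.le hr hw.1 p)
  apply ContinuousAt.continuousWithinAt
  have hx := norm_div_lam_lt_one hδ hw.2.le hr hw.1 p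
  have hq : ContinuousAt (fun w : ℂ × ℂ => w.1 / lam w.2 p) w :=
    continuousAt_fst.div ((continuous_lam p).comp continuous_snd).continuousAt
      (lam_ne_zero (hδ.trans hw.2) p)
  exact (((continuousAt_const.sub hq).clog (slitPlane_one_sub hx)).sub
    ((continuousAt_const.add hq).clog (mem_slitPlane_of_norm_lt_one hx))).add
    (continuousAt_const.mul hq)

lemma continuousOn_latSum {r δ : ℝ} (hδ : 0 < δ) (hr : r < (1 + δ) / 2) :
    ContinuousOn (fun w : ℂ × ℂ => latSum w.1 w.2) {w | ‖w.1‖ < r ∧ δ < w.2.re} := by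
  refine continuousOn_tsum (fun p w hw => ?_) (summable_quadWeight.mul_left _)
    (fun p w hw => norm_latTerm_le_of_norm_lt hδ hw.2.le hr hw.1 p)
  apply ContinuousAt.continuousWithinAt
  have hl := le_norm_lam hδ.le hw.2.le p
  have hlam : ContinuousAt (fun w : ℂ × ℂ => lam w.2 p) w :=
    ((continuous_lam p).comp continuous_snd).continuousAt
  have e1 : w.1 - lam w.2 p ≠ 0 := by
    intro h; rw [sub_eq_zero] at h; have := hw.1; rw [h] at this; linarith
  have e2 : w.1 + lam w.2 p ≠ 0 := by
    intro h; rw [add_eq_zero_iff_eq_neg] at h; have := hw.1; rw [h, norm_neg] at this; linarith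
  exact ((continuousAt_const.div (continuousAt_fst.sub hlam) e1).sub
    (continuousAt_const.div (continuousAt_fst.add hlam) e2)).add
    (continuousAt_const.div hlam (lam_ne_zero (hδ.trans hw.2) p))

/-- The center of symmetry `(τ - 1) / 2`. -/
def center (τ : ℂ) : ℂ := τ / 2 - 1 / 2

lemma cen_center (τ : ℂ) : cen (center τ) τ = 0 := by unfold cen center; ring

lemma center_mem {τ : ℂ} (hτ : 0 < τ.im) : center τ ∈ quadrant τ := by
  have := (mem_quadrant_iff hτ (-1 / 2) (1 / 2)).2 ⟨by norm_num, by norm_num⟩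
  convert this using 1
  unfold center; push_cast; ring

/-- The exponent relating the two infinite products near the center of symmetry. -/
def sigExp (τ u : ℂ) : ℂ :=
  logDiff τ (center τ) * u + Real.pi * I * u ^ 2 / (2 * τ) + latLog u τ

/-- On the part of the disc inside the quadrant, `sig` and the exponential have equal logarithmic
derivatives. The identity is stated without division because the disc leaves the quadrant and may
contain zeros of the products; the identity theorem extends it there. -/
lemma qPoch_inv_eq {z τ : ℂ} {r δ : ℝ} (hδ : 0 < δ) (hτ : δ ≤ τ.re)
    (hr : r < (1 + δ) / 2) (him : 0 < τ.im) (hz : ‖cen z τ‖ < r) :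
    qPoch (z / τ) (-1 / τ) = sig (center τ) τ * exp (sigExp τ (cen z τ)) * qPoch z τ := by
  have hτ0 := ne_zero_of_im him
  have hr0 : 0 < r := (norm_nonneg _).trans_lt hz
  set B : Set ℂ := Metric.ball (center τ) r with hB
  have hBcen : ∀ w, w ∈ B ↔ ‖cen w τ‖ < r := by
    intro w
    rw [hB, Metric.mem_ball, dist_eq_norm]
    have : w - center τ = cen w τ := by unfold cen center; ring
    rw [this]
  have hdc : ∀ w, HasDerivAt (fun z => cen z τ) 1 w := fun w =>
    ((hasDerivAt_id w).add_const (1 / 2)).sub_const (τ / 2)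
  have hderiv : ∀ w ∈ B, HasDerivAt (fun z => sigExp τ (cen z τ))
      (logDiff τ (center τ) + Real.pi * I * cen w τ / τ + latSum (cen w τ) τ) w := by
    intro w hw
    have hL : HasDerivAt (fun u => latLog u τ) (latSum (cen w τ) τ) (cen w τ) :=
      hasDerivAt_latLog hδ hτ hr ((hBcen w).1 hw)
    have h1 : HasDerivAt (fun z => latLog (cen z τ) τ) (latSum (cen w τ) τ * 1) w :=
      HasDerivAt.comp (h₂ := fun u => latLog u τ) w hL (hdc w)
    have h2 := ((hdc w).const_mul (logDiff τ (center τ))).add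
      ((((hdc w).pow 2).const_mul (Real.pi * I)).div_const (2 * τ))
    refine (h2.add h1).congr_deriv ?_
    simp only [Nat.cast_ofNat, Nat.add_one_sub_one, pow_one]
    field_simp
  -- equality near the center
  have hconv : Convex ℝ (B ∩ quadrant τ) := (convex_ball _ _).inter (convex_quadrant τ)
  have hopen : IsOpen (B ∩ quadrant τ) := Metric.isOpen_ball.inter (isOpen_quadrant τ)
  have hcm : center τ ∈ B ∩ quadrant τ := ⟨Metric.mem_ball_self hr0, center_mem him⟩
  have hquot : ∀ w ∈ B ∩ quadrant τ,
      HasDerivAt (fun z => sig z τ * exp (-sigExp τ (cen z τ))) 0 w := by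
    intro w hw
    have hs := (differentiableAt_sig him hw.2).hasDerivAt
    have he := (hderiv w hw.1).neg.cexp
    refine (hs.mul he).congr_deriv ?_
    have hlog : deriv (fun z => sig z τ) w = (logDiff τ (center τ) + Real.pi * I * cen w τ / τ +
        latSum (cen w τ) τ) * sig w τ := by
      have h1 : logDiff τ w = logDiff τ (center τ) :=
        logDiff_const him (hδ.trans_le hτ) hw.2 (center_mem him)
      rw [← h1]
      unfold logDiff
      rw [logDeriv_apply]
      have := sig_ne_zero him hw.2
      field_simp
      ring
    rw [hlog]; simp only [Pi.neg_apply]; ring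
  have hconst : ∀ w ∈ B ∩ quadrant τ,
      sig w τ * exp (-sigExp τ (cen w τ)) = sig (center τ) τ := by
    intro w hw
    have := hopen.is_const_of_deriv_eq_zero hconv.isPreconnected
      (fun x hx => (hquot x hx).differentiableAt.differentiableWithinAt)
      (fun x hx => (hquot x hx).deriv) hw hcm
    rw [this, cen_center]
    simp [sigExp, latLog_zero]
  have han1 : AnalyticOnNhd ℂ (fun z => qPoch (z / τ) (-1 / τ)) B := by
    refine DifferentiableOn.analyticOnNhd (Differentiable.differentiableOn ?_) Metric.isOpen_ball
    exact (differentiable_qPoch (im_neg_inv_pos him)).comp (differentiable_id.div_const τ)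
  have han2 : AnalyticOnNhd ℂ
      (fun z => sig (center τ) τ * exp (sigExp τ (cen z τ)) * qPoch z τ) B := by
    refine DifferentiableOn.analyticOnNhd (fun w hw => ?_) Metric.isOpen_ball
    exact (((hderiv w hw).cexp.const_mul _).differentiableAt.mul
      (differentiable_qPoch him w)).differentiableWithinAt
  refine han1.eqOn_of_preconnected_of_eventuallyEq han2 (convex_ball _ _).isPreconnected hcm.1 ?_
    ((hBcen z).2 hz)
  filter_upwards [hopen.mem_nhds hcm] with w hw
  have hq : qPoch w τ ≠ 0 := qPoch_ne_zero_of_im_pos him hw.2.1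
  have h1 : qPoch (w / τ) (-1 / τ) = sig w τ * qPoch w τ := by
    unfold sig; rw [div_mul_cancel₀ _ hq]
  rw [h1, ← hconst w hw, Complex.exp_neg]
  field_simp [Complex.exp_ne_zero]

/-- The four quarter points `(±1 ± τ)/4`. -/
lemma quarter_mem {τ : ℂ} (him : 0 < τ.im) :
    τ / 4 - 1 / 4 ∈ quadrant τ ∧ τ / 4 - 1 / 4 + τ / 2 ∈ quadrant τ ∧
      τ / 4 - 1 / 4 - 1 / 2 ∈ quadrant τ ∧ τ / 4 - 1 / 4 + τ / 2 - 1 / 2 ∈ quadrant τ := by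
  refine ⟨?_, ?_, ?_, ?_⟩
  · convert (mem_quadrant_iff him (-1 / 4) (1 / 4)).2 ⟨by norm_num, by norm_num⟩ using 1
    push_cast; ring
  · convert (mem_quadrant_iff him (-1 / 4) (3 / 4)).2 ⟨by norm_num, by norm_num⟩ using 1
    push_cast; ring
  · convert (mem_quadrant_iff him (-3 / 4) (1 / 4)).2 ⟨by norm_num, by norm_num⟩ using 1
    push_cast; ring
  · convert (mem_quadrant_iff him (-3 / 4) (3 / 4)).2 ⟨by norm_num, by norm_num⟩ using 1
    push_cast; ring

lemma cen_quarter (τ : ℂ) :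
    cen (τ / 4 - 1 / 4) τ = (1 - τ) / 4 ∧ cen (τ / 4 - 1 / 4 + τ / 2) τ = (1 + τ) / 4 ∧
      cen (τ / 4 - 1 / 4 - 1 / 2) τ = -((1 + τ) / 4) ∧
      cen (τ / 4 - 1 / 4 + τ / 2 - 1 / 2) τ = -((1 - τ) / 4) := by
  unfold cen
  refine ⟨?_, ?_, ?_, ?_⟩ <;> ring

/-- The sum of `latSum` over the quarter points, which determines the constant `logDiff`. -/
def quarterSum (τ : ℂ) : ℂ :=
  latSum ((1 - τ) / 4) τ + latSum ((1 + τ) / 4) τ + latSum (-((1 + τ) / 4)) τ +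
    latSum (-((1 - τ) / 4)) τ

/-- Differentiating the logarithm of the duplication formula at half the center gives 2c = 4c +
`quarterSum`, the linear terms cancelling in pairs. The resulting value involves only `latSum`,
hence makes sense for real τ > 0 as well. -/
lemma logDiff_center {τ : ℂ} (him : 0 < τ.im) (hre : 0 < τ.re) :
    logDiff τ (center τ) = -quarterSum τ / 2 := by
  obtain ⟨m1, m2, m3, m4⟩ := quarter_mem him
  obtain ⟨c1, c2, c3, c4⟩ := cen_quarter τ
  have hτ0 := ne_zero_of_im him
  set q := τ / 4 - 1 / 4 with hq
  have h2q : 2 * q = center τ := by rw [hq]; unfold center; ring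
  set s : ℂ → ℂ := fun z => sig z τ with hs
  have hfun : (fun z => s (2 * z)) = fun z => (s z * s (z + τ / 2)) * s (z - 1 / 2) *
      s (z + τ / 2 - 1 / 2) := funext fun z => sig_two_mul z him
  have hl : logDeriv (fun z => s (2 * z)) q = 2 * logDeriv s (center τ) := by
    have hd : HasDerivAt (fun z : ℂ => 2 * z) 2 q := by
      simpa using (hasDerivAt_id q).const_mul (2:ℂ)
    rw [show (fun z => s (2 * z)) = s ∘ fun z => 2 * z from rfl,
      logDeriv_comp (by rw [h2q]; exact differentiableAt_sig him (center_mem him))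
      hd.differentiableAt, hd.deriv, h2q]
    ring
  have hshift : ∀ c, q + c ∈ quadrant τ → DifferentiableAt ℂ (fun z => s (z + c)) q := fun c hc =>
    DifferentiableAt.comp (g := s) (f := fun z => z + c) q (differentiableAt_sig him hc)
      (by fun_prop)
  have m3' : q + -(1 / 2) ∈ quadrant τ := by rwa [← sub_eq_add_neg]
  have m4' : q + (τ / 2 - 1 / 2) ∈ quadrant τ := by rwa [← add_sub_assoc]
  have e3 : (fun z => s (z - 1 / 2)) = fun z => s (z + -(1 / 2)) := rfl
  have e4 : (fun z => s (z + τ / 2 - 1 / 2)) = fun z => s (z + (τ / 2 - 1 / 2)) := by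
    funext z; rw [add_sub_assoc]
  have d2 := hshift _ m2
  have d3 := hshift _ m3'
  have d4 := hshift _ m4'
  rw [← e3] at d3
  rw [← e4] at d4
  have d1 := differentiableAt_sig him m1
  have n1 := sig_ne_zero him m1
  have n2 := sig_ne_zero him m2
  have n3 := sig_ne_zero him m3
  have n4 := sig_ne_zero him m4
  have hr : logDeriv (fun z => s (2 * z)) q = logDeriv s q + logDeriv s (q + τ / 2) +
      logDeriv s (q - 1 / 2) + logDeriv s (q + τ / 2 - 1 / 2) := by
    rw [hfun, logDeriv_mul (f := fun z => (s z * s (z + τ / 2)) * s (z - 1 / 2))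
      (g := fun z => s (z + τ / 2 - 1 / 2)) q (mul_ne_zero (mul_ne_zero n1 n2) n3) n4
      ((d1.mul d2).mul d3) d4,
      logDeriv_mul (f := fun z => s z * s (z + τ / 2)) (g := fun z => s (z - 1 / 2)) q
      (mul_ne_zero n1 n2) n3 (d1.mul d2) d3,
      logDeriv_mul (f := s) (g := fun z => s (z + τ / 2)) q n1 n2 d1 d2,
      logDeriv_shift, e3, logDeriv_shift, e4, logDeriv_shift, ← sub_eq_add_neg, ← add_sub_assoc]
  have hall : ∀ w ∈ quadrant τ, logDeriv s w = logDiff τ (center τ) + latSum (cen w τ) τ +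
      Real.pi * I * cen w τ / τ := by
    intro w hw
    rw [← logDiff_const him hre hw (center_mem him)]
    unfold logDiff
    ring
  rw [hl, hall _ m1, hall _ m2, hall _ m3, hall _ m4, hall _ (center_mem him), cen_center, c1, c2,
    c3, c4, latSum_zero] at hr
  unfold quarterSum
  linear_combination (-1/2 : ℂ) * hr

/-- Duplication expresses the central value as its own fourth power times an exponential. Over the
four quarter points ±(1 ± τ)/4 the odd terms of the exponents cancel, and only the quadratic terms
survive. The condition Im τ < Re τ keeps these points within the disc where `latLog` converges. -/
lemma sig_center_cube {τ : ℂ} (him : 0 < τ.im) (hre : τ.im < τ.re) :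
    sig (center τ) τ ^ 3 * exp (Real.pi * I * (1 + τ ^ 2) / (8 * τ)) = 1 := by
  obtain ⟨m1, m2, m3, m4⟩ := quarter_mem him
  obtain ⟨c1, c2, c3, c4⟩ := cen_quarter τ
  have hτ0 := ne_zero_of_im him
  have hre0 : 0 < τ.re := him.trans hre
  have hform : ∀ z ∈ quadrant τ, ‖cen z τ‖ < (1 + 2 * τ.re) / 4 →
      sig z τ = sig (center τ) τ * exp (sigExp τ (cen z τ)) := by
    intro z hz hzr
    have := qPoch_inv_eq hre0 le_rfl (r := (1 + 2 * τ.re) / 4) (by linarith) him hzr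
    have hq := qPoch_ne_zero_of_im_pos him hz.1
    rw [sig, this, mul_div_cancel_right₀ _ hq]
  have hn : ‖τ‖ < 2 * τ.re := by
    have := Complex.norm_le_abs_re_add_abs_im τ
    rw [abs_of_pos him, abs_of_pos hre0] at this
    linarith
  have hp : ‖(1 + τ) / 4‖ < (1 + 2 * τ.re) / 4 := by
    rw [norm_div]
    have := norm_add_le 1 τ
    simp only [norm_one, Complex.norm_ofNat] at *
    linarith
  have hm : ‖(1 - τ) / 4‖ < (1 + 2 * τ.re) / 4 := by
    rw [norm_div]
    have := norm_sub_le 1 τ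
    simp only [norm_one, Complex.norm_ofNat] at *
    linarith
  have hdup := sig_two_mul (τ / 4 - 1 / 4) him
  have h2q : 2 * (τ / 4 - 1 / 4) = center τ := by unfold center; ring
  rw [h2q, hform _ m1 (by rw [c1]; exact hm), hform _ m2 (by rw [c2]; exact hp),
    hform _ m3 (by rw [c3, norm_neg]; exact hp), hform _ m4 (by rw [c4, norm_neg]; exact hm),
    c1, c2, c3, c4] at hdup
  have hs : sigExp τ ((1 - τ) / 4) + sigExp τ ((1 + τ) / 4) + sigExp τ (-((1 + τ) / 4)) +
      sigExp τ (-((1 - τ) / 4)) = Real.pi * I * (1 + τ ^ 2) / (8 * τ) := by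
    unfold sigExp
    rw [latLog_neg, latLog_neg]
    field_simp
    ring
  have h0 := sig_ne_zero him (center_mem him)
  rw [← hs, Complex.exp_add, Complex.exp_add, Complex.exp_add]
  apply mul_left_cancel₀ h0
  rw [mul_one]
  nth_rewrite 3 [hdup]
  ring

/-- The open sector `0 < Im τ < Re τ`. -/
def sector : Set ℂ := {τ | 0 < τ.im ∧ τ.im < τ.re}

lemma convex_sector : Convex ℝ sector := by
  have h1 : Convex ℝ {τ : ℂ | 0 < τ.im} := convex_halfSpace_im_gt 0
  have h2 : Convex ℝ {τ : ℂ | (Complex.imCLM - Complex.reCLM : ℂ →L[ℝ] ℝ) τ < 0} :=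
    convex_halfSpace_lt (Complex.imCLM - Complex.reCLM : ℂ →L[ℝ] ℝ).isLinear 0
  convert h1.inter h2 using 1
  ext τ
  simp [sector]

lemma continuousOn_qPoch_comp {X : Type*} [TopologicalSpace X] {f g : X → ℂ} {s : Set X}
    (hf : ContinuousOn f s) (hg : ContinuousOn g s) (h : ∀ x ∈ s, 0 < (g x).im) :
    ContinuousOn (fun x => qPoch (f x) (g x)) s :=
  ContinuousOn.comp (g := fun w : ℂ × ℂ => qPoch w.1 w.2) (f := fun x => (f x, g x))
    continuousOn_qPoch (hf.prodMk hg) h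

/-- A continuous function on a connected set whose cube is 1 is constant. Which cube root occurs is
immaterial: only a nonzero limit at real points is needed. -/
lemma sig_center_eq : ∃ ζ : ℂ, ζ ≠ 0 ∧ ∀ τ ∈ sector,
    sig (center τ) τ = ζ * exp (-(Real.pi * I * (1 + τ ^ 2) / (24 * τ))) := by
  set f : ℂ → ℂ := fun τ => sig (center τ) τ * exp (Real.pi * I * (1 + τ ^ 2) / (24 * τ)) with hf
  have hcube : ∀ τ ∈ sector, f τ ^ 3 = 1 := by
    intro τ hτ
    rw [← sig_center_cube hτ.1 hτ.2, hf]
    simp only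
    rw [mul_pow, ← Complex.exp_nat_mul]
    have hτ0 := ne_zero_of_im hτ.1
    congr 2
    push_cast
    field_simp
    ring
  have hcont : ContinuousOn f sector := by
    have hne : ∀ τ ∈ sector, τ ≠ 0 := fun τ hτ => ne_zero_of_im hτ.1
    have hc : ContinuousOn center sector := by unfold center; fun_prop
    have h1 : ContinuousOn (fun τ => qPoch (center τ) τ) sector :=
      continuousOn_qPoch_comp hc continuousOn_id fun τ hτ => hτ.1
    have h2 : ContinuousOn (fun τ => qPoch (center τ / τ) (-1 / τ)) sector :=
      continuousOn_qPoch_comp (hc.div continuousOn_id hne)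
        (continuousOn_const.div continuousOn_id hne) fun τ hτ => im_neg_inv_pos hτ.1
    refine (h2.div h1 fun τ hτ => qPoch_ne_zero_of_im_pos hτ.1 (center_mem hτ.1).1).mul ?_
    refine ContinuousOn.cexp (ContinuousOn.div (by fun_prop) (by fun_prop) ?_)
    intro τ hτ
    exact mul_ne_zero (by norm_num) (hne τ hτ)
  have hfin : ({x : ℂ | x ^ 3 = 1}).Finite := by
    have : {x : ℂ | x ^ 3 = 1} ⊆ (Polynomial.nthRoots 3 (1:ℂ)).toFinset := by
      intro x hx
      simp only [Finset.mem_coe, Multiset.mem_toFinset]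
      exact (Polynomial.mem_nthRoots (by norm_num)).2 hx
    exact (Finset.finite_toSet _).subset this
  obtain ⟨ζ, hζ, hall⟩ := convex_sector.isPreconnected.eqOn_const_of_mapsTo hfin.isDiscrete hcont
    (fun τ hτ => hcube τ hτ) ⟨1, by simp⟩
  refine ⟨ζ, ?_, fun τ hτ => ?_⟩
  · rintro rfl
    have : (0:ℂ) ^ 3 = 1 := hζ
    norm_num at this
  · have := hall hτ
    simp only [Function.const] at this
    rw [← this, hf, Complex.exp_neg]
    field_simp [Complex.exp_ne_zero]

/-- The points with `τ` in the upper half plane. -/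
def upperSet : Set (ℂ × ℂ) := {w | 0 < w.2.im}

/-- Near the real point `(y, x)`, the products `ϖ(z / j_M(τ), M·τ)` and `ϖ(z, τ)` differ by a factor
with a nonzero limit. -/
def HasLim (M : SL(2, ℤ)) (y x : ℝ) : Prop :=
  ∃ (F : ℂ × ℂ → ℂ) (l : ℂ), l ≠ 0 ∧ Tendsto F (𝓝[upperSet] ((y : ℂ), (x : ℂ))) (𝓝 l) ∧
    ∀ᶠ w in 𝓝[upperSet] ((y : ℂ), (x : ℂ)),
      qPoch (w.1 / jden M w.2) (moeb M w.2) = F w * qPoch w.1 w.2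

lemma jden_S (τ : ℂ) : jden ModularGroup.S τ = τ := by simp [jden, ModularGroup.S]

lemma moeb_S (τ : ℂ) : moeb ModularGroup.S τ = -1 / τ := by
  rw [moeb, jden_S]; simp [ModularGroup.S]

/-- Every ingredient of the explicit factor (the central value, the constant `logDiff`, the lattice
logarithm) is continuous at real τ > 0. The window |u| ≤ 1/2 is one unit long, so integer
translations will reach every y. -/
lemma hasLim_S_near_center {x y : ℝ} (hx : 0 < x) (hy : |y + 1 / 2 - x / 2| ≤ 1 / 2) :
    HasLim ModularGroup.S y x := by
  obtain ⟨ζ, hζ, hsig⟩ := sig_center_eq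
  set F : ℂ × ℂ → ℂ := fun w => ζ * exp (-(Real.pi * I * (1 + w.2 ^ 2) / (24 * w.2))) *
    exp (-quarterSum w.2 / 2 * cen w.1 w.2 + Real.pi * I * cen w.1 w.2 ^ 2 / (2 * w.2) +
      latLog (cen w.1 w.2) w.2) with hF
  have hx0 : ((x:ℝ):ℂ) ≠ 0 := by exact_mod_cast hx.ne'
  have hcen : Continuous fun w : ℂ × ℂ => cen w.1 w.2 := by unfold cen; fun_prop
  -- With δ = x/2 the disc of convergence has radius 1/2 + x/4. The radius 1/2 + x/8 lies strictly
  -- between this and the window |u| ≤ 1/2, leaving room for a neighbourhood.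
  have hcen0 : ‖cen (y:ℂ) (x:ℂ)‖ < 1 / 2 + x / 8 := by
    have : cen (y:ℂ) (x:ℂ) = ((y + 1 / 2 - x / 2 : ℝ) : ℂ) := by unfold cen; push_cast; ring
    rw [this, Complex.norm_real, Real.norm_eq_abs]
    linarith
  have hδ : 0 < x / 2 := half_pos hx
  have hlogc : ContinuousAt (fun w : ℂ × ℂ => latLog (cen w.1 w.2) w.2) ((y : ℂ), (x : ℂ)) := by
    have hop : IsOpen {w : ℂ × ℂ | ‖w.1‖ < 1 / 2 + x / 8 ∧ x / 2 < w.2.re} :=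
      (isOpen_lt continuous_fst.norm continuous_const).inter
        (isOpen_lt continuous_const (Complex.continuous_re.comp continuous_snd))
    have h1 := (continuousOn_latLog hδ (r := 1 / 2 + x / 8) (by linarith)).continuousAt
      (hop.mem_nhds (x := (cen (y:ℂ) (x:ℂ), (x:ℂ))) ⟨hcen0, by simp; linarith⟩)
    exact ContinuousAt.comp (g := fun w : ℂ × ℂ => latLog w.1 w.2)
      (f := fun w : ℂ × ℂ => (cen w.1 w.2, w.2)) h1 (by fun_prop)
  have hquart : ContinuousAt quarterSum (x : ℂ) := by
    have hop : IsOpen {w : ℂ × ℂ | ‖w.1‖ < 3 / 8 + x / 4 ∧ x / 2 < w.2.re} :=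
      (isOpen_lt continuous_fst.norm continuous_const).inter
        (isOpen_lt continuous_const (Complex.continuous_re.comp continuous_snd))
    have key : ∀ g : ℂ → ℂ, Continuous g → ‖g x‖ < 3 / 8 + x / 4 →
        ContinuousAt (fun τ => latSum (g τ) τ) (x : ℂ) := by
      intro g hg hgx
      have h1 := (continuousOn_latSum hδ (r := 3 / 8 + x / 4) (by linarith)).continuousAt
        (hop.mem_nhds (x := (g x, (x:ℂ))) ⟨hgx, by simp; linarith⟩)
      exact ContinuousAt.comp (g := fun w : ℂ × ℂ => latSum w.1 w.2)
        (f := fun τ : ℂ => (g τ, τ)) h1 (by fun_prop)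
    have hm : ‖(1 - (x:ℂ)) / 4‖ < 3 / 8 + x / 4 := by
      have : (1 - (x:ℂ)) / 4 = (((1 - x) / 4 : ℝ) : ℂ) := by push_cast; ring
      rw [this, Complex.norm_real, Real.norm_eq_abs, abs_lt]
      constructor <;> linarith
    have hp : ‖(1 + (x:ℂ)) / 4‖ < 3 / 8 + x / 4 := by
      have : (1 + (x:ℂ)) / 4 = (((1 + x) / 4 : ℝ) : ℂ) := by push_cast; ring
      rw [this, Complex.norm_real, Real.norm_eq_abs, abs_lt]
      constructor <;> linarith
    unfold quarterSum
    exact (((key (fun τ => (1 - τ) / 4) (by fun_prop) hm).add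
      (key (fun τ => (1 + τ) / 4) (by fun_prop) hp)).add
      (key (fun τ => -((1 + τ) / 4)) (by fun_prop) (by rw [norm_neg]; exact hp))).add
      (key (fun τ => -((1 - τ) / 4)) (by fun_prop) (by rw [norm_neg]; exact hm))
  have hq2 : ContinuousAt (fun w : ℂ × ℂ => quarterSum w.2) ((y : ℂ), (x : ℂ)) :=
    ContinuousAt.comp (g := quarterSum) (f := fun w : ℂ × ℂ => w.2) hquart continuousAt_snd
  have hFc : ContinuousAt F ((y : ℂ), (x : ℂ)) := by
    refine (continuousAt_const.mul (ContinuousAt.cexp (ContinuousAt.neg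
      (ContinuousAt.div (by fun_prop) (by fun_prop) ?_)))).mul (ContinuousAt.cexp ?_)
    · exact mul_ne_zero (by norm_num) hx0
    · refine (((hq2.neg.div_const 2).mul hcen.continuousAt).add
        (ContinuousAt.div (by fun_prop) (by fun_prop) ?_)).add hlogc
      exact mul_ne_zero (by norm_num) hx0
  refine ⟨F, F ((y : ℂ), (x : ℂ)), ?_, hFc.tendsto.mono_left nhdsWithin_le_nhds, ?_⟩
  · exact mul_ne_zero (mul_ne_zero hζ (Complex.exp_ne_zero _)) (Complex.exp_ne_zero _)
  · have h1 : ∀ᶠ w : ℂ × ℂ in 𝓝 ((y : ℂ), (x : ℂ)), ‖cen w.1 w.2‖ < 1 / 2 + x / 8 :=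
      (hcen.norm.tendsto _).eventually_lt_const hcen0
    have h2 : ∀ᶠ w : ℂ × ℂ in 𝓝 ((y : ℂ), (x : ℂ)), x / 2 < w.2.re :=
      ((Complex.continuous_re.comp continuous_snd).tendsto _).eventually_const_lt (by simp; linarith)
    have h3 : ∀ᶠ w : ℂ × ℂ in 𝓝 ((y : ℂ), (x : ℂ)), w.2.im < x / 2 :=
      ((Complex.continuous_im.comp continuous_snd).tendsto _).eventually_lt_const (by simp; linarith)
    filter_upwards [h1.filter_mono nhdsWithin_le_nhds, h2.filter_mono nhdsWithin_le_nhds,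
      h3.filter_mono nhdsWithin_le_nhds, self_mem_nhdsWithin] with w hw1 hw2 hw3 him
    have him : 0 < w.2.im := him
    have := qPoch_inv_eq hδ hw2.le (r := 1 / 2 + x / 8) (by linarith) him hw1
    rw [jden_S, moeb_S, this, hsig w.2 ⟨him, by linarith⟩, hF, sigExp,
      logDiff_center him (by linarith)]

/-- `y` does not lie in `ℤ + ℤ x`. -/
def OffLattice (y x : ℝ) : Prop := ∀ a b : ℤ, y ≠ a + b * x

lemma tendsto_shift (n : ℤ) (z τ : ℂ) :
    Tendsto (fun w : ℂ × ℂ => (w.1 + n, w.2)) (𝓝[upperSet] (z, τ)) (𝓝[upperSet] (z + n, τ)) := by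
  refine tendsto_nhdsWithin_iff.2 ⟨?_, ?_⟩
  · have : Continuous fun w : ℂ × ℂ => (w.1 + (n:ℂ), w.2) := by fun_prop
    exact (this.tendsto (z, τ)).mono_left nhdsWithin_le_nhds
  · filter_upwards [self_mem_nhdsWithin] with w hw using hw

lemma one_sub_ex_div_ne_zero {x y : ℝ} (hx : 0 < x) (hy : OffLattice y x) :
    1 - ex ((y:ℂ) / x) ≠ 0 := by
  intro h
  obtain ⟨n, hn⟩ := (ex_eq_one_iff _).1 (sub_eq_zero.1 h).symm
  have hx0 : ((x:ℝ):ℂ) ≠ 0 := by exact_mod_cast hx.ne'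
  rw [div_eq_iff hx0] at hn
  exact hy 0 n (by push_cast; rw [zero_add]; exact_mod_cast hn)

lemma qPoch_inv_shift (z : ℂ) {τ : ℂ} (hτ : 0 < τ.im) :
    qPoch ((z + 1) / τ) (-1 / τ) = (1 - ex ((z + 1) / τ)) * qPoch (z / τ) (-1 / τ) := by
  rw [qPoch_eq_mul ((z + 1) / τ) (im_neg_inv_pos hτ), show (z + 1) / τ + -1 / τ = z / τ by ring]

lemma tendsto_one_sub_ex_div (c : ℂ) (y : ℂ) {x : ℝ} (hx : 0 < x) :
    Tendsto (fun w : ℂ × ℂ => 1 - ex ((w.1 + c) / w.2)) (𝓝[upperSet] (y, (x : ℂ)))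
      (𝓝 (1 - ex ((y + c) / x))) := by
  have hx0 : ((x:ℝ):ℂ) ≠ 0 := by exact_mod_cast hx.ne'
  have : ContinuousAt (fun w : ℂ × ℂ => 1 - ex ((w.1 + c) / w.2)) (y, (x : ℂ)) :=
    continuousAt_const.sub (continuous_ex.continuousAt.comp
      ((continuousAt_fst.add continuousAt_const).div continuousAt_snd hx0))
  exact this.tendsto.mono_left nhdsWithin_le_nhds

/-- Translating z by 1 leaves ϖ(z, τ) unchanged and multiplies ϖ(z/τ, -1/τ) by 1 - e((z + 1)/τ),
which is nonzero at the limit point because it lies off the lattice. -/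
lemma hasLim_S_add_one {x y : ℝ} (hx : 0 < x) (hy : OffLattice (y + 1) x)
    (h : HasLim ModularGroup.S y x) : HasLim ModularGroup.S (y + 1) x := by
  obtain ⟨F, l, hl, hlim, hF⟩ := h
  have hs := tendsto_shift (-1) ((y + 1 : ℝ) : ℂ) x
  rw [show ((y + 1 : ℝ) : ℂ) + ((-1 : ℤ) : ℂ) = y by push_cast; ring] at hs
  have h2 := tendsto_one_sub_ex_div 0 ((y + 1 : ℝ) : ℂ) hx
  rw [add_zero] at h2
  refine ⟨_, _, mul_ne_zero (one_sub_ex_div_ne_zero hx hy) hl, h2.mul (hlim.comp hs), ?_⟩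
  filter_upwards [self_mem_nhdsWithin, hs.eventually hF] with w hw hw2
  have hw : 0 < w.2.im := hw
  have h3 := qPoch_inv_shift (w.1 + ((-1 : ℤ) : ℂ)) hw
  simp only [jden_S, moeb_S] at hw2 ⊢
  rw [hw2, show w.1 + ((-1 : ℤ) : ℂ) + 1 = w.1 by push_cast; ring] at h3
  rw [h3, qPoch_add_intCast, add_zero, Function.comp]
  ring

lemma hasLim_S_sub_one {x y : ℝ} (hx : 0 < x) (hy : OffLattice y x)
    (h : HasLim ModularGroup.S y x) : HasLim ModularGroup.S (y - 1) x := by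
  obtain ⟨F, l, hl, hlim, hF⟩ := h
  have hs := tendsto_shift 1 ((y - 1 : ℝ) : ℂ) x
  rw [show ((y - 1 : ℝ) : ℂ) + ((1 : ℤ) : ℂ) = y by push_cast; ring] at hs
  have h2 := tendsto_one_sub_ex_div 1 ((y - 1 : ℝ) : ℂ) hx
  rw [show ((y - 1 : ℝ) : ℂ) + 1 = y by push_cast; ring] at h2
  have hne := one_sub_ex_div_ne_zero hx hy
  refine ⟨_, _, div_ne_zero hl hne, (hlim.comp hs).div h2 hne, ?_⟩
  filter_upwards [self_mem_nhdsWithin, hs.eventually hF, h2.eventually_ne hne] with w hw hw2 hw3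
  have hw : 0 < w.2.im := hw
  have h3 := qPoch_inv_shift w.1 hw
  simp only [jden_S, moeb_S, Int.cast_one] at hw2 ⊢
  rw [hw2, qPoch_add_one] at h3
  rw [Pi.div_apply, Function.comp, div_mul_eq_mul_div, eq_div_iff hw3, mul_comm, ← h3]

lemma OffLattice.add_int {y x : ℝ} (h : OffLattice y x) (n : ℤ) : OffLattice (y + n) x := by
  intro a b hab
  exact h (a - n) b (by push_cast; linarith)

lemma hasLim_S {x y : ℝ} (hx : 0 < x) (hy : OffLattice y x) : HasLim ModularGroup.S y x := by
  set n : ℤ := round (y + 1 / 2 - x / 2) with hn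
  have h0 : HasLim ModularGroup.S (y - n) x := by
    refine hasLim_S_near_center hx ?_
    have := abs_sub_round (y + 1 / 2 - x / 2)
    rw [← hn] at this
    rwa [show y - n + 1 / 2 - x / 2 = y + 1 / 2 - x / 2 - n by ring]
  have hup : ∀ k : ℕ, HasLim ModularGroup.S (y - n + k) x := by
    intro k
    induction k with
    | zero => simpa using h0
    | succ k ih =>
      push_cast
      rw [← add_assoc]
      refine hasLim_S_add_one hx ?_ ih
      convert hy.add_int (-n + k + 1) using 1
      push_cast; ring
  have hdown : ∀ k : ℕ, HasLim ModularGroup.S (y - n - k) x := by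
    intro k
    induction k with
    | zero => simpa using h0
    | succ k ih =>
      push_cast
      rw [← sub_sub]
      refine hasLim_S_sub_one hx ?_ ih
      convert hy.add_int (-n - k) using 1
      push_cast; ring
  obtain ⟨k, hk | hk⟩ := n.eq_nat_or_neg
  · have := hup k
    rw [hk] at this; simpa using this
  · have := hdown k
    rw [hk] at this; simpa using this

/-! ### Continuation for all of `SL(2, ℤ)` -/

lemma sl_det (M : SL(2, ℤ)) : M 0 0 * M 1 1 - M 0 1 * M 1 0 = 1 := by
  have := M.2; rwa [Matrix.det_fin_two] at this

lemma sl_mul (M N : SL(2, ℤ)) (i j : Fin 2) : (M * N) i j = M i 0 * N 0 j + M i 1 * N 1 j := by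
  rw [Matrix.SpecialLinearGroup.coe_mul, Matrix.mul_apply, Fin.sum_univ_two]

lemma jden_ne_zero (M : SL(2, ℤ)) {τ : ℂ} (hτ : 0 < τ.im) : jden M τ ≠ 0 := by
  intro h
  have him := congrArg Complex.im h
  have hre := congrArg Complex.re h
  simp [jden] at him hre
  have hg : M 1 0 = 0 := by
    rcases him with h | h
    · exact_mod_cast h
    · exact absurd h hτ.ne'
  rw [hg] at hre
  have hd : M 1 1 = 0 := by simpa using hre
  have := sl_det M
  rw [hg, hd] at this
  simp at this

lemma moeb_im_pos (M : SL(2, ℤ)) {τ : ℂ} (hτ : 0 < τ.im) : 0 < (moeb M τ).im := by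
  have hj := Complex.normSq_pos.2 (jden_ne_zero M hτ)
  have hdet : (M 0 0 : ℝ) * M 1 1 - M 0 1 * M 1 0 = 1 := by exact_mod_cast sl_det M
  have : (moeb M τ).im = τ.im / Complex.normSq (jden M τ) := by
    unfold moeb
    rw [Complex.div_im, ← sub_div]
    congr 1
    simp only [jden, Complex.add_im, Complex.add_re, Complex.mul_im, Complex.mul_re,
      Complex.intCast_re, Complex.intCast_im]
    linear_combination τ.im * hdet
  rw [this]; positivity

lemma jden_mul (M N : SL(2, ℤ)) {τ : ℂ} (h : jden N τ ≠ 0) :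
    jden (M * N) τ = jden M (moeb N τ) * jden N τ := by
  have h1 : jden M (moeb N τ) * jden N τ =
      M 1 0 * (moeb N τ * jden N τ) + M 1 1 * jden N τ := by unfold jden; ring
  have h2 : moeb N τ * jden N τ = N 0 0 * τ + N 0 1 := by
    unfold moeb; rw [div_mul_cancel₀ _ h]
  rw [h1, h2]
  simp only [jden, sl_mul]
  push_cast; ring

lemma moeb_mul (M N : SL(2, ℤ)) {τ : ℂ} (h : jden N τ ≠ 0) :
    moeb (M * N) τ = moeb M (moeb N τ) := by
  have h2 : moeb N τ * jden N τ = N 0 0 * τ + N 0 1 := by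
    unfold moeb; rw [div_mul_cancel₀ _ h]
  have h3 : ((M * N) 0 0 : ℂ) * τ + (M * N) 0 1 =
      (M 0 0 * moeb N τ + M 0 1) * jden N τ := by
    rw [add_mul, mul_assoc, h2]
    simp only [jden, sl_mul]; push_cast; ring
  rw [moeb, jden_mul M N h, h3, mul_div_mul_right _ _ h]
  rfl

lemma continuous_jden (M : SL(2, ℤ)) : Continuous (jden M) := by unfold jden; fun_prop

lemma continuousAt_moeb (M : SL(2, ℤ)) {τ : ℂ} (h : jden M τ ≠ 0) : ContinuousAt (moeb M) τ := by
  unfold moeb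
  exact ContinuousAt.div (by fun_prop) (continuous_jden M).continuousAt h

lemma tendsto_act (N : SL(2, ℤ)) (z : ℂ) {τ : ℂ} (h : jden N τ ≠ 0) :
    Tendsto (fun w : ℂ × ℂ => (w.1 / jden N w.2, moeb N w.2)) (𝓝[upperSet] (z, τ))
      (𝓝[upperSet] (z / jden N τ, moeb N τ)) := by
  refine tendsto_nhdsWithin_iff.2 ⟨?_, ?_⟩
  · have h1 : ContinuousAt (fun w : ℂ × ℂ => w.1 / jden N w.2) (z, τ) :=
      continuousAt_fst.div ((continuous_jden N).comp continuous_snd).continuousAt h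
    have h2 : ContinuousAt (fun w : ℂ × ℂ => moeb N w.2) (z, τ) :=
      ContinuousAt.comp (g := moeb N) (f := fun w : ℂ × ℂ => w.2) (continuousAt_moeb N h)
        continuousAt_snd
    exact (h1.prodMk h2).tendsto.mono_left nhdsWithin_le_nhds
  · filter_upwards [self_mem_nhdsWithin] with w hw using moeb_im_pos N hw

/-- The cocycle relation: the factor of MN at (z, τ) is that of M at the image of (z, τ) under N,
times that of N. -/
lemma HasLim.mul {M N : SL(2, ℤ)} {y x y' x' : ℝ} (hj : jden N x ≠ 0)
    (hy : (y' : ℂ) = y / jden N x) (hx : (x' : ℂ) = moeb N x) (hM : HasLim M y' x')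
    (hN : HasLim N y x) : HasLim (M * N) y x := by
  obtain ⟨F, l, hl, hF, hFe⟩ := hM
  obtain ⟨G, k, hk, hG, hGe⟩ := hN
  have ht := tendsto_act N (y : ℂ) hj
  rw [← hy, ← hx] at ht
  refine ⟨_, _, mul_ne_zero hl hk, (hF.comp ht).mul hG, ?_⟩
  filter_upwards [ht.eventually hFe, hGe, self_mem_nhdsWithin] with w h1 h2 h3
  have h3 : 0 < w.2.im := h3
  have hjw := jden_ne_zero N h3
  rw [jden_mul M N hjw, moeb_mul M N hjw, mul_comm (jden M _), ← div_div, h1, h2, Function.comp,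
    mul_assoc]

lemma qPoch_add_int_right (z τ : ℂ) (n : ℤ) : qPoch z (τ + n) = qPoch z τ := by
  simp only [qPoch_eq]
  refine tprod_congr fun k => ?_
  have : z + k * (τ + n) = (z + k * τ) + ((k * n : ℤ) : ℂ) := by push_cast; ring
  rw [this, ex_add, ex_intCast, mul_one]

lemma hasLim_of_lower_left_eq_zero {M : SL(2, ℤ)} (h0 : M 1 0 = 0) (h1 : M 1 1 = 1) (y x : ℝ) :
    HasLim M y x := by
  have hd := sl_det M
  rw [h0, h1] at hd
  have ha : M 0 0 = 1 := by linarith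
  refine ⟨fun _ => 1, 1, one_ne_zero, tendsto_const_nhds, Eventually.of_forall fun w => ?_⟩
  simp [jden, moeb, h0, h1, ha, qPoch_add_int_right]

lemma S_inv_entries : (ModularGroup.S⁻¹ : SL(2, ℤ)) 0 0 = 0 ∧ (ModularGroup.S⁻¹ : SL(2, ℤ)) 0 1 = 1 ∧
    (ModularGroup.S⁻¹ : SL(2, ℤ)) 1 0 = -1 ∧ (ModularGroup.S⁻¹ : SL(2, ℤ)) 1 1 = 0 := by
  simp [Matrix.SpecialLinearGroup.coe_inv, ModularGroup.coe_S, Matrix.adjugate_fin_two]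

lemma S_entries : ModularGroup.S 0 0 = 0 ∧ ModularGroup.S 0 1 = -1 ∧
    ModularGroup.S 1 0 = 1 ∧ ModularGroup.S 1 1 = 0 := by
  simp [ModularGroup.coe_S]

lemma jden_S_inv (τ : ℂ) : jden ModularGroup.S⁻¹ τ = -τ := by
  obtain ⟨_, _, h3, h4⟩ := S_inv_entries
  simp [jden, h3, h4]

lemma moeb_S_inv (τ : ℂ) : moeb ModularGroup.S⁻¹ τ = -1 / τ := by
  obtain ⟨h1, h2, _, _⟩ := S_inv_entries
  rw [moeb, jden_S_inv, h1, h2]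
  simp [div_neg, neg_div]

lemma OffLattice.S_act {y x : ℝ} (hx : x ≠ 0) (h : OffLattice y x) :
    OffLattice (y / x) (-1 / x) := by
  intro a b hab
  refine h (-b) a ?_
  field_simp at hab
  push_cast; linarith

lemma OffLattice.neg {y x : ℝ} (h : OffLattice y x) : OffLattice (-y) x := by
  intro a b hab
  refine h (-a) (-b) ?_
  push_cast; linarith

/-- The action of S⁻¹ sends a point with x < 0 to one with positive second coordinate, where S is
already treated. The two actions undo each other, so the factor is the reciprocal one. -/
lemma hasLim_S_inv {x y : ℝ} (hx : x < 0) (hy : OffLattice y x) :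
    HasLim ModularGroup.S⁻¹ y x := by
  have hx0 : ((x:ℝ):ℂ) ≠ 0 := by exact_mod_cast hx.ne
  have hS : HasLim ModularGroup.S (-(y / x)) (-1 / x) :=
    hasLim_S (by rw [neg_div]; have := one_div_neg.2 hx; linarith) (hy.S_act hx.ne).neg
  obtain ⟨F, l, hl, hF, hFe⟩ := hS
  have ht := tendsto_act ModularGroup.S⁻¹ (y : ℂ) (τ := x) (by rw [jden_S_inv]; simpa using hx0)
  rw [jden_S_inv, moeb_S_inv] at ht
  have e1 : (y : ℂ) / -(x:ℂ) = ((-(y / x) : ℝ) : ℂ) := by push_cast; rw [div_neg]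
  have e2 : -1 / (x:ℂ) = ((-1 / x : ℝ) : ℂ) := by push_cast; ring
  rw [e1, e2] at ht
  have hlim := hF.comp ht
  refine ⟨_, _, inv_ne_zero hl, hlim.inv₀ hl, ?_⟩
  filter_upwards [ht.eventually hFe, hlim.eventually_ne hl, self_mem_nhdsWithin] with w h1 h2 h3
  have h3 : w.2 ≠ 0 := ne_zero_of_im h3
  simp only [jden_S, moeb_S, jden_S_inv, moeb_S_inv] at h1 ⊢
  rw [show w.1 / -w.2 / (-1 / w.2) = w.1 by field_simp, show -1 / (-1 / w.2) = w.2 by field_simp]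
    at h1
  rw [h1]
  simp only [Function.comp, jden_S_inv, moeb_S_inv] at h2 ⊢
  rw [inv_mul_cancel_left₀ h2]

lemma T_zpow_entries (k : ℤ) : (ModularGroup.T ^ k : SL(2, ℤ)) 0 0 = 1 ∧
    (ModularGroup.T ^ k : SL(2, ℤ)) 0 1 = k ∧ (ModularGroup.T ^ k : SL(2, ℤ)) 1 0 = 0 ∧
    (ModularGroup.T ^ k : SL(2, ℤ)) 1 1 = 1 := by
  simp [ModularGroup.coe_T_zpow]

lemma HasLim.mul_T_zpow {M : SL(2, ℤ)} {y x : ℝ} (k : ℤ) (h : HasLim M y (x + k)) :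
    HasLim (M * ModularGroup.T ^ k) y x := by
  obtain ⟨t1, t2, t3, t4⟩ := T_zpow_entries k
  have hj : jden (ModularGroup.T ^ k) x = 1 := by simp [jden, t3, t4]
  refine HasLim.mul (y' := y) (x' := x + k) (by rw [hj]; exact one_ne_zero) (by rw [hj, div_one]) ?_
    h (hasLim_of_lower_left_eq_zero t3 t4 y x)
  rw [moeb, hj, t1, t2]; push_cast; ring

lemma HasLim.mul_S {M : SL(2, ℤ)} {y x : ℝ} (hx : 0 < x) (hy : OffLattice y x)
    (h : HasLim M (y / x) (-1 / x)) : HasLim (M * ModularGroup.S) y x := by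
  refine HasLim.mul (y' := y / x) (x' := -1 / x) ?_ ?_ ?_ h (hasLim_S hx hy)
  · rw [jden_S]; exact_mod_cast hx.ne'
  · rw [jden_S]; push_cast; ring
  · rw [moeb_S]; push_cast; ring

lemma HasLim.mul_S_inv {M : SL(2, ℤ)} {y x : ℝ} (hx : x < 0) (hy : OffLattice y x)
    (h : HasLim M (-(y / x)) (-1 / x)) : HasLim (M * ModularGroup.S⁻¹) y x := by
  refine HasLim.mul (y' := -(y / x)) (x' := -1 / x) ?_ ?_ ?_ h (hasLim_S_inv hx hy)
  · rw [jden_S_inv]; simpa using hx.ne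
  · rw [jden_S_inv]; push_cast; rw [div_neg]
  · rw [moeb_S_inv]; push_cast; ring

lemma OffLattice.add_right {y x : ℝ} (h : OffLattice y x) (k : ℤ) : OffLattice y (x + k) := by
  intro a b hab
  refine h (a + b * k) b ?_
  push_cast; linarith

/-- The quotient of infinite products extends to all real points with `j_M > 0`. -/
theorem hasLim_of_pos (M : SL(2, ℤ)) {y x : ℝ} (hj : 0 < (M 1 0 : ℝ) * x + M 1 1)
    (hy : OffLattice y x) : HasLim M y x := by
  induction hn : (M 1 0).natAbs using Nat.strong_induction_on generalizing M y x with
  | _ n ih =>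
  by_cases hc : M 1 0 = 0
  · refine hasLim_of_lower_left_eq_zero hc ?_ y x
    have hd := sl_det M
    rw [hc] at hd hj
    have h11 : 0 < M 1 1 := by
      have : (0:ℝ) < M 1 1 := by simpa using hj
      exact_mod_cast this
    have hdvd : M 1 1 ∣ 1 := ⟨M 0 0, by linarith⟩
    exact Int.eq_one_of_dvd_one h11.le hdvd
  -- Division with remainder taken so that d₁ = δ - γk satisfies -|γ| < d₁ ≤ 0. The sign matters:
  -- γx₁ + d₁ > 0 then forces x₁ to have the sign of γ, which decides between splitting off S and
  -- S⁻¹ and makes the corresponding step legitimate. The remaining matrix has lower left entry ±d₁.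
  · set k : ℤ := -((-M 1 1) / M 1 0) with hk
    set d₁ : ℤ := M 1 1 - M 1 0 * k with hd1
    have hd1' : d₁ = -((-M 1 1) % M 1 0) := by
      rw [hd1, hk, Int.emod_def]; ring
    have hd1nonpos : d₁ ≤ 0 := by
      rw [hd1']; have := Int.emod_nonneg (-M 1 1) hc; omega
    have hd1abs : d₁.natAbs < (M 1 0).natAbs := by
      have h1 := Int.emod_lt_abs (-M 1 1) hc
      have h2 := Int.emod_nonneg (-M 1 1) hc
      rw [Int.abs_eq_natAbs] at h1
      omega
    obtain ⟨t1, t2, t3, t4⟩ := T_zpow_entries (-k)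
    set x₁ : ℝ := x + k with hx1
    have hy1 : OffLattice y x₁ := hy.add_right k
    have hjx : 0 < (M 1 0 : ℝ) * x₁ + d₁ := by
      rw [hx1, hd1]; push_cast
      have : (M 1 0 : ℝ) * (x + k) + (M 1 1 - M 1 0 * k) = M 1 0 * x + M 1 1 := by ring
      rw [this]; exact hj
    have hd1r : (d₁ : ℝ) ≤ 0 := by exact_mod_cast hd1nonpos
    rcases lt_or_gt_of_ne hc with hneg | hpos
    · have hnegr : (M 1 0 : ℝ) < 0 := by exact_mod_cast hneg
      have hx1neg : x₁ < 0 := by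
        by_contra h; push Not at h
        nlinarith [mul_nonpos_of_nonpos_of_nonneg hnegr.le h]
      set M₂ : SL(2, ℤ) := M * ModularGroup.T ^ (-k) * ModularGroup.S with hM2
      obtain ⟨s1, s2, s3, s4⟩ := S_entries
      have e10 : M₂ 1 0 = d₁ := by
        simp only [hM2, sl_mul, t1, t2, t3, t4, s1, s3, hd1]
        ring
      have e11 : M₂ 1 1 = -M 1 0 := by
        simp only [hM2, sl_mul, t1, t2, t3, t4, s2, s4]
        ring
      have hMeq : M = M₂ * ModularGroup.S⁻¹ * ModularGroup.T ^ k := by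
        rw [hM2, mul_inv_cancel_right, mul_assoc, ← zpow_add]; simp
      rw [hMeq]
      refine HasLim.mul_T_zpow k (HasLim.mul_S_inv hx1neg hy1 ?_)
      refine ih _ ?_ M₂ ?_ (hy1.S_act hx1neg.ne).neg rfl
      · rw [e10, ← hn]; exact hd1abs
      · rw [e10, e11]
        have : (d₁ : ℝ) * (-1 / x₁) + ((-M 1 0 : ℤ) : ℝ) = (M 1 0 * x₁ + d₁) / (-x₁) := by
          have := hx1neg.ne
          field_simp; push_cast; ring
        rw [this]
        exact div_pos hjx (by linarith)
    · have hposr : (0 : ℝ) < M 1 0 := by exact_mod_cast hpos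
      have hx1pos : 0 < x₁ := by
        by_contra h; push Not at h
        nlinarith [mul_nonpos_of_nonneg_of_nonpos hposr.le h]
      set M₂ : SL(2, ℤ) := M * ModularGroup.T ^ (-k) * ModularGroup.S⁻¹ with hM2
      obtain ⟨s1, s2, s3, s4⟩ := S_inv_entries
      have e10 : M₂ 1 0 = -d₁ := by
        simp only [hM2, sl_mul, t1, t2, t3, t4, s1, s3, hd1]
        ring
      have e11 : M₂ 1 1 = M 1 0 := by
        simp only [hM2, sl_mul, t1, t2, t3, t4, s2, s4]
        ring
      have hMeq : M = M₂ * ModularGroup.S * ModularGroup.T ^ k := by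
        rw [hM2, inv_mul_cancel_right, mul_assoc, ← zpow_add]; simp
      rw [hMeq]
      refine HasLim.mul_T_zpow k (HasLim.mul_S hx1pos hy1 ?_)
      refine ih _ ?_ M₂ ?_ (hy1.S_act hx1pos.ne') rfl
      · rw [e10, ← hn, Int.natAbs_neg]; exact hd1abs
      · rw [e10, e11]
        have : ((-d₁ : ℤ) : ℝ) * (-1 / x₁) + (M 1 0 : ℝ) = (M 1 0 * x₁ + d₁) / x₁ := by
          have := hx1pos.ne'
          field_simp; push_cast; ring
        rw [this]
        exact div_pos hjx hx1pos

/-! ### Values of the modular cocycle at real quadratic points -/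

lemma qPochFin_eq (n : ℤ) (z τ : ℂ) : qPochFin n z τ =
    if 0 ≤ n then ∏ k ∈ Finset.Ico 0 n, (1 - ex (z + k * τ))
    else ∏ k ∈ Finset.Ico n 0, (1 - ex (z + k * τ))⁻¹ := rfl

lemma qPochFin_ne_zero (n : ℤ) {z τ : ℂ} (h : ∀ k : ℤ, ex (z + k * τ) ≠ 1) :
    qPochFin n z τ ≠ 0 := by
  rw [qPochFin_eq]
  split_ifs
  · exact Finset.prod_ne_zero_iff.2 fun k _ => sub_ne_zero.2 (h k).symm
  · exact Finset.prod_ne_zero_iff.2 fun k _ => inv_ne_zero (sub_ne_zero.2 (h k).symm)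

lemma tendsto_qPochFin {X : Type*} {l : Filter X} (n : ℤ) {f g : X → ℂ} {z τ : ℂ}
    (hf : Tendsto f l (𝓝 z)) (hg : Tendsto g l (𝓝 τ)) (h : ∀ k : ℤ, ex (z + k * τ) ≠ 1) :
    Tendsto (fun x => qPochFin n (f x) (g x)) l (𝓝 (qPochFin n z τ)) := by
  simp only [qPochFin_eq]
  have hk : ∀ k : ℤ, Tendsto (fun x => 1 - ex (f x + k * g x)) l (𝓝 (1 - ex (z + k * τ))) :=
    fun k => tendsto_const_nhds.sub
      ((continuous_ex.tendsto _).comp (hf.add (tendsto_const_nhds.mul hg)))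
  split_ifs
  · exact tendsto_finsetProd _ fun k _ => hk k
  · exact tendsto_finsetProd _ fun k _ => (hk k).inv₀ (sub_ne_zero.2 (h k).symm)

lemma qPochFin_succ (n : ℤ) {z τ : ℂ} (h : ∀ k : ℤ, ex (z + k * τ) ≠ 1) :
    qPochFin (n + 1) z τ = qPochFin n z τ * (1 - ex (z + n * τ)) := by
  rw [qPochFin_eq, qPochFin_eq]
  by_cases h0 : 0 ≤ n
  · have hins : Finset.Ico 0 (n + 1) = insert n (Finset.Ico 0 n) := by
      ext k; simp only [Finset.mem_Ico, Finset.mem_insert]; omega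
    rw [if_pos (by omega), if_pos h0, hins,
      Finset.prod_insert (by simp), mul_comm]
  · rw [if_neg h0]
    have hne : 1 - ex (z + n * τ) ≠ 0 := sub_ne_zero.2 (h n).symm
    have hsp : ∏ k ∈ Finset.Ico n 0, (1 - ex (z + k * τ))⁻¹ =
        (1 - ex (z + n * τ))⁻¹ * ∏ k ∈ Finset.Ico (n + 1) 0, (1 - ex (z + k * τ))⁻¹ := by
      have hins : Finset.Ico n 0 = insert n (Finset.Ico (n + 1) 0) := by
        ext k; simp only [Finset.mem_Ico, Finset.mem_insert]; omega
      rw [hins, Finset.prod_insert (by simp)]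
    rw [hsp]
    by_cases h1 : 0 ≤ n + 1
    · have : n = -1 := by omega
      subst this
      rw [if_pos (by norm_num)]
      simp only [Int.reduceNeg, neg_add_cancel, Finset.Ico_self, Finset.prod_empty, mul_one]
      rw [inv_mul_cancel₀ hne]
    · rw [if_neg h1, mul_comm, mul_inv_cancel_left₀ hne]

lemma qPoch_eq_qPochFin_mul (n : ℤ) {z τ : ℂ} (hτ : 0 < τ.im) (h : ∀ k : ℤ, ex (z + k * τ) ≠ 1) :
    qPoch z τ = qPochFin n z τ * qPoch (z + n * τ) τ := by
  have step : ∀ n : ℤ, qPochFin n z τ * qPoch (z + n * τ) τ =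
      qPochFin (n + 1) z τ * qPoch (z + (n + 1 : ℤ) * τ) τ := by
    intro n
    rw [qPochFin_succ n h, qPoch_eq_mul (z + n * τ) hτ, mul_assoc]
    congr 3
    push_cast; ring
  induction n using Int.induction_on with
  | zero => simp [qPochFin]
  | succ k ih => rw [← step]; exact ih
  | pred k ih => rw [step, sub_add_cancel]; exact ih

/-- `M r ≡ r` modulo `ℤ²`. -/
def FixesMod (M : SL(2, ℤ)) (r : Fin 2 → ℚ) : Prop :=
  ∃ N : Fin 2 → ℤ, ∀ i, (M i 0 : ℚ) * r 0 + M i 1 * r 1 = r i + N i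

/-- `r` does not lie in `ℤ²`. -/
def NonIntegral (r : Fin 2 → ℚ) : Prop := ¬ ∃ N : Fin 2 → ℤ, ∀ i, r i = N i

lemma ex_pairing_ne_one_of_im {r : Fin 2 → ℚ} (hr : NonIntegral r) {τ : ℂ} (hτ : 0 < τ.im) (k : ℤ) :
    ex (pairing r τ + k * τ) ≠ 1 := by
  intro h
  obtain ⟨n, hn⟩ := (ex_eq_one_iff _).1 h
  have him := congrArg Complex.im hn
  have hre := congrArg Complex.re hn
  simp [pairing] at him hre
  have h1 : ((r 1 : ℚ) : ℝ) = -k := by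
    have : (((r 1 : ℚ) : ℝ) + k) * τ.im = 0 := by linarith
    rcases mul_eq_zero.1 this with h | h
    · linarith
    · exact absurd h hτ.ne'
  have h0 : ((r 0 : ℚ) : ℝ) = -n := by rw [h1] at hre; linarith
  refine hr ⟨![-n, -k], fun i => ?_⟩
  fin_cases i
  · simp only [Fin.zero_eta, Matrix.cons_val_zero]; exact_mod_cast h0
  · simp only [Fin.mk_one, Matrix.cons_val_one]; exact_mod_cast h1

lemma offLattice_pairing {r : Fin 2 → ℚ} (hr : NonIntegral r) {x : ℝ} (hx : Irrational x) :
    OffLattice ((r 1 : ℝ) * x - (r 0 : ℝ)) x := by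
  intro a b hab
  have h : (((r 1 - b : ℚ) : ℝ)) * x = ((a + r 0 : ℚ) : ℝ) := by push_cast; linarith
  have h1 : r 1 - b = 0 := by
    by_contra hne
    refine hx ⟨(a + r 0) / (r 1 - b), ?_⟩
    have hne' : (((r 1 - b : ℚ) : ℝ)) ≠ 0 := by exact_mod_cast hne
    push_cast at h hne' ⊢
    rw [div_eq_iff hne']
    linarith
  rw [h1] at h
  have h0 : a + r 0 = 0 := by
    have : (((a + r 0 : ℚ)) : ℝ) = 0 := by rw [← h]; simp
    exact_mod_cast this
  refine hr ⟨![-a, b], fun i => ?_⟩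
  fin_cases i
  · simp only [Fin.zero_eta, Matrix.cons_val_zero]; push_cast; linarith
  · change r 1 = (b : ℚ); linarith

lemma ex_pairing_ne_one_of_irrational {r : Fin 2 → ℚ} (hr : NonIntegral r) {x : ℝ}
    (hx : Irrational x) (k : ℤ) : ex (pairing r (x : ℂ) + k * (x : ℂ)) ≠ 1 := by
  intro h
  obtain ⟨n, hn⟩ := (ex_eq_one_iff _).1 h
  refine offLattice_pairing hr hx n (-k) ?_
  have : ((((r 1 : ℚ) : ℝ) * x - ((r 0 : ℚ) : ℝ) + k * x : ℝ) : ℂ) = ((n : ℝ) : ℂ) := by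
    rw [pairing] at hn; push_cast; exact hn
  have := Complex.ofReal_injective this
  push_cast; linarith

/-- `ϖ(⟨r, τ⟩, τ)`. -/
def thetaLike (r : Fin 2 → ℚ) (τ : ℂ) : ℂ := qPoch (pairing r τ) τ

lemma thetaLike_ne_zero {r : Fin 2 → ℚ} (hr : NonIntegral r) {τ : ℂ} (hτ : 0 < τ.im) :
    thetaLike r τ ≠ 0 := by
  refine qPoch_ne_zero hτ fun k m h => ex_pairing_ne_one_of_im hr hτ k ?_
  rw [ex_eq_one_iff]; exact ⟨m, by exact_mod_cast h⟩

/-- The upper half plane as a subset of `ℂ`. -/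
def upperHalf : Set ℂ := {τ | 0 < τ.im}

instance neBot_nhdsWithin_upperHalf (x : ℝ) : (𝓝[upperHalf] (x : ℂ)).NeBot := by
  rw [← mem_closure_iff_nhdsWithin_neBot]
  have : closure {τ : ℂ | 0 < τ.im} = {τ | 0 ≤ τ.im} := Complex.closure_setOfPred_lt_im 0
  rw [upperHalf, this]
  simp

lemma continuous_pairing (r : Fin 2 → ℚ) : Continuous (pairing r) := by unfold pairing; fun_prop

lemma tendsto_path (r : Fin 2 → ℚ) (x : ℝ) :
    Tendsto (fun τ : ℂ => (pairing r τ, τ)) (𝓝[upperHalf] (x : ℂ))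
      (𝓝[upperSet] (pairing r x, (x : ℂ))) := by
  refine tendsto_nhdsWithin_iff.2 ⟨?_, ?_⟩
  · exact (((continuous_pairing r).prodMk continuous_id).tendsto _).mono_left nhdsWithin_le_nhds
  · filter_upwards [self_mem_nhdsWithin] with w hw using hw

lemma pairing_real (r : Fin 2 → ℚ) (x : ℝ) :
    pairing r (x : ℂ) = (((r 1 : ℝ) * x - (r 0 : ℝ) : ℝ) : ℂ) := by
  unfold pairing; push_cast; ring

/-- The points of the upper half space at which `ϖ` does not vanish. -/
def regularSet : Set (ℂ × ℂ) := {w : ℂ × ℂ | 0 < w.2.im ∧ qPoch w.1 w.2 ≠ 0}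

lemma sfJacobi_eq_of_tendsto {M : SL(2, ℤ)} {z τ l : ℂ} (hne : (𝓝[regularSet] (z, τ)).NeBot)
    (h : Tendsto (fun w : ℂ × ℂ => qPoch (w.1 / jden M w.2) (moeb M w.2) / qPoch w.1 w.2)
      (𝓝[regularSet] (z, τ)) (𝓝 l)) : sfJacobi M z τ = l := by
  unfold sfJacobi
  exact h.limUnder_eq

/-- The quotient defining `sfJacobi` is taken only where ϖ(z, τ) is nonzero; there it equals the
factor of `HasLim`, so its limit exists and is the value chosen by `limUnder`. -/
lemma HasLim.tendsto_sfJacobi {M : SL(2, ℤ)} {y x : ℝ} (h : HasLim M y x)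
    (hne : (𝓝[regularSet] ((y : ℂ), (x : ℂ))).NeBot) :
    Tendsto (fun w : ℂ × ℂ => qPoch (w.1 / jden M w.2) (moeb M w.2) / qPoch w.1 w.2)
      (𝓝[regularSet] ((y : ℂ), (x : ℂ))) (𝓝 (sfJacobi M y x)) := by
  obtain ⟨F, l, hl, hF, hFe⟩ := h
  have hlim : Tendsto (fun w : ℂ × ℂ => qPoch (w.1 / jden M w.2) (moeb M w.2) / qPoch w.1 w.2)
      (𝓝[regularSet] ((y : ℂ), (x : ℂ))) (𝓝 l) := by
    have hle : 𝓝[regularSet] ((y : ℂ), (x : ℂ)) ≤ 𝓝[upperSet] ((y : ℂ), (x : ℂ)) :=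
      nhdsWithin_mono _ fun w hw => hw.1
    refine (hF.mono_left hle).congr' ?_
    filter_upwards [hFe.filter_mono hle, self_mem_nhdsWithin] with w h1 h2
    rw [h1, mul_div_cancel_right₀ _ h2.2]
  rw [sfJacobi_eq_of_tendsto hne hlim]
  exact hlim

lemma tendsto_path_regularSet {r : Fin 2 → ℚ} (hr : NonIntegral r) (x : ℝ) :
    Tendsto (fun τ : ℂ => (pairing r τ, τ)) (𝓝[upperHalf] (x : ℂ))
      (𝓝[regularSet] (pairing r x, (x : ℂ))) := by
  refine tendsto_nhdsWithin_iff.2 ⟨(tendsto_nhdsWithin_iff.1 (tendsto_path r x)).1, ?_⟩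
  filter_upwards [self_mem_nhdsWithin] with τ hτ
  exact ⟨hτ, thetaLike_ne_zero hr hτ⟩

lemma sfJacobi_spec (M : SL(2, ℤ)) {r : Fin 2 → ℚ} (hr : NonIntegral r) {x : ℝ}
    (hx : Irrational x) (hj : 0 < (M 1 0 : ℝ) * x + M 1 1) :
    Tendsto (fun τ => qPoch (pairing r τ / jden M τ) (moeb M τ) / qPoch (pairing r τ) τ)
      (𝓝[upperHalf] (x : ℂ)) (𝓝 (sfJacobi M (pairing r x) x)) := by
  have hpath := tendsto_path_regularSet hr x
  have hne : (𝓝[regularSet] (pairing r x, (x : ℂ))).NeBot := hpath.neBot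
  have h := hasLim_of_pos M hj (offLattice_pairing hr hx)
  rw [pairing_real] at hpath hne ⊢
  have h2 := h.tendsto_sfJacobi hne
  have h3 := h2.comp hpath
  simp only [Function.comp_def] at h3
  exact h3

/-- In general ⟨r, τ⟩ / j_M(τ) = ⟨Mr, M·τ⟩, by det M = 1; here Mr = r + N. -/
lemma pairing_div_jden (M : SL(2, ℤ)) {r : Fin 2 → ℚ} {N : Fin 2 → ℤ}
    (hN : ∀ i, (M i 0 : ℚ) * r 0 + M i 1 * r 1 = r i + N i) {τ : ℂ} (hj : jden M τ ≠ 0) :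
    pairing r τ / jden M τ = pairing r (moeb M τ) + N 1 * moeb M τ - N 0 := by
  have h0 : (M 0 0 : ℂ) * r 0 + M 0 1 * r 1 = r 0 + N 0 := by exact_mod_cast hN 0
  have h1 : (M 1 0 : ℂ) * r 0 + M 1 1 * r 1 = r 1 + N 1 := by exact_mod_cast hN 1
  have hd : (M 0 0 : ℂ) * M 1 1 - M 0 1 * M 1 0 = 1 := by exact_mod_cast sl_det M
  have hm : moeb M τ * jden M τ = M 0 0 * τ + M 0 1 := by
    unfold moeb; rw [div_mul_cancel₀ _ hj]
  rw [div_eq_iff hj]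
  have : (pairing r (moeb M τ) + N 1 * moeb M τ - N 0) * jden M τ =
      (r 1 + N 1) * (moeb M τ * jden M τ) - (r 0 + N 0) * jden M τ := by unfold pairing; ring
  rw [this, hm, ← h0, ← h1]
  unfold pairing jden
  linear_combination ((r 0 : ℂ) - r 1 * τ) * hd

lemma jden_real_ne_zero {M : SL(2, ℤ)} {x : ℝ} (hj : 0 < (M 1 0 : ℝ) * x + M 1 1) :
    jden M (x : ℂ) ≠ 0 := by
  have : jden M (x : ℂ) = (((M 1 0 : ℝ) * x + M 1 1 : ℝ) : ℂ) := by unfold jden; push_cast; ring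
  rw [this]; exact_mod_cast hj.ne'

lemma floor_sub_mulVec {M : SL(2, ℤ)} {r : Fin 2 → ℚ} {N : Fin 2 → ℤ}
    (hN : ∀ i, (M i 0 : ℚ) * r 0 + M i 1 * r 1 = r i + N i) :
    ⌊((1 - M.1.map (Int.cast : ℤ → ℚ)).mulVec r) 1⌋ = -N 1 := by
  have : ((1 - M.1.map (Int.cast : ℤ → ℚ)).mulVec r) 1 = ((-N 1 : ℤ) : ℚ) := by
    rw [Matrix.sub_mulVec, Matrix.one_mulVec, Pi.sub_apply]
    have h1 := hN 1
    simp only [Matrix.mulVec, dotProduct, Fin.sum_univ_two, Matrix.map_apply]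
    push_cast
    linarith
  rw [this, Int.floor_intCast]

lemma ex_act_ne_one (M : SL(2, ℤ)) {r : Fin 2 → ℚ} {N : Fin 2 → ℤ}
    (hN : ∀ i, (M i 0 : ℚ) * r 0 + M i 1 * r 1 = r i + N i) {τ : ℂ} (hj : jden M τ ≠ 0)
    (h : ∀ k : ℤ, ex (pairing r (moeb M τ) + k * moeb M τ) ≠ 1) (k : ℤ) :
    ex (pairing r τ / jden M τ + k * moeb M τ) ≠ 1 := by
  rw [pairing_div_jden M hN hj]
  have : pairing r (moeb M τ) + N 1 * moeb M τ - N 0 + k * moeb M τ =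
      (pairing r (moeb M τ) + ((N 1 + k : ℤ) : ℂ) * moeb M τ) + ((-N 0 : ℤ) : ℂ) := by
    push_cast; ring
  rw [this, ex_add, ex_intCast, mul_one]
  exact h _

/-- At a real fixed point of `M`, the modular cocycle is the limit of `ϖ_r(M·τ) / ϖ_r(τ)`. -/
theorem tendsto_sfModular {M : SL(2, ℤ)} {r : Fin 2 → ℚ} (hr : NonIntegral r) {x : ℝ}
    (hx : Irrational x) (hj : 0 < (M 1 0 : ℝ) * x + M 1 1) (hM : FixesMod M r)
    (hfix : moeb M x = x) :
    Tendsto (fun τ => thetaLike r (moeb M τ) / thetaLike r τ)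
      (𝓝[upperHalf] (x : ℂ)) (𝓝 (sfModular r M x)) := by
  obtain ⟨N, hN⟩ := hM
  have hjx := jden_real_ne_zero hj
  have hne : ∀ k : ℤ, ex (pairing r (x : ℂ) / jden M x + k * moeb M x) ≠ 1 :=
    ex_act_ne_one M hN hjx (fun k => by rw [hfix]; exact ex_pairing_ne_one_of_irrational hr hx k)
  unfold sfModular
  -- The finite symbol of length -N₂ removes exactly the shift by N₂ M·τ between ⟨r, τ⟩/j_M(τ) and
  -- ⟨r, M·τ⟩; the remaining shift by an integer does not affect ϖ.
  rw [floor_sub_mulVec hN]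
  have h1 := sfJacobi_spec M hr hx hj
  have hc1 : Tendsto (fun τ => pairing r τ / jden M τ) (𝓝[upperHalf] (x : ℂ))
      (𝓝 (pairing r x / jden M x)) :=
    (((continuous_pairing r).continuousAt.div (continuous_jden M).continuousAt
      hjx).tendsto).mono_left nhdsWithin_le_nhds
  have hc2 : Tendsto (moeb M) (𝓝[upperHalf] (x : ℂ)) (𝓝 (moeb M x)) :=
    (continuousAt_moeb M hjx).tendsto.mono_left nhdsWithin_le_nhds
  have h2 := tendsto_qPochFin (-N 1) hc1 hc2 hne
  refine (h1.div h2 (qPochFin_ne_zero _ hne)).congr' ?_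
  filter_upwards [self_mem_nhdsWithin] with τ hτ
  have hτ : 0 < τ.im := hτ
  have hjτ := jden_ne_zero M hτ
  have hmτ := moeb_im_pos M hτ
  have hneτ : ∀ k : ℤ, ex (pairing r τ / jden M τ + k * moeb M τ) ≠ 1 :=
    ex_act_ne_one M hN hjτ fun k => ex_pairing_ne_one_of_im hr hmτ k
  simp only [Pi.div_apply]
  rw [qPoch_eq_qPochFin_mul (-N 1) hmτ hneτ]
  have hsh : pairing r τ / jden M τ + ((-N 1 : ℤ) : ℂ) * moeb M τ =
      pairing r (moeb M τ) + ((-N 0 : ℤ) : ℂ) := by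
    rw [pairing_div_jden M hN hjτ]; push_cast; ring
  rw [hsh, qPoch_add_intCast, div_right_comm, mul_div_cancel_left₀ _ (qPochFin_ne_zero _ hneτ)]
  rfl

/-! ### Powers of the matrix and integer translations of the characteristic -/

lemma tendsto_moeb_fix {M : SL(2, ℤ)} {x : ℝ} (hj : 0 < (M 1 0 : ℝ) * x + M 1 1)
    (hfix : moeb M x = x) : Tendsto (moeb M) (𝓝[upperHalf] (x : ℂ)) (𝓝[upperHalf] (x : ℂ)) := by
  refine tendsto_nhdsWithin_iff.2 ⟨?_, ?_⟩
  · have := (continuousAt_moeb M (jden_real_ne_zero hj)).tendsto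
    rw [hfix] at this
    exact this.mono_left nhdsWithin_le_nhds
  · filter_upwards [self_mem_nhdsWithin] with τ hτ using moeb_im_pos M hτ

lemma FixesMod.mul {M N : SL(2, ℤ)} {r : Fin 2 → ℚ} (hM : FixesMod M r) (hN : FixesMod N r) :
    FixesMod (M * N) r := by
  obtain ⟨A, hA⟩ := hM
  obtain ⟨B, hB⟩ := hN
  refine ⟨fun i => A i + M i 0 * B 0 + M i 1 * B 1, fun i => ?_⟩
  simp only [sl_mul]
  push_cast
  linear_combination hA i + (M i 0 : ℚ) * hB 0 + (M i 1 : ℚ) * hB 1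

lemma fixesMod_one (r : Fin 2 → ℚ) : FixesMod 1 r := by
  refine ⟨0, fun i => ?_⟩
  fin_cases i <;> simp

lemma pow_fix {A : SL(2, ℤ)} {r : Fin 2 → ℚ} {x : ℝ} (hj : 0 < (A 1 0 : ℝ) * x + A 1 1)
    (hA : FixesMod A r) (hfix : moeb A x = x) (n : ℕ) :
    0 < ((A ^ n) 1 0 : ℝ) * x + (A ^ n) 1 1 ∧ FixesMod (A ^ n) r ∧ moeb (A ^ n) x = x := by
  induction n with
  | zero => exact ⟨by simp, by simpa using fixesMod_one r, by simp [moeb, jden]⟩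
  | succ n ih =>
    obtain ⟨h1, h2, h3⟩ := ih
    have hjx := jden_real_ne_zero h1
    have hreal : ∀ M : SL(2, ℤ), jden M (x : ℂ) = (((M 1 0 : ℝ) * x + M 1 1 : ℝ) : ℂ) := by
      intro M; unfold jden; push_cast; ring
    rw [pow_succ']
    refine ⟨?_, hA.mul h2, ?_⟩
    · have := jden_mul A (A ^ n) hjx
      rw [h3, hreal, hreal, hreal, ← Complex.ofReal_mul] at this
      rw [Complex.ofReal_injective this]
      exact mul_pos hj h1
    · rw [moeb_mul _ _ hjx, h3, hfix]

/-- The quotient ϖ_r(Aⁿ·τ)/ϖ_r(τ) is the product of the quotients ϖ_r(A·σ)/ϖ_r(σ) at σ = A^k·τ for k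
< n, and each A^k·τ tends to the same fixed point from the upper half plane. -/
theorem sfModular_pow {A : SL(2, ℤ)} {r : Fin 2 → ℚ} (hr : NonIntegral r) {x : ℝ}
    (hx : Irrational x) (hj : 0 < (A 1 0 : ℝ) * x + A 1 1) (hA : FixesMod A r)
    (hfix : moeb A x = x) (n : ℕ) : sfModular r (A ^ n) x = sfModular r A x ^ n := by
  have h1 := tendsto_sfModular hr hx hj hA hfix
  have key : ∀ n : ℕ, Tendsto (fun τ => thetaLike r (moeb (A ^ n) τ) / thetaLike r τ)
      (𝓝[upperHalf] (x : ℂ)) (𝓝 (sfModular r A x ^ n)) := by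
    intro n
    induction n with
    | zero =>
      rw [show sfModular r A x ^ 0 = 1 from pow_zero _]
      refine tendsto_const_nhds.congr' ?_
      filter_upwards [self_mem_nhdsWithin] with τ hτ
      have : moeb (A ^ 0) τ = τ := by simp [moeb, jden]
      rw [this, div_self (thetaLike_ne_zero hr hτ)]
    | succ n ih =>
      obtain ⟨p1, p2, p3⟩ := pow_fix hj hA hfix n
      have h2 := h1.comp (tendsto_moeb_fix p1 p3)
      rw [show sfModular r A x ^ (n + 1) = sfModular r A x * sfModular r A x ^ n from
        pow_succ' _ _]
      refine (h2.mul ih).congr' ?_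
      filter_upwards [self_mem_nhdsWithin] with τ hτ
      have hne := thetaLike_ne_zero hr (moeb_im_pos (A ^ n) hτ)
      simp only [Function.comp]
      rw [pow_succ' A n, moeb_mul _ _ (jden_ne_zero (A ^ n) hτ), div_mul_div_cancel₀ hne]
  obtain ⟨p1, p2, p3⟩ := pow_fix hj hA hfix n
  exact tendsto_nhds_unique (tendsto_sfModular hr hx p1 p2 p3) (key n)

/-- Translating r multiplies ϖ_r(τ) by the inverse of a finite symbol. At A·τ and at τ these finite
symbols tend to the same nonzero value, since A fixes the limit point, so their quotient tends to 1.
-/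
theorem sfModular_add_int {A : SL(2, ℤ)} {r : Fin 2 → ℚ} (hr : NonIntegral r) {x : ℝ}
    (hx : Irrational x) (hj : 0 < (A 1 0 : ℝ) * x + A 1 1) (hA : FixesMod A r)
    (hfix : moeb A x = x) (q : Fin 2 → ℤ) :
    sfModular (fun i => r i + q i) A x = sfModular r A x := by
  have hr' : NonIntegral fun i => r i + q i := by
    rintro ⟨N, hN⟩
    exact hr ⟨fun i => N i - q i, fun i => by push_cast; linarith [hN i]⟩
  have hA' : FixesMod A fun i => r i + q i := by
    obtain ⟨N, hN⟩ := hA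
    refine ⟨fun i => N i + A i 0 * q 0 + A i 1 * q 1 - q i, fun i => ?_⟩
    push_cast
    linear_combination hN i
  have h1 := tendsto_sfModular hr hx hj hA hfix
  have h2 := tendsto_sfModular hr' hx hj hA' hfix
  refine tendsto_nhds_unique h2 ?_
  have hne := ex_pairing_ne_one_of_irrational hr hx
  have hp : Tendsto (fun τ => qPochFin (q 1) (pairing r τ) τ) (𝓝[upperHalf] (x : ℂ))
      (𝓝 (qPochFin (q 1) (pairing r x) x)) :=
    tendsto_qPochFin (q 1) (((continuous_pairing r).tendsto _).mono_left nhdsWithin_le_nhds)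
      (tendsto_id.mono_left nhdsWithin_le_nhds) hne
  have hp0 := qPochFin_ne_zero (q 1) hne
  have h3 := h1.mul (hp.div (hp.comp (tendsto_moeb_fix hj hfix)) hp0)
  rw [div_self hp0, mul_one] at h3
  refine h3.congr' ?_
  have hth : ∀ τ : ℂ, 0 < τ.im → thetaLike r τ =
      qPochFin (q 1) (pairing r τ) τ * thetaLike (fun i => r i + q i) τ := by
    intro τ hτ
    have := qPoch_eq_qPochFin_mul (q 1) hτ fun k => ex_pairing_ne_one_of_im hr hτ k
    unfold thetaLike
    rw [this]
    congr 1
    have e : pairing r τ + (q 1 : ℂ) * τ =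
        pairing (fun i => r i + q i) τ + (q 0 : ℂ) := by
      unfold pairing; push_cast; ring
    rw [e, qPoch_add_intCast]
  filter_upwards [self_mem_nhdsWithin] with τ hτ
  have hmτ := moeb_im_pos A hτ
  have n1 := qPochFin_ne_zero (q 1) fun k => ex_pairing_ne_one_of_im hr hτ k
  have n2 := qPochFin_ne_zero (q 1) fun k => ex_pairing_ne_one_of_im hr hmτ k
  have n3 := thetaLike_ne_zero hr' hτ
  simp only [Pi.div_apply, Function.comp]
  rw [hth τ hτ, hth _ hmτ]
  field_simp

end Analysis

/-! ### Dedekind sums: reciprocity -/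

/-- Multiplication by a unit permutes the residues modulo k. -/
lemma sum_mul_mod {h k : ℕ} (hk : 0 < k) (hc : Nat.Coprime h k) (f : ℕ → ℚ) :
    ∑ μ ∈ Finset.range k, f (h * μ % k) = ∑ μ ∈ Finset.range k, f μ := by
  have hinj : Set.InjOn (fun μ => h * μ % k) (Finset.range k : Set ℕ) := by
    intro a ha b hb hab
    have h1 : h * a ≡ h * b [MOD k] := hab
    have h2 : a ≡ b [MOD k] := Nat.ModEq.cancel_left_of_coprime (by rwa [Nat.coprime_comm] at hc) h1
    simp only [Finset.coe_range, Set.mem_Iio] at ha hb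
    exact Nat.ModEq.eq_of_lt_of_lt h2 ha hb
  have himg : (Finset.range k).image (fun μ => h * μ % k) = Finset.range k := by
    refine Finset.eq_of_subset_of_card_le ?_ ?_
    · intro x hx
      obtain ⟨μ, -, rfl⟩ := Finset.mem_image.1 hx
      exact Finset.mem_range.2 (Nat.mod_lt _ hk)
    · rw [Finset.card_image_of_injOn hinj]
  conv_rhs => rw [← himg]
  rw [Finset.sum_image hinj]

lemma sum_range_rat (k : ℕ) : ∑ μ ∈ Finset.range k, (μ : ℚ) = k * (k - 1) / 2 := by
  induction k with
  | zero => simp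
  | succ k ih => rw [Finset.sum_range_succ, ih]; push_cast; ring

lemma sum_range_sq_rat (k : ℕ) :
    ∑ μ ∈ Finset.range k, (μ : ℚ) ^ 2 = k * (k - 1) * (2 * k - 1) / 6 := by
  induction k with
  | zero => simp
  | succ k ih => rw [Finset.sum_range_succ, ih]; push_cast; ring

/-- `∑ μ ⌊hμ/k⌋`. -/
def floorSum (h k : ℕ) : ℚ := ∑ μ ∈ Finset.range k, (μ : ℚ) * (h * μ / k : ℕ)

/-- With q = ⌊hμ/k⌋, the term q(q + 1) is the sum of 2ν over 0 ≤ ν ≤ q. Exchanging the two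
summations counts for each ν > 0 the μ with ⌊kν/h⌋ < μ < k; coprimality ensures that no such lattice
point lies on the diagonal kν = hμ. -/
lemma sum_div_mul_div_add_one {h k : ℕ} (hh : 0 < h) (hk : 0 < k) (hc : Nat.Coprime h k) :
    ∑ μ ∈ Finset.range k, ((h * μ / k : ℕ) : ℚ) * ((h * μ / k : ℕ) + 1) =
      (k - 1) * (h * (h - 1)) - 2 * floorSum k h := by
  have h1 : ∀ μ ∈ Finset.range k, ((h * μ / k : ℕ) : ℚ) * ((h * μ / k : ℕ) + 1) =
      ∑ ν ∈ Finset.range h, if ν ≤ h * μ / k then 2 * (ν : ℚ) else 0 := by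
    intro μ hμ
    have hlt : h * μ / k < h := by
      rw [Nat.div_lt_iff_lt_mul hk]
      exact Nat.mul_lt_mul_of_pos_left (Finset.mem_range.1 hμ) hh
    rw [← Finset.sum_filter]
    have : (Finset.range h).filter (fun ν => ν ≤ h * μ / k) = Finset.range (h * μ / k + 1) := by
      ext ν; simp only [Finset.mem_filter, Finset.mem_range]; omega
    rw [this, ← Finset.mul_sum, sum_range_rat]
    push_cast; ring
  rw [Finset.sum_congr rfl h1, Finset.sum_comm]
  have h2 : ∀ ν ∈ Finset.range h, (∑ μ ∈ Finset.range k, if ν ≤ h * μ / k then 2 * (ν : ℚ) else 0) =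
      2 * (k - 1) * ν - 2 * ((ν : ℚ) * (k * ν / h : ℕ)) := by
    intro ν hν
    have hν := Finset.mem_range.1 hν
    rcases Nat.eq_zero_or_pos ν with rfl | hpos
    · simp
    have hlt : k * ν / h < k := by
      rw [Nat.div_lt_iff_lt_mul hh]
      exact Nat.mul_lt_mul_of_pos_left hν hk
    rw [← Finset.sum_filter, Finset.sum_const, nsmul_eq_mul]
    have : (Finset.range k).filter (fun μ => ν ≤ h * μ / k) = Finset.Ico (k * ν / h + 1) k := by
      ext μ
      simp only [Finset.mem_filter, Finset.mem_range, Finset.mem_Ico]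
      rw [Nat.le_div_iff_mul_le hk, Nat.add_one_le_iff, Nat.div_lt_iff_lt_mul hh,
        mul_comm ν k, mul_comm μ h]
      have hne : k * ν ≠ h * μ := by
        intro he
        have : h ∣ k * ν := ⟨μ, he⟩
        have := Nat.le_of_dvd hpos (hc.dvd_of_dvd_mul_left this)
        omega
      constructor
      · rintro ⟨a, b⟩; exact ⟨lt_of_le_of_ne b hne, a⟩
      · rintro ⟨a, b⟩; exact ⟨b, a.le⟩
    rw [this, Nat.card_Ico, Nat.cast_sub (by omega)]
    push_cast; ring
  rw [Finset.sum_congr rfl h2, Finset.sum_sub_distrib, ← Finset.mul_sum, ← Finset.mul_sum,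
    sum_range_rat, floorSum]
  ring

lemma sawtooth_div_nat {m k : ℕ} (hk : 0 < k) (hm : ¬ k ∣ m) :
    sawtooth ((m : ℚ) / k) = ((m % k : ℕ) : ℚ) / k - 1 / 2 := by
  have hk' : (0 : ℚ) < k := by exact_mod_cast hk
  have hfr : Int.fract ((m : ℚ) / k) = ((m % k : ℕ) : ℚ) / k := by
    have := Nat.div_add_mod m k
    rw [Int.fract_eq_iff]
    refine ⟨by positivity, ?_, (m / k : ℕ), ?_⟩
    · rw [div_lt_one hk']; exact_mod_cast Nat.mod_lt m hk
    · have h2 : (m : ℚ) = k * (m / k : ℕ) + (m % k : ℕ) := by exact_mod_cast this.symm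
      rw [← sub_div, div_eq_iff hk'.ne']
      rw [Int.cast_natCast]
      linarith
  rw [sawtooth, hfr, if_neg]
  intro h
  rw [div_eq_zero_iff] at h
  rcases h with h | h
  · exact hm (Nat.dvd_of_mod_eq_zero (by exact_mod_cast h))
  · exact hk'.ne' h

lemma dedekindSum_nat {h k : ℕ} (hk : 0 < k) (hc : Nat.Coprime h k) :
    dedekindSum h k =
      (∑ μ ∈ Finset.range k, (μ : ℚ) * (h * μ % k : ℕ)) / k ^ 2 - (k - 1) / 4 := by
  have hk' : (k : ℚ) ≠ 0 := by exact_mod_cast hk.ne'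
  have h1 : dedekindSum h k = ∑ μ ∈ Finset.Ico 1 k,
      ((μ : ℚ) / k - 1 / 2) * (((h * μ % k : ℕ) : ℚ) / k - 1 / 2) := by
    rw [dedekindSum, Nat.abs_cast]
    symm
    refine Finset.sum_bij (fun μ _ => (μ : ℤ)) ?_ ?_ ?_ ?_
    · intro μ hμ; simp only [Finset.mem_Ico] at hμ ⊢; omega
    · intro a _ b _ hab; exact_mod_cast hab
    · intro b hb
      simp only [Finset.mem_Ico] at hb
      exact ⟨b.toNat, by simp only [Finset.mem_Ico]; omega, by omega⟩
    · intro μ hμ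
      simp only [Finset.mem_Ico] at hμ
      have hnd : ¬ k ∣ μ := fun h => by have := Nat.le_of_dvd (by omega) h; omega
      have e1 := sawtooth_div_nat hk hnd
      have e2 := sawtooth_div_nat (m := h * μ) hk fun hd =>
        hnd ((Nat.Coprime.symm hc).dvd_of_dvd_mul_left hd)
      rw [Nat.mod_eq_of_lt hμ.2] at e1
      rw [← e1, ← e2]
      push_cast
      rw [mul_comm (μ : ℚ) h]
  have h2 : ∑ μ ∈ Finset.range k, ((μ : ℚ) / k - 1 / 2) * (((h * μ % k : ℕ) : ℚ) / k - 1 / 2) =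
      1 / 4 + dedekindSum h k := by
    rw [h1, Finset.range_eq_Ico, Finset.sum_eq_sum_Ico_succ_bot hk]
    norm_num
  have h3 := sum_mul_mod hk hc fun m => (m : ℚ)
  have h4 : ∑ μ ∈ Finset.range k, ((μ : ℚ) / k - 1 / 2) * (((h * μ % k : ℕ) : ℚ) / k - 1 / 2) =
      (∑ μ ∈ Finset.range k, (μ : ℚ) * (h * μ % k : ℕ)) / k ^ 2
      - (∑ μ ∈ Finset.range k, (μ : ℚ)) / (2 * k)
      - (∑ μ ∈ Finset.range k, ((h * μ % k : ℕ) : ℚ)) / (2 * k) + k / 4 := by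
    have e : (k : ℚ) / 4 = ∑ μ ∈ Finset.range k, (1 / 4 : ℚ) := by simp; ring
    rw [Finset.sum_div, Finset.sum_div, Finset.sum_div, e, ← Finset.sum_sub_distrib,
      ← Finset.sum_sub_distrib, ← Finset.sum_add_distrib]
    refine Finset.sum_congr rfl fun μ _ => ?_
    field_simp
    ring
  rw [h3, sum_range_rat, h2] at h4
  rw [eq_sub_iff_add_eq]
  have : dedekindSum h k = (∑ μ ∈ Finset.range k, (μ : ℚ) * (h * μ % k : ℕ)) / k ^ 2
      - k * (k - 1) / 2 / (2 * k) - k * (k - 1) / 2 / (2 * k) + k / 4 - 1 / 4 := by linarith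
  rw [this]
  field_simp
  ring

/-- Both Dedekind sums are affine in the floor sums. Three linear relations (permutation invariance
of the sums of the residues and of their squares, and the lattice point count) eliminate all
unknowns but one, and that one cancels. -/
lemma dedekindSum_reciprocity_nat {h k : ℕ} (hh : 0 < h) (hk : 0 < k) (hc : Nat.Coprime h k) :
    12 * (dedekindSum h k + dedekindSum k h) =
      -3 + (h : ℚ) / k + (k : ℚ) / h + 1 / (h * k) := by
  have hh' : (h : ℚ) ≠ 0 := by exact_mod_cast hh.ne'
  have hk' : (k : ℚ) ≠ 0 := by exact_mod_cast hk.ne'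
  have hdm : ∀ h k μ : ℕ, ((h * μ % k : ℕ) : ℚ) = h * μ - k * (h * μ / k : ℕ) := by
    intro h k μ
    have : (k : ℚ) * (h * μ / k : ℕ) + (h * μ % k : ℕ) = h * μ := by
      exact_mod_cast Nat.div_add_mod (h * μ) k
    linarith
  have hR : ∀ h k : ℕ, ∑ μ ∈ Finset.range k, (μ : ℚ) * (h * μ % k : ℕ) =
      h * (k * (k - 1) * (2 * k - 1) / 6) - k * floorSum h k := by
    intro h k
    rw [← sum_range_sq_rat, floorSum, Finset.mul_sum, Finset.mul_sum, ← Finset.sum_sub_distrib]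
    refine Finset.sum_congr rfl fun μ _ => ?_
    rw [hdm]; ring
  have f1 := sum_mul_mod hk hc fun m => (m : ℚ)
  have f2 := sum_mul_mod hk hc fun m => (m : ℚ) ^ 2
  have f3 := sum_div_mul_div_add_one hh hk hc
  rw [sum_range_rat] at f1
  rw [sum_range_sq_rat] at f2
  have g1 : ∑ μ ∈ Finset.range k, ((h * μ % k : ℕ) : ℚ) =
      h * (k * (k - 1) / 2) - k * ∑ μ ∈ Finset.range k, ((h * μ / k : ℕ) : ℚ) := by
    rw [← sum_range_rat, Finset.mul_sum, Finset.mul_sum, ← Finset.sum_sub_distrib]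
    exact Finset.sum_congr rfl fun μ _ => hdm h k μ
  have g2 : ∑ μ ∈ Finset.range k, ((h * μ % k : ℕ) : ℚ) ^ 2 =
      h ^ 2 * (k * (k - 1) * (2 * k - 1) / 6) - 2 * h * k * floorSum h k +
        k ^ 2 * ∑ μ ∈ Finset.range k, ((h * μ / k : ℕ) : ℚ) ^ 2 := by
    rw [← sum_range_sq_rat, floorSum, Finset.mul_sum, Finset.mul_sum, Finset.mul_sum,
      ← Finset.sum_sub_distrib, ← Finset.sum_add_distrib]
    refine Finset.sum_congr rfl fun μ _ => ?_
    rw [hdm]; ring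
  have g3 : ∑ μ ∈ Finset.range k, ((h * μ / k : ℕ) : ℚ) * ((h * μ / k : ℕ) + 1) =
      ∑ μ ∈ Finset.range k, ((h * μ / k : ℕ) : ℚ) ^ 2 +
        ∑ μ ∈ Finset.range k, ((h * μ / k : ℕ) : ℚ) := by
    rw [← Finset.sum_add_distrib]
    exact Finset.sum_congr rfl fun μ _ => by ring
  rw [g1] at f1
  rw [g2] at f2
  rw [g3] at f3
  rw [dedekindSum_nat hk hc, dedekindSum_nat hh hc.symm, hR, hR]
  generalize ∑ μ ∈ Finset.range k, ((h * μ / k : ℕ) : ℚ) ^ 2 = q2 at *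
  generalize ∑ μ ∈ Finset.range k, ((h * μ / k : ℕ) : ℚ) = q1 at *
  generalize floorSum h k = W at *
  generalize floorSum k h = W' at *
  have e1 : q1 = (h - 1) * (k - 1) / 2 := by
    have : (k : ℚ) * q1 = k * ((h - 1) * (k - 1) / 2) := by linarith
    exact mul_left_cancel₀ hk' this
  have e2 : W' = ((k - 1) * (h * (h - 1)) - q2 - q1) / 2 := by linarith
  have e3 : q2 = ((k * (k - 1) * (2 * k - 1) / 6) * (1 - h ^ 2) + 2 * h * k * W) / k ^ 2 := by
    rw [eq_div_iff (pow_ne_zero 2 hk')]; linarith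
  rw [e2, e1, e3]
  field_simp
  ring

lemma sawtooth_neg (x : ℚ) : sawtooth (-x) = -sawtooth x := by
  unfold sawtooth
  by_cases h : Int.fract x = 0
  · rw [if_pos h, if_pos (Int.fract_neg_eq_zero.2 h), neg_zero]
  · rw [if_neg h, if_neg (fun h' => h (Int.fract_neg_eq_zero.1 h')), Int.fract_neg h]
    ring

lemma dedekindSum_neg_left (a b : ℤ) : dedekindSum (-a) b = -dedekindSum a b := by
  rw [dedekindSum, dedekindSum, ← Finset.sum_neg_distrib]
  refine Finset.sum_congr rfl fun n _ => ?_
  have : (n : ℚ) * ((-a : ℤ) : ℚ) / b = -((n : ℚ) * a / b) := by push_cast; ring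
  rw [this, sawtooth_neg]; ring

lemma dedekindSum_neg_right (a b : ℤ) : dedekindSum a (-b) = dedekindSum a b := by
  rw [dedekindSum, dedekindSum, abs_neg]
  refine Finset.sum_congr rfl fun n _ => ?_
  have h1 : (n : ℚ) / ((-b : ℤ) : ℚ) = -((n : ℚ) / b) := by push_cast; rw [div_neg]
  have h2 : (n : ℚ) * a / ((-b : ℤ) : ℚ) = -((n : ℚ) * a / b) := by push_cast; rw [div_neg]
  rw [h1, h2, sawtooth_neg, sawtooth_neg]; ring

lemma dedekindSum_add (a b : ℤ) (hb : b ≠ 0) : dedekindSum (a + b) b = dedekindSum a b := by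
  rw [dedekindSum, dedekindSum]
  refine Finset.sum_congr rfl fun n _ => ?_
  have hb' : (b : ℚ) ≠ 0 := by exact_mod_cast hb
  have : (n : ℚ) * ((a + b : ℤ) : ℚ) / b = (n : ℚ) * a / b + n := by
    push_cast; field_simp
  rw [this]
  congr 1
  unfold sawtooth
  rw [Int.fract_add_intCast]

/-- The reciprocity law for Dedekind sums. -/
theorem dedekindSum_reciprocity {a c : ℤ} (ha : a ≠ 0) (hc : c ≠ 0) (hac : IsCoprime a c) :
    12 * ((c.sign : ℚ) * dedekindSum a c + (a.sign : ℚ) * dedekindSum c a) =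
      -3 * ((a * c).sign : ℚ) + (a : ℚ) / c + (c : ℚ) / a + 1 / (a * c) := by
  have hpos : ∀ a c : ℤ, 0 < a → 0 < c → IsCoprime a c →
      12 * ((c.sign : ℚ) * dedekindSum a c + (a.sign : ℚ) * dedekindSum c a) =
      -3 * ((a * c).sign : ℚ) + (a : ℚ) / c + (c : ℚ) / a + 1 / (a * c) := by
    intro a c ha hc hac
    lift a to ℕ using ha.le
    lift c to ℕ using hc.le
    have := dedekindSum_reciprocity_nat (by exact_mod_cast ha) (by exact_mod_cast hc)
      (Nat.isCoprime_iff_coprime.1 hac)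
    rw [Int.sign_eq_one_of_pos ha, Int.sign_eq_one_of_pos hc,
      Int.sign_eq_one_of_pos (mul_pos ha hc)]
    push_cast
    linarith
  have hposc : ∀ a c : ℤ, a ≠ 0 → 0 < c → IsCoprime a c →
      12 * ((c.sign : ℚ) * dedekindSum a c + (a.sign : ℚ) * dedekindSum c a) =
      -3 * ((a * c).sign : ℚ) + (a : ℚ) / c + (c : ℚ) / a + 1 / (a * c) := by
    intro a c ha hc hac
    rcases lt_or_gt_of_ne ha with h | h
    · have := hpos (-a) c (by omega) hc hac.neg_left
      rw [dedekindSum_neg_left, dedekindSum_neg_right, Int.sign_neg, neg_mul a c, Int.sign_neg] at this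
      push_cast at this ⊢
      rw [neg_div, div_neg, neg_mul (a : ℚ) c, div_neg] at this
      linarith
    · exact hpos a c h hc hac
  rcases lt_or_gt_of_ne hc with h | h
  · have := hposc a (-c) ha (by omega) hac.neg_right
    rw [dedekindSum_neg_left, dedekindSum_neg_right, Int.sign_neg, mul_neg a c, Int.sign_neg] at this
    push_cast at this ⊢
    rw [neg_div, div_neg, mul_neg (a : ℚ) c, div_neg] at this
    linarith
  · exact hposc a c ha h hac

/-! ### The Rademacher function on the modular group -/

/-- Dedekind's function `Φ`. -/
def dedekindPhi (M : SL(2, ℤ)) : ℚ :=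
  if M 1 0 = 0 then (M 0 1 : ℚ) / (M 1 1 : ℚ)
  else ((M 0 0 + M 1 1 : ℤ) : ℚ) / (M 1 0 : ℚ)
    - 12 * ((M 1 0).sign : ℚ) * dedekindSum (M 0 0) (M 1 0)

lemma rademacher_eq (M : SL(2, ℤ)) :
    rademacher M = dedekindPhi M - 3 * ((M 1 0 * (M 0 0 + M 1 1)).sign : ℚ) := by
  unfold rademacher dedekindPhi
  split_ifs with h
  · simp [h]
  · ring

lemma dedekindPhi_T_mul {M N : SL(2, ℤ)} (h0 : N 0 0 = M 0 0 + M 1 0) (h1 : N 0 1 = M 0 1 + M 1 1)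
    (h2 : N 1 0 = M 1 0) (h3 : N 1 1 = M 1 1) : dedekindPhi N = dedekindPhi M + 1 := by
  unfold dedekindPhi
  rw [h0, h1, h2, h3]
  by_cases hc : M 1 0 = 0
  · have hd : (M 1 1 : ℚ) ≠ 0 := by
      intro h
      have := sl_det M
      rw [hc, (by exact_mod_cast h : M 1 1 = 0)] at this
      simp at this
    rw [if_pos hc, if_pos hc]
    push_cast
    field_simp
  · have hc' : (M 1 0 : ℚ) ≠ 0 := by exact_mod_cast hc
    rw [if_neg hc, if_neg hc, dedekindSum_add _ _ hc]
    push_cast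
    field_simp
    ring

/-- For nonzero a and c this is the reciprocity law for the first column (a, c); if a or c vanishes
the other is ±1 and the Dedekind sum involved is empty. -/
lemma dedekindPhi_S_mul {M N : SL(2, ℤ)} (h0 : N 0 0 = -M 1 0) (h1 : N 0 1 = -M 1 1)
    (h2 : N 1 0 = M 0 0) (h3 : N 1 1 = M 0 1) :
    dedekindPhi N = dedekindPhi M - 3 * ((M 0 0 * M 1 0).sign : ℚ) := by
  have hdet := sl_det M
  unfold dedekindPhi
  rw [h0, h1, h2, h3]
  generalize M 0 0 = a at *
  generalize M 0 1 = b at *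
  generalize M 1 0 = c at *
  generalize M 1 1 = d at *
  by_cases ha : a = 0
  · subst ha
    have hbc : b * c = -1 := by linarith
    have hc0 : c ≠ 0 := by rintro rfl; simp at hbc
    have hb0 : b ≠ 0 := by rintro rfl; simp at hbc
    have hc : c.natAbs = 1 := by
      have := congrArg Int.natAbs hbc
      rw [Int.natAbs_mul] at this
      exact Nat.eq_one_of_mul_eq_one_left this
    have hs : dedekindSum 0 c = 0 := by
      rw [dedekindSum, Int.abs_eq_natAbs, hc]; simp
    rw [if_pos rfl, if_neg hc0, hs]
    have hb' : (b : ℚ) ≠ 0 := by exact_mod_cast hb0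
    have hc' : (c : ℚ) ≠ 0 := by exact_mod_cast hc0
    have hbc' : (b : ℚ) * c = -1 := by exact_mod_cast hbc
    simp only [zero_mul, Int.sign_zero, Int.cast_zero, mul_zero, sub_zero, zero_add]
    push_cast
    rw [div_eq_div_iff hb' hc']
    have hcc : (c : ℚ) * c = 1 := by
      have : c * c = 1 := by
        rcases Int.natAbs_eq_iff.1 hc with h | h <;> rw [h] <;> norm_num
      exact_mod_cast this
    have hcb : (c : ℚ) = -b := by linear_combination (c : ℚ) * hbc' - (b : ℚ) * hcc
    rw [hcb]; ring
  by_cases hc : c = 0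
  · subst hc
    have had : a * d = 1 := by linarith
    have han : a.natAbs = 1 := by
      have := congrArg Int.natAbs had
      rw [Int.natAbs_mul] at this
      exact Nat.eq_one_of_mul_eq_one_right this
    have hs : dedekindSum (-0) a = 0 := by
      rw [dedekindSum, Int.abs_eq_natAbs, han]; simp
    have hda : d = a := by
      have : a * a = 1 := by
        rcases Int.natAbs_eq_iff.1 han with h | h <;> rw [h] <;> norm_num
      exact mul_left_cancel₀ ha (by rw [had, this])
    rw [if_neg ha, if_pos rfl, hs, hda]
    simp
  · have ha' : (a : ℚ) ≠ 0 := by exact_mod_cast ha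
    have hc' : (c : ℚ) ≠ 0 := by exact_mod_cast hc
    have hrec := dedekindSum_reciprocity ha hc ⟨d, -b, by linarith⟩
    rw [if_neg ha, if_neg hc, dedekindSum_neg_left]
    have hdet' : (a : ℚ) * d - b * c = 1 := by exact_mod_cast hdet
    have e : ((-c + b : ℤ) : ℚ) / a - ((a + d : ℤ) : ℚ) / c = -((a : ℚ) / c + c / a + 1 / (a * c)) := by
      push_cast
      field_simp
      linear_combination -hdet'
    linarith

lemma sign_eq_cases (x : ℤ) : x.sign = -1 ∧ x < 0 ∨ x.sign = 0 ∧ x = 0 ∨ x.sign = 1 ∧ 0 < x := by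
  rcases lt_trichotomy x 0 with h | h | h
  · exact Or.inl ⟨Int.sign_eq_neg_one_of_neg h, h⟩
  · exact Or.inr (Or.inl ⟨by simp [h], h⟩)
  · exact Or.inr (Or.inr ⟨Int.sign_eq_one_of_pos h, h⟩)

/-- A finite check over signs: the five implications record what w = xv - yu determines about the
sign of w from those of xv and yu. -/
lemma sign_table : ∀ X ∈ Finset.Icc (-1 : ℤ) 1, ∀ Y ∈ Finset.Icc (-1 : ℤ) 1,
    ∀ U ∈ Finset.Icc (-1 : ℤ) 1, ∀ V ∈ Finset.Icc (-1 : ℤ) 1, ∀ W ∈ Finset.Icc (-1 : ℤ) 1,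
    ¬ (X = 0 ∧ Y = 0) → ¬ (U = 0 ∧ V = 0) →
    (X * V = 1 → Y * U ≠ 1 → W = 1) ∧ (X * V ≠ 1 → Y * U = 1 → W = -1) ∧
      (X * V = 0 → Y * U = -1 → W = 1) ∧ (X * V = -1 → Y * U = 0 → W = -1) ∧
      (X * V = 0 → Y * U = 0 → W = 0) →
    U * V + Y * W * V = X * Y + X * W * U := by
  intro X hX Y hY U hU V hV W hW
  rw [Finset.mem_Icc] at hX hY hU hV hW
  obtain ⟨hX, hX'⟩ := hX
  obtain ⟨hY, hY'⟩ := hY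
  obtain ⟨hU, hU'⟩ := hU
  obtain ⟨hV, hV'⟩ := hV
  interval_cases X <;> interval_cases Y <;> interval_cases U <;> interval_cases V <;> omega

/-- Here (x, y) and (u, v) will be the first columns of N and NM, and w the lower left entry of M.
The identity makes the sign term of the composition law compatible with replacing N by SN. -/
lemma sign_cocycle_aux (x y u v w : ℤ) (hxy : ¬ (x = 0 ∧ y = 0))
    (huv : ¬ (u = 0 ∧ v = 0)) (hw : w = x * v - y * u) :
    (u * v).sign + (y * w * v).sign = (x * y).sign + (x * w * u).sign := by
  have key : (x.sign * v.sign = 1 → y.sign * u.sign ≠ 1 → w.sign = 1) ∧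
      (x.sign * v.sign ≠ 1 → y.sign * u.sign = 1 → w.sign = -1) ∧
      (x.sign * v.sign = 0 → y.sign * u.sign = -1 → w.sign = 1) ∧
      (x.sign * v.sign = -1 → y.sign * u.sign = 0 → w.sign = -1) ∧
      (x.sign * v.sign = 0 → y.sign * u.sign = 0 → w.sign = 0) := by
    rw [← Int.sign_mul, ← Int.sign_mul]
    generalize x * v = p at hw
    generalize y * u = q at hw
    rcases sign_eq_cases p with ⟨h1, h1'⟩ | ⟨h1, h1'⟩ | ⟨h1, h1'⟩ <;>
    rcases sign_eq_cases q with ⟨h2, h2'⟩ | ⟨h2, h2'⟩ | ⟨h2, h2'⟩ <;>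
    rcases sign_eq_cases w with ⟨h3, h3'⟩ | ⟨h3, h3'⟩ | ⟨h3, h3'⟩ <;>
    rw [h1, h2, h3] <;> omega
  simp only [Int.sign_mul]
  have hmem : ∀ z : ℤ, z.sign ∈ Finset.Icc (-1 : ℤ) 1 := by
    intro z
    rw [Finset.mem_Icc]
    rcases sign_eq_cases z with ⟨h, -⟩ | ⟨h, -⟩ | ⟨h, -⟩ <;> rw [h] <;> norm_num
  exact sign_table _ (hmem x) _ (hmem y) _ (hmem u) _ (hmem v) _ (hmem w)
    (by simpa only [Int.sign_eq_zero_iff_zero] using hxy)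
    (by simpa only [Int.sign_eq_zero_iff_zero] using huv) key

/-- The composition law of Dedekind's function. -/
theorem dedekindPhi_mul (N M : SL(2, ℤ)) : dedekindPhi (N * M) =
    dedekindPhi N + dedekindPhi M - 3 * ((N 1 0 * M 1 0 * (N * M) 1 0).sign : ℚ) := by
  obtain ⟨s0, s1, s2, s3⟩ := S_entries
  obtain ⟨i0, i1, i2, i3⟩ := S_inv_entries
  obtain ⟨t0, t1, t2, t3⟩ := T_zpow_entries 1
  obtain ⟨v0, v1, v2, v3⟩ := T_zpow_entries (-1)
  rw [zpow_one] at t0 t1 t2 t3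
  rw [zpow_neg_one] at v0 v1 v2 v3
  have hT : ∀ M, dedekindPhi (ModularGroup.T * M) = dedekindPhi M + 1 := fun M =>
    dedekindPhi_T_mul (by simp [sl_mul, t0, t1]) (by simp [sl_mul, t0, t1])
      (by simp [sl_mul, t2, t3]) (by simp [sl_mul, t2, t3])
  have hT' : ∀ M, dedekindPhi (ModularGroup.T⁻¹ * M) = dedekindPhi M - 1 := fun M => by
    have := hT (ModularGroup.T⁻¹ * M)
    rw [mul_inv_cancel_left] at this
    linarith
  have hS : ∀ M, dedekindPhi (ModularGroup.S * M) =
      dedekindPhi M - 3 * ((M 0 0 * M 1 0).sign : ℚ) := fun M =>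
    dedekindPhi_S_mul (by simp [sl_mul, s0, s1]) (by simp [sl_mul, s0, s1])
      (by simp [sl_mul, s2, s3]) (by simp [sl_mul, s2, s3])
  have hS' : ∀ M, dedekindPhi (ModularGroup.S⁻¹ * M) =
      dedekindPhi M - 3 * ((M 0 0 * M 1 0).sign : ℚ) := fun M => by
    have := hS (ModularGroup.S⁻¹ * M)
    rw [mul_inv_cancel_left] at this
    have e : (ModularGroup.S⁻¹ * M) 0 0 * (ModularGroup.S⁻¹ * M) 1 0 = -(M 0 0 * M 1 0) := by
      rw [sl_mul, sl_mul, i0, i1, i2, i3]; ring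
    rw [e, Int.sign_neg] at this
    push_cast at this
    linarith
  have hlow : ∀ N M : SL(2, ℤ), M 1 0 = N 0 0 * (N * M) 1 0 - N 1 0 * (N * M) 0 0 := by
    intro N M
    rw [sl_mul, sl_mul]
    linear_combination -(M 1 0) * sl_det N
  have hne : ∀ N : SL(2, ℤ), ¬ (N 0 0 = 0 ∧ N 1 0 = 0) := by
    rintro N ⟨h, h'⟩
    have := sl_det N
    rw [h, h'] at this
    simp at this
  -- Induction on a word in S^{±1}, T^{±1}, letter by letter on the left. A letter T^{±1} changes Φ
  -- by ±1 on both sides and leaves the lower left entries alone; for S^{±1} the sign cocycle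
  -- identity is needed.
  have hN : N ∈ Subgroup.closure {ModularGroup.S, ModularGroup.T} := by
    rw [SpecialLinearGroup.SL2Z_generators]; trivial
  induction hN using Subgroup.closure_induction_left with
  | one => simp [dedekindPhi]
  | mul_left x hx N hN ih =>
    rcases hx with rfl | rfl
    · rw [mul_assoc, hS, hS, ih]
      have := sign_cocycle_aux _ _ _ _ _ (hne N) (hne (N * M)) (hlow N M)
      have e1 : (ModularGroup.S * N) 1 0 = N 0 0 := by simp [sl_mul, s2, s3]
      have e2 : (ModularGroup.S * (N * M)) 1 0 = (N * M) 0 0 := by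
        rw [sl_mul, s2, s3]; ring
      rw [e1, e2]
      have := congrArg (Int.cast : ℤ → ℚ) this
      push_cast at this ⊢
      linarith
    · rw [mul_assoc, hT, hT, ih]
      have e1 : (ModularGroup.T * N) 1 0 = N 1 0 := by simp [sl_mul, t2, t3]
      have e2 : (ModularGroup.T * (N * M)) 1 0 = (N * M) 1 0 := by
        rw [sl_mul, t2, t3]; ring
      rw [e1, e2]
      ring
  | inv_mul_cancel x hx N hN ih =>
    rcases hx with rfl | rfl
    · rw [mul_assoc, hS', hS', ih]
      have := sign_cocycle_aux _ _ _ _ _ (hne N) (hne (N * M)) (hlow N M)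
      have e1 : (ModularGroup.S⁻¹ * N) 1 0 = -N 0 0 := by
        rw [sl_mul, i2, i3]; ring
      have e2 : (ModularGroup.S⁻¹ * (N * M)) 1 0 = -(N * M) 0 0 := by
        rw [sl_mul, i2, i3]; ring
      rw [e1, e2, show -N 0 0 * M 1 0 * -(N * M) 0 0 = N 0 0 * M 1 0 * (N * M) 0 0 by ring]
      have := congrArg (Int.cast : ℤ → ℚ) this
      push_cast at this ⊢
      linarith
    · rw [mul_assoc, hT', hT', ih]
      have e1 : (ModularGroup.T⁻¹ * N) 1 0 = N 1 0 := by rw [sl_mul, v2, v3]; ring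
      have e2 : (ModularGroup.T⁻¹ * (N * M)) 1 0 = (N * M) 1 0 := by
        rw [sl_mul, v2, v3]; ring
      rw [e1, e2]
      ring

/-- The Rademacher invariant is additive on the powers of a hyperbolic matrix of positive trace. -/
theorem rademacher_pow {A : SL(2, ℤ)} {e : ℤ}
    (hc : ∀ k : ℕ, 0 < k → ((A ^ k) 1 0).sign = e)
    (htr : ∀ k : ℕ, 0 < k → 0 < (A ^ k) 0 0 + (A ^ k) 1 1) {n : ℕ} (hn : 0 < n) :
    rademacher (A ^ n) = n * rademacher A := by
  have he3 : e * e * e = e := by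
    rw [← hc 1 one_pos]
    rcases sign_eq_cases ((A ^ 1) 1 0) with ⟨h, -⟩ | ⟨h, -⟩ | ⟨h, -⟩ <;> rw [h] <;> norm_num
  have hr : ∀ k : ℕ, 0 < k → rademacher (A ^ k) = dedekindPhi (A ^ k) - 3 * (e : ℚ) := by
    intro k hk
    rw [rademacher_eq, Int.sign_mul, hc k hk, Int.sign_eq_one_of_pos (htr k hk), mul_one]
  have h1 := hr 1 one_pos
  rw [pow_one] at h1
  induction n, hn using Nat.le_induction with
  | base => simp
  | succ k hk ih =>
    have hmul := dedekindPhi_mul (A ^ k) A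
    have hs1 := hc 1 one_pos
    rw [pow_one] at hs1
    -- The correction is -3e³ = -3e. Since Ψ = Φ - 3e on every positive power, it is precisely what
    -- makes Ψ additive.
    rw [← pow_succ, Int.sign_mul, Int.sign_mul, hc k hk, hs1, hc (k + 1) (by omega), he3] at hmul
    rw [hr (k + 1) (by omega), hmul]
    rw [hr k hk] at ih
    push_cast
    linarith

/-! ### Units of real quadratic fields -/

lemma irrational_sqrt_squarefree {D : ℕ} (hD : 1 < D) (hsq : Squarefree D) :
    Irrational √(D : ℝ) := by
  rw [irrational_sqrt_natCast_iff]
  rintro ⟨r, rfl⟩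
  have := hsq r dvd_rfl
  rw [Nat.isUnit_iff] at this
  subst this
  omega

/-- The generator `√D` of `quadField D`. -/
def quadGen (D : ℕ) : quadField D :=
  ⟨√(D : ℝ), IntermediateField.subset_adjoin ℚ _ (Set.mem_singleton _)⟩

lemma quadGen_mul_self (D : ℕ) : quadGen D * quadGen D = (D : quadField D) := by
  apply Subtype.ext
  change √(D : ℝ) * √(D : ℝ) = _
  rw [Real.mul_self_sqrt (Nat.cast_nonneg D)]
  simp

lemma quadField_exists {D : ℕ} (y : quadField D) :
    ∃ p q : ℚ, y = algebraMap ℚ _ p + algebraMap ℚ _ q * quadGen D := by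
  obtain ⟨y, hy⟩ := y
  have hint : IsIntegral ℚ √(D : ℝ) :=
    ⟨Polynomial.X ^ 2 - Polynomial.C (D : ℚ), Polynomial.monic_X_pow_sub_C _ two_ne_zero, by
      simp [Real.sq_sqrt (Nat.cast_nonneg D)]⟩
  have hy' : y ∈ (Algebra.adjoin ℚ {√(D : ℝ)} : Subalgebra ℚ ℝ) := by
    rw [← IntermediateField.adjoin_simple_toSubalgebra_of_isAlgebraic hint.isAlgebraic]; exact hy
  suffices ∃ p q : ℚ, y = p + q * √(D : ℝ) by
    obtain ⟨p, q, h⟩ := this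
    refine ⟨p, q, Subtype.ext ?_⟩
    exact h
  have hs : √(D : ℝ) * √(D : ℝ) = D := Real.mul_self_sqrt (Nat.cast_nonneg D)
  clear hy
  induction hy' using Algebra.adjoin_induction with
  | mem x hx => exact ⟨0, 1, by rw [Set.mem_singleton_iff.1 hx]; simp⟩
  | algebraMap r => exact ⟨r, 0, by simp⟩
  | add x y _ _ hx hy =>
    obtain ⟨p, q, rfl⟩ := hx
    obtain ⟨p', q', rfl⟩ := hy
    exact ⟨p + p', q + q', by push_cast; ring⟩
  | mul x y _ _ hx hy =>
    obtain ⟨p, q, rfl⟩ := hx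
    obtain ⟨p', q', rfl⟩ := hy
    exact ⟨p * p' + D * q * q', p * q' + p' * q, by
      push_cast; linear_combination (q : ℝ) * q' * hs⟩

/-- The basis `{1, √D}` of `ℚ(√D)`. -/
def quadBasis {D : ℕ} (hD : 1 < D) (hsq : Squarefree D) : Module.Basis (Fin 2) ℚ (quadField D) :=
  Module.Basis.ofEquivFun (LinearEquiv.symm (LinearEquiv.ofBijective
    ({ toFun := fun v => algebraMap ℚ _ (v 0) + algebraMap ℚ _ (v 1) * quadGen D
       map_add' := fun v w => by simp only [Pi.add_apply, map_add]; ring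
       map_smul' := fun c v => by
        simp only [Pi.smul_apply, smul_eq_mul, map_mul, RingHom.id_apply, Algebra.smul_def]; ring } :
      (Fin 2 → ℚ) →ₗ[ℚ] quadField D)
    ⟨by
      rw [← LinearMap.ker_eq_bot, LinearMap.ker_eq_bot']
      intro v hv
      have h : ((v 0 : ℚ) : ℝ) + (v 1 : ℚ) * √(D : ℝ) = 0 := congrArg Subtype.val hv
      have h1 : v 1 = 0 := by
        by_contra hne
        refine irrational_sqrt_squarefree hD hsq ⟨-v 0 / v 1, ?_⟩
        have : ((v 1 : ℚ) : ℝ) ≠ 0 := by exact_mod_cast hne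
        push_cast
        rw [div_eq_iff this]
        linarith
      have h0 : v 0 = 0 := by
        rw [h1] at h
        simpa using h
      ext i
      fin_cases i
      · exact h0
      · exact h1,
     fun y => by
      obtain ⟨p, q, h⟩ := quadField_exists y
      exact ⟨![p, q], by simp [h]⟩⟩))

lemma quadBasis_zero {D : ℕ} (hD : 1 < D) (hsq : Squarefree D) : quadBasis hD hsq 0 = 1 := by
  simp [quadBasis]

lemma quadBasis_one {D : ℕ} (hD : 1 < D) (hsq : Squarefree D) :
    quadBasis hD hsq 1 = quadGen D := by
  simp [quadBasis]

lemma quadBasis_repr {D : ℕ} (hD : 1 < D) (hsq : Squarefree D) (p q : ℚ) (i : Fin 2) :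
    (quadBasis hD hsq).repr (algebraMap ℚ _ p + algebraMap ℚ _ q * quadGen D) i = ![p, q] i := by
  have : algebraMap ℚ (quadField D) p + algebraMap ℚ _ q * quadGen D =
      p • quadBasis hD hsq 0 + q • quadBasis hD hsq 1 := by
    rw [quadBasis_zero, quadBasis_one, Algebra.smul_def, Algebra.smul_def, mul_one]
  rw [this]
  fin_cases i <;> simp

lemma quad_leftMulMatrix {D : ℕ} (hD : 1 < D) (hsq : Squarefree D) (p q : ℚ) :
    Algebra.leftMulMatrix (quadBasis hD hsq) (algebraMap ℚ _ p + algebraMap ℚ _ q * quadGen D) =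
      !![p, D * q; q, p] := by
  have e1 : (algebraMap ℚ (quadField D) p + algebraMap ℚ _ q * quadGen D) * quadGen D =
      algebraMap ℚ _ (D * q) + algebraMap ℚ _ p * quadGen D := by
    have := quadGen_mul_self D
    rw [map_mul, map_natCast]
    linear_combination (algebraMap ℚ (quadField D) q) * this
  ext i k
  rw [Algebra.leftMulMatrix_eq_repr_mul]
  fin_cases k
  · simp only [Fin.zero_eta, quadBasis_zero, mul_one, quadBasis_repr]
    fin_cases i <;> rfl
  · simp only [Fin.mk_one, quadBasis_one, e1, quadBasis_repr]
    fin_cases i <;> rfl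

/-- The square of the denominator of q divides D, so the denominator is 1. -/
lemma int_of_squarefree_mul_sq {D : ℕ} (hsq : Squarefree D) {q : ℚ} {m : ℤ}
    (h : (D : ℚ) * q ^ 2 = m) : ∃ s : ℤ, q = s := by
  have hden : (D : ℤ) * q.num ^ 2 = m * q.den ^ 2 := by
    have hq : (q.den : ℚ) ≠ 0 := by exact_mod_cast q.den_ne_zero
    have h2 : (D : ℚ) * (q.num : ℚ) ^ 2 = m * (q.den : ℚ) ^ 2 := by
      have hnum : q * q.den = q.num := Rat.mul_den_eq_num q
      rw [← h, ← hnum]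
      ring
    exact_mod_cast h2
  have hdvd : ((q.den : ℤ)) ^ 2 ∣ (D : ℤ) := by
    have hcop : IsCoprime ((q.den : ℤ) ^ 2) (q.num ^ 2) := by
      have := q.reduced
      rw [Nat.coprime_comm] at this
      exact (Int.isCoprime_iff_gcd_eq_one.2 (by simpa [Int.gcd] using this)).pow
    exact hcop.dvd_of_dvd_mul_right ⟨m, by rw [hden]; ring⟩
  have hd : q.den * q.den ∣ D := by
    rw [← sq]; exact_mod_cast hdvd
  have h1 : q.den = 1 := Nat.isUnit_iff.1 (hsq _ hd)
  exact ⟨q.num, by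
    conv_lhs => rw [← Rat.num_div_den q]
    rw [h1]; simp⟩

lemma rat_int_of_isIntegral {q : ℚ} (h : IsIntegral ℤ q) : ∃ m : ℤ, q = m := by
  obtain ⟨m, hm⟩ := IsIntegrallyClosed.isIntegral_iff.1 h
  exact ⟨m, by rw [← hm]; simp⟩

/-- Totally positive units are solutions of the Pell equation `T² - Δ₀ f² = 4`. -/
theorem posNormUnits_spec {D : ℕ} (hD : 1 < D) (hsq : Squarefree D) {x : ℝ}
    (hx : x ∈ posNormUnits D) : ∃ T f : ℤ, 0 < T ∧ 0 < f ∧ T ^ 2 = fundDisc D * f ^ 2 + 4 ∧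
      x = (T + f * √(fundDisc D : ℝ)) / 2 ∧ x⁻¹ = (T - f * √(fundDisc D : ℝ)) / 2 := by
  obtain ⟨hx1, u, hux, hN⟩ := hx
  have hfin : FiniteDimensional ℚ (quadField D) := (quadBasis hD hsq).finiteDimensional_of_finite
  obtain ⟨p, q, hpq⟩ := quadField_exists ((u : 𝓞 (quadField D)) : quadField D)
  have htr : Algebra.trace ℚ (quadField D) ((u : 𝓞 (quadField D)) : quadField D) = 2 * p := by
    rw [Algebra.trace_eq_matrix_trace (quadBasis hD hsq), hpq, quad_leftMulMatrix,
      Matrix.trace_fin_two]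
    simp; ring
  have hnorm : Algebra.norm ℚ ((u : 𝓞 (quadField D)) : quadField D) = p ^ 2 - D * q ^ 2 := by
    rw [Algebra.norm_eq_matrix_det (quadBasis hD hsq), hpq, quad_leftMulMatrix,
      Matrix.det_fin_two]
    simp; ring
  obtain ⟨T, hT⟩ := rat_int_of_isIntegral (Algebra.isIntegral_trace (L := ℚ)
    (NumberField.RingOfIntegers.isIntegral_coe (u : 𝓞 (quadField D))))
  obtain ⟨N, hNi⟩ := rat_int_of_isIntegral (Algebra.isIntegral_norm ℚ (L := quadField D)
    (NumberField.RingOfIntegers.isIntegral_coe (u : 𝓞 (quadField D))))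
  obtain ⟨N', hNi'⟩ := rat_int_of_isIntegral (Algebra.isIntegral_norm ℚ (L := quadField D)
    (NumberField.RingOfIntegers.isIntegral_coe ((u⁻¹ : (𝓞 (quadField D))ˣ) : 𝓞 (quadField D))))
  have hNN : N * N' = 1 := by
    have h1 : Algebra.norm ℚ ((u : 𝓞 (quadField D)) : quadField D) *
        Algebra.norm ℚ (((u⁻¹ : (𝓞 (quadField D))ˣ) : 𝓞 (quadField D)) : quadField D) = 1 := by
      rw [← map_mul, ← map_mul, Units.mul_inv, map_one, map_one]
    rw [hNi, hNi'] at h1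
    exact_mod_cast h1
  rw [hNi] at hN
  have hN0 : 0 < N := by exact_mod_cast hN
  have hN1 : N = 1 := Int.eq_one_of_mul_eq_one_right hN0.le hNN
  rw [hnorm, hN1] at hNi
  rw [htr] at hT
  have hval : x = p + q * √(D : ℝ) := by
    rw [← hux, hpq]; rfl
  have hpell : (D : ℚ) * (2 * q) ^ 2 = ((T ^ 2 - 4 : ℤ) : ℚ) := by
    push_cast at hNi ⊢
    rw [← hT]
    linear_combination (-4) * hNi
  obtain ⟨s, hs⟩ := int_of_squarefree_mul_sq hsq hpell
  have hpellZ : (D : ℤ) * s ^ 2 = T ^ 2 - 4 := by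
    rw [hs] at hpell; exact_mod_cast hpell
  have hfs : ∃ f : ℤ, (fundDisc D : ℤ) * f ^ 2 = D * s ^ 2 ∧
      (f : ℝ) * √(fundDisc D : ℝ) = s * √(D : ℝ) := by
    unfold fundDisc
    split_ifs with hmod
    · exact ⟨s, rfl, rfl⟩
    · have hnot4 : D % 4 ≠ 0 := by
        intro h
        have h4 : 2 * 2 ∣ D := Nat.dvd_of_mod_eq_zero h
        have := hsq 2 h4
        rw [Nat.isUnit_iff] at this
        omega
      -- If D ≡ 2 or 3 mod 4 and s were odd, then D s² ≡ 2 or 3 mod 4, whereas T² - 4 ≡ 0 or 1 mod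
      -- 4. So √Δ₀ = 2√D absorbs the factor 2.
      have hs2 : Even s := by
        by_contra hodd
        rw [Int.not_even_iff_odd] at hodd
        obtain ⟨k, rfl⟩ := hodd
        have hD' : (D : ℤ) % 4 = 2 ∨ (D : ℤ) % 4 = 3 := by omega
        have h1 : ((D : ℤ) * (2 * k + 1) ^ 2) % 4 = (D : ℤ) % 4 := by
          have : (D : ℤ) * (2 * k + 1) ^ 2 = D + 4 * (D * (k ^ 2 + k)) := by ring
          rw [this]; omega
        have h2 : (T ^ 2 - 4) % 4 = 0 ∨ (T ^ 2 - 4) % 4 = 1 := by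
          rcases Int.even_or_odd' T with ⟨c, rfl | rfl⟩
          · left; have : (2 * c) ^ 2 - 4 = 4 * (c ^ 2 - 1) := by ring
            rw [this]; omega
          · right; have : (2 * c + 1) ^ 2 - 4 = 1 + 4 * (c ^ 2 + c - 1) := by ring
            rw [this]; omega
        rw [hpellZ] at h1
        omega
      obtain ⟨f, rfl⟩ := hs2
      refine ⟨f, by push_cast; ring, ?_⟩
      have : √((4 * D : ℕ) : ℝ) = 2 * √(D : ℝ) := by
        push_cast
        rw [Real.sqrt_mul (by norm_num), show (4 : ℝ) = 2 ^ 2 by norm_num,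
          Real.sqrt_sq (by norm_num)]
      rw [this]; push_cast; ring
  obtain ⟨f, hf1, hf2⟩ := hfs
  have hTr : (2 : ℝ) * p = T := by exact_mod_cast congrArg (Rat.cast : ℚ → ℝ) hT
  have hsr : (2 : ℝ) * q = s := by exact_mod_cast congrArg (Rat.cast : ℚ → ℝ) hs
  have hx2 : x = (T + f * √(fundDisc D : ℝ)) / 2 := by
    rw [hval, hf2, ← hTr, ← hsr]; ring
  have hpell2 : T ^ 2 = fundDisc D * f ^ 2 + 4 := by rw [hf1]; linarith
  have hprod : x * ((T - f * √(fundDisc D : ℝ)) / 2) = 1 := by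
    have h1 : √(fundDisc D : ℝ) ^ 2 = fundDisc D := Real.sq_sqrt (Nat.cast_nonneg _)
    have h2 : (T : ℝ) ^ 2 = fundDisc D * f ^ 2 + 4 := by exact_mod_cast hpell2
    rw [hx2]
    linear_combination h2 / 4 - (f : ℝ) ^ 2 / 4 * h1
  have hinv : x⁻¹ = (T - f * √(fundDisc D : ℝ)) / 2 := inv_eq_of_mul_eq_one_right hprod
  have hx0 : 0 < x := by linarith
  have hi0 : 0 < x⁻¹ := inv_pos.2 hx0
  have hi1 : x⁻¹ < 1 := inv_lt_one_of_one_lt₀ hx1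
  refine ⟨T, f, ?_, ?_, hpell2, hx2, hinv⟩
  · have : (0 : ℝ) < T := by linarith
    exact_mod_cast this
  · have h : (0 : ℝ) < f * √(fundDisc D : ℝ) := by linarith
    have : (0 : ℝ) < f := by
      by_contra hneg
      have := mul_nonneg (neg_nonneg.2 (not_lt.1 hneg)) (Real.sqrt_nonneg (fundDisc D : ℝ))
      linarith
    exact_mod_cast this

/-- The fundamental unit is attained as soon as there is a totally positive unit. -/
theorem fundUnit_mem {D : ℕ} (hD : 1 < D) (hsq : Squarefree D) (hne : (posNormUnits D).Nonempty) :
    fundUnit D ∈ posNormUnits D := by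
  classical
  -- The traces x + 1/x of the units considered are natural numbers and x ↦ x + 1/x increases on x >
  -- 1, so a unit of least trace is the least unit and the infimum is attained.
  have hex : ∃ T : ℕ, ∃ x ∈ posNormUnits D, x + x⁻¹ = T := by
    obtain ⟨x, hx⟩ := hne
    obtain ⟨T, f, hT, -, -, h1, h2⟩ := posNormUnits_spec hD hsq hx
    refine ⟨T.toNat, x, hx, ?_⟩
    have : ((T.toNat : ℕ) : ℝ) = T := by exact_mod_cast Int.toNat_of_nonneg hT.le
    rw [this, h2]
    linarith
  obtain ⟨x, hx, hxT⟩ := Nat.find_spec hex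
  have hmin : ∀ y ∈ posNormUnits D, x ≤ y := by
    intro y hy
    obtain ⟨T, f, hT, -, -, h1, h2⟩ := posNormUnits_spec hD hsq hy
    have hyT : y + y⁻¹ = T.toNat := by
      have : ((T.toNat : ℕ) : ℝ) = T := by exact_mod_cast Int.toNat_of_nonneg hT.le
      rw [this, h2]
      linarith
    have hle : x + x⁻¹ ≤ y + y⁻¹ := by
      rw [hxT, hyT]
      exact_mod_cast Nat.find_min' hex ⟨y, hy, hyT⟩
    by_contra hlt
    push Not at hlt
    have hx1 := hx.1
    have hy1 := hy.1
    have : (x - y) * (1 - (x * y)⁻¹) ≤ 0 := by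
      have hx0 : x ≠ 0 := by linarith
      have hy0 : y ≠ 0 := by linarith
      have e : (x - y) * (1 - (x * y)⁻¹) = (x + x⁻¹) - (y + y⁻¹) := by field_simp; ring
      rw [e]; linarith
    have h3 : (x * y)⁻¹ < 1 := inv_lt_one_of_one_lt₀ (by nlinarith)
    nlinarith
  have : fundUnit D = x := (IsLeast.csInf_eq ⟨hx, hmin⟩)
  rw [this]; exact hx

/-! ### Lucas sequences -/

/-- The Lucas sequence `(xⁿ - x⁻ⁿ)/(x - x⁻¹)` with `x + x⁻¹ = T`. -/
def lucU (T : ℤ) : ℕ → ℤ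
  | 0 => 0
  | 1 => 1
  | n + 2 => T * lucU T (n + 1) - lucU T n

/-- The companion Lucas sequence `xⁿ + x⁻ⁿ` with `x + x⁻¹ = T`. -/
def lucV (T : ℤ) : ℕ → ℤ
  | 0 => 2
  | 1 => T
  | n + 2 => T * lucV T (n + 1) - lucV T n

lemma lucU_succ_succ (T : ℤ) (n : ℕ) : lucU T (n + 2) = T * lucU T (n + 1) - lucU T n := rfl

lemma lucV_succ_succ (T : ℤ) (n : ℕ) : lucV T (n + 2) = T * lucV T (n + 1) - lucV T n := rfl

lemma lucU_spec {T : ℤ} {x y : ℝ} (hxy : x * y = 1) (hT : x + y = T) (n : ℕ) :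
    x ^ n - y ^ n = (x - y) * lucU T n := by
  induction n using Nat.twoStepInduction with
  | zero => simp [lucU]
  | one => simp [lucU]
  | more n h1 h2 =>
    rw [lucU_succ_succ]
    push_cast
    rw [← hT]
    linear_combination (x + y) * h2 - h1 - (x ^ n - y ^ n) * hxy

lemma lucV_spec {T : ℤ} {x y : ℝ} (hxy : x * y = 1) (hT : x + y = T) (n : ℕ) :
    x ^ n + y ^ n = lucV T n := by
  induction n using Nat.twoStepInduction with
  | zero => norm_num [lucV]
  | one => simp [lucV, hT]
  | more n h1 h2 =>
    rw [lucV_succ_succ]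
    push_cast
    rw [← hT]
    linear_combination (x + y) * h2 - h1 - (x ^ n + y ^ n) * hxy

lemma lucU_pos_lucV_ge {T : ℤ} (hT : 2 ≤ T) (n : ℕ) :
    0 < lucU T (n + 1) ∧ lucU T n ≤ lucU T (n + 1) ∧ T ≤ lucV T (n + 1) ∧
      lucV T n ≤ lucV T (n + 1) := by
  induction n with
  | zero => simp [lucU, lucV]; omega
  | succ n ih =>
    obtain ⟨h1, h2, h3, h4⟩ := ih
    rw [lucU_succ_succ, lucV_succ_succ]
    refine ⟨?_, ?_, ?_, ?_⟩ <;> nlinarith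

/-- Every third term obeys a Lucas recursion of its own with coefficient V_3 = T³ - 3T; this is what
makes residues of n modulo 3 relevant. -/
lemma lucU_add_three (T : ℤ) (n : ℕ) :
    lucU T (n + 6) = (T ^ 3 - 3 * T) * lucU T (n + 3) - lucU T n := by
  have e : ∀ k, lucU T (k + 2) = T * lucU T (k + 1) - lucU T k := fun k => rfl
  rw [e (n + 4), e (n + 3), e (n + 2), e (n + 1), e n]; ring

lemma lucV_add_three (T : ℤ) (n : ℕ) :
    lucV T (n + 6) = (T ^ 3 - 3 * T) * lucV T (n + 3) - lucV T n := by
  have e : ∀ k, lucV T (k + 2) = T * lucV T (k + 1) - lucV T k := fun k => rfl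
  rw [e (n + 4), e (n + 3), e (n + 2), e (n + 1), e n]; ring

lemma lucV_sq (T : ℤ) (n : ℕ) :
    lucV T n ^ 2 = (T ^ 2 - 4) * lucU T n ^ 2 + 4 ∧
    lucV T n * lucV T (n + 1) = (T ^ 2 - 4) * (lucU T n * lucU T (n + 1)) + 2 * T ∧
    lucV T (n + 1) ^ 2 = (T ^ 2 - 4) * lucU T (n + 1) ^ 2 + 4 := by
  induction n with
  | zero => simp [lucU, lucV]
  | succ n ih =>
    obtain ⟨h1, h2, h3⟩ := ih
    refine ⟨h3, ?_, ?_⟩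
    · rw [lucU_succ_succ, lucV_succ_succ]; linear_combination T * h3 - h2
    · rw [lucU_succ_succ, lucV_succ_succ]; linear_combination T ^ 2 * h3 - 2 * T * h2 + h1

/-- With `lucV_two_mul_add_one` this shows that V_n + 2, which is d_{nj} + 1, is a square for n even
and T + 2 times a square for n odd. -/
lemma lucV_two_mul (T : ℤ) (k : ℕ) :
    lucV T (2 * k) + 2 = lucV T k ^ 2 ∧
    lucV T (2 * k + 1) + T = lucV T k * lucV T (k + 1) := by
  induction k with
  | zero => simp [lucV]; ring
  | succ k ih =>
    obtain ⟨h1, h2⟩ := ih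
    obtain ⟨q1, q2, q3⟩ := lucV_sq T k
    have q4 : lucV T k ^ 2 - T * (lucV T k * lucV T (k + 1)) + lucV T (k + 1) ^ 2 = 4 - T ^ 2 := by
      have hU : lucU T k ^ 2 - T * (lucU T k * lucU T (k + 1)) + lucU T (k + 1) ^ 2 = 1 := by
        clear h1 h2 q1 q2 q3
        induction k with
        | zero => simp [lucU]
        | succ k ih => rw [lucU_succ_succ]; linear_combination ih
      linear_combination q1 - T * q2 + q3 + (T ^ 2 - 4) * hU
    have e1 : lucV T (2 * (k + 1)) = T * lucV T (2 * k + 1) - lucV T (2 * k) := rfl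
    have e2 : lucV T (2 * (k + 1) + 1) = T * lucV T (2 * (k + 1)) - lucV T (2 * k + 1) := rfl
    have s1 : lucV T (2 * (k + 1)) + 2 = lucV T (k + 1) ^ 2 := by
      rw [e1]; linear_combination T * h2 - h1 - q4
    refine ⟨s1, ?_⟩
    rw [e2, lucV_succ_succ]
    linear_combination T * s1 - h2

lemma lucV_two_mul_add_one (T : ℤ) (k : ℕ) :
    lucV T (2 * k + 1) + 2 = (T + 2) * (lucU T (k + 1) - lucU T k) ^ 2 := by
  obtain ⟨-, q2, -⟩ := lucV_sq T k
  obtain ⟨-, h2⟩ := lucV_two_mul T k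
  have hU : lucU T k ^ 2 - T * (lucU T k * lucU T (k + 1)) + lucU T (k + 1) ^ 2 = 1 := by
    clear q2 h2
    induction k with
    | zero => simp [lucU]
    | succ k ih => rw [lucU_succ_succ]; linear_combination ih
  linear_combination h2 + q2 - (T + 2) * hU

/-! ### Congruences for the Lucas sequences modulo d² and 2d² -/

/-- For T = d - 1 the coefficient T³ - 3T equals 2 + d²(d - 3), so modulo d² the second differences
of every third term vanish and these terms form an arithmetic progression, determined by its first
two members. -/
lemma lucV_congr_one {T d : ℤ} (hT : T = d - 1) (k : ℕ) :
    ∃ z, lucV T (1 + 3 * k) = -1 + d * (1 + 3 * k) + d ^ 2 * z := by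
  induction k using Nat.twoStepInduction with
  | zero => exact ⟨0, by simp [lucV, hT]; ring⟩
  | one => exact ⟨d ^ 2 - 4 * d + 2, by simp [lucV, hT]; ring⟩
  | more k h1 h2 =>
    obtain ⟨z1, h1⟩ := h1
    obtain ⟨z2, h2⟩ := h2
    have e := lucV_add_three T (1 + 3 * k)
    refine ⟨2 * z2 - z1 + (d - 3) * lucV T (1 + 3 * (k + 1)), ?_⟩
    have e' : lucV T (1 + 3 * (k + 2)) =
        (T ^ 3 - 3 * T) * lucV T (1 + 3 * (k + 1)) - lucV T (1 + 3 * k) := e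
    have e3 : T ^ 3 - 3 * T = 2 + d ^ 2 * (d - 3) := by rw [hT]; ring
    rw [e', e3]
    push_cast at h1 h2 ⊢
    linear_combination 2 * h2 - h1

lemma lucV_congr_two {T d : ℤ} (hT : T = d - 1) (k : ℕ) :
    ∃ z, lucV T (2 + 3 * k) = -1 - d * (2 + 3 * k) + d ^ 2 * z := by
  induction k using Nat.twoStepInduction with
  | zero => exact ⟨1, by simp [lucV, hT]; ring⟩
  | one => exact ⟨d ^ 3 - 5 * d ^ 2 + 5 * d + 5, by simp [lucV, hT]; ring⟩
  | more k h1 h2 =>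
    obtain ⟨z1, h1⟩ := h1
    obtain ⟨z2, h2⟩ := h2
    have e := lucV_add_three T (2 + 3 * k)
    refine ⟨2 * z2 - z1 + (d - 3) * lucV T (2 + 3 * (k + 1)), ?_⟩
    have e' : lucV T (2 + 3 * (k + 2)) =
        (T ^ 3 - 3 * T) * lucV T (2 + 3 * (k + 1)) - lucV T (2 + 3 * k) := e
    have e3 : T ^ 3 - 3 * T = 2 + d ^ 2 * (d - 3) := by rw [hT]; ring
    rw [e', e3]
    push_cast at h1 h2 ⊢
    linear_combination 2 * h2 - h1

lemma lucU_congr_one {T d : ℤ} (hT : T = d - 1) (k : ℕ) :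
    ∃ z, lucU T (1 + 3 * k) = 1 + d * k + d ^ 2 * z := by
  induction k using Nat.twoStepInduction with
  | zero => exact ⟨0, by simp [lucU]⟩
  | one => exact ⟨d - 3, by simp [lucU, hT]; ring⟩
  | more k h1 h2 =>
    obtain ⟨z1, h1⟩ := h1
    obtain ⟨z2, h2⟩ := h2
    have e := lucU_add_three T (1 + 3 * k)
    refine ⟨2 * z2 - z1 + (d - 3) * lucU T (1 + 3 * (k + 1)), ?_⟩
    have e' : lucU T (1 + 3 * (k + 2)) =
        (T ^ 3 - 3 * T) * lucU T (1 + 3 * (k + 1)) - lucU T (1 + 3 * k) := e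
    have e3 : T ^ 3 - 3 * T = 2 + d ^ 2 * (d - 3) := by rw [hT]; ring
    rw [e', e3]
    push_cast at h1 h2 ⊢
    linear_combination 2 * h2 - h1

lemma lucU_congr_two {T d : ℤ} (hT : T = d - 1) (k : ℕ) :
    ∃ z, lucU T (2 + 3 * k) = -1 + d * (k + 1) + d ^ 2 * z := by
  induction k using Nat.twoStepInduction with
  | zero => exact ⟨0, by simp [lucU, hT]; ring⟩
  | one => exact ⟨d ^ 2 - 4 * d + 3, by simp [lucU, hT]; ring⟩
  | more k h1 h2 =>
    obtain ⟨z1, h1⟩ := h1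
    obtain ⟨z2, h2⟩ := h2
    have e := lucU_add_three T (2 + 3 * k)
    refine ⟨2 * z2 - z1 + (d - 3) * lucU T (2 + 3 * (k + 1)), ?_⟩
    have e' : lucU T (2 + 3 * (k + 2)) =
        (T ^ 3 - 3 * T) * lucU T (2 + 3 * (k + 1)) - lucU T (2 + 3 * k) := e
    have e3 : T ^ 3 - 3 * T = 2 + d ^ 2 * (d - 3) := by rw [hT]; ring
    rw [e', e3]
    push_cast at h1 h2 ⊢
    linear_combination 2 * h2 - h1

/-- Modulo 2d² the second difference is d²(d - 3)V, with both d - 3 and V odd, hence congruent to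
d². Summing twice gives d² times a triangular number c. -/
lemma lucV_congr_one_even {T d : ℤ} (hT : T = d - 1) (hd : Even d) (k : ℕ) :
    ∃ c z, 2 * c = (k : ℤ) * (k - 1) ∧
      lucV T (1 + 3 * k) = -1 + d * (1 + 3 * k) + d ^ 2 * c + 2 * d ^ 2 * z := by
  obtain ⟨e, he⟩ := hd
  induction k using Nat.twoStepInduction with
  | zero => exact ⟨0, 0, by simp, by simp [lucV, hT]; ring⟩
  | one => exact ⟨0, 2 * e ^ 2 - 4 * e + 1, by simp, by simp [lucV, hT, he]; ring⟩
  | more k h1 h2 =>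
    obtain ⟨c1, z1, hc1, h1⟩ := h1
    obtain ⟨c2, z2, hc2, h2⟩ := h2
    have e' : lucV T (1 + 3 * (k + 2)) =
        (T ^ 3 - 3 * T) * lucV T (1 + 3 * (k + 1)) - lucV T (1 + 3 * k) :=
      lucV_add_three T (1 + 3 * k)
    have e3 : T ^ 3 - 3 * T = 2 + d ^ 2 * (d - 3) := by rw [hT]; ring
    -- V is odd because it is congruent to -1 modulo the even number d, as the induction hypothesis
    -- shows.
    have hodd : ∃ w, (d - 3) * lucV T (1 + 3 * (k + 1)) = 1 + 2 * w := by
      refine ⟨(d - 3) * (e * (1 + 3 * (k + 1 : ℕ)) + e * d * c2 + d ^ 2 * z2) + 1 - e, ?_⟩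
      rw [h2, he]; ring
    obtain ⟨w, hw⟩ := hodd
    refine ⟨2 * c2 - c1 + 1, 2 * z2 - z1 + w, ?_, ?_⟩
    · push_cast at hc1 hc2 ⊢; linear_combination 2 * hc2 - hc1
    · rw [e', e3]
      push_cast at h1 h2 ⊢
      linear_combination 2 * h2 - h1 + d ^ 2 * hw

lemma lucV_congr_two_even {T d : ℤ} (hT : T = d - 1) (hd : Even d) (k : ℕ) :
    ∃ c z, 2 * c = ((k : ℤ) + 1) * (k + 2) ∧
      lucV T (2 + 3 * k) = -1 - d * (2 + 3 * k) + d ^ 2 * c + 2 * d ^ 2 * z := by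
  obtain ⟨e, he⟩ := hd
  induction k using Nat.twoStepInduction with
  | zero => exact ⟨1, 0, by simp, by simp [lucV, hT]; ring⟩
  | one =>
    exact ⟨3, 4 * e ^ 3 - 10 * e ^ 2 + 5 * e + 1, by simp, by simp [lucV, hT, he]; ring⟩
  | more k h1 h2 =>
    obtain ⟨c1, z1, hc1, h1⟩ := h1
    obtain ⟨c2, z2, hc2, h2⟩ := h2
    have e' : lucV T (2 + 3 * (k + 2)) =
        (T ^ 3 - 3 * T) * lucV T (2 + 3 * (k + 1)) - lucV T (2 + 3 * k) :=
      lucV_add_three T (2 + 3 * k)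
    have e3 : T ^ 3 - 3 * T = 2 + d ^ 2 * (d - 3) := by rw [hT]; ring
    have hodd : ∃ w, (d - 3) * lucV T (2 + 3 * (k + 1)) = 1 + 2 * w := by
      refine ⟨(d - 3) * (-e * (2 + 3 * (k + 1 : ℕ)) + e * d * c2 + d ^ 2 * z2) + 1 - e, ?_⟩
      rw [h2, he]; ring
    obtain ⟨w, hw⟩ := hodd
    refine ⟨2 * c2 - c1 + 1, 2 * z2 - z1 + w, ?_, ?_⟩
    · push_cast at hc1 hc2 ⊢; linear_combination 2 * hc2 - hc1
    · rw [e', e3]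
      push_cast at h1 h2 ⊢
      linear_combination 2 * h2 - h1 + d ^ 2 * hw

lemma even_lucV {T : ℤ} (hT : Even T) (n : ℕ) : Even (lucV T n) := by
  induction n using Nat.twoStepInduction with
  | zero => exact even_two
  | one => exact hT
  | more n h1 h2 => rw [lucV_succ_succ]; exact (hT.mul_right _).sub h1

lemma exists_three_mul_of_coprime {n : ℕ} (hn3 : Nat.Coprime n 3) :
    ∃ k, n = 1 + 3 * k ∨ n = 2 + 3 * k := by
  have : ¬ 3 ∣ n := fun h => by
    have := Nat.Coprime.eq_one_of_dvd hn3.symm h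
    omega
  exact ⟨n / 3, by omega⟩

/-- `d_j` divides `d_{nj}` for `n` prime to `3`. -/
lemma dvd_lucV_add_one {T d : ℤ} (hT : T = d - 1) {n : ℕ} (hn3 : Nat.Coprime n 3) :
    d ∣ lucV T n + 1 := by
  obtain ⟨k, rfl | rfl⟩ := exists_three_mul_of_coprime hn3
  · obtain ⟨z, h⟩ := lucV_congr_one hT k
    exact ⟨1 + 3 * k + d * z, by rw [h]; ring⟩
  · obtain ⟨z, h⟩ := lucV_congr_two hT k
    exact ⟨-(2 + 3 * k) + d * z, by rw [h]; ring⟩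

/-- Dividing the congruence for V_n + 1 by d gives κ ≡ ±n mod d, and U_n ≡ ±1 mod d with the same
sign. -/
lemma ratio_mul_lucU {T d κ : ℤ} (hd : d ≠ 0) (hT : T = d - 1) {n : ℕ} (hn3 : Nat.Coprime n 3)
    (hκ : d * κ = lucV T n + 1) : d ∣ κ * lucU T n - n := by
  obtain ⟨k, rfl | rfl⟩ := exists_three_mul_of_coprime hn3
  · obtain ⟨z, h⟩ := lucV_congr_one hT k
    obtain ⟨z', h'⟩ := lucU_congr_one hT k
    have hk : κ = 1 + 3 * k + d * z := mul_left_cancel₀ hd (by rw [hκ, h]; ring)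
    refine ⟨z * lucU T (1 + 3 * k) + (1 + 3 * k) * (k + d * z'), ?_⟩
    rw [hk]
    push_cast
    linear_combination (1 + 3 * (k : ℤ)) * h'
  · obtain ⟨z, h⟩ := lucV_congr_two hT k
    obtain ⟨z', h'⟩ := lucU_congr_two hT k
    have hk : κ = -(2 + 3 * k) + d * z := mul_left_cancel₀ hd (by rw [hκ, h]; ring)
    refine ⟨z * lucU T (2 + 3 * k) - (2 + 3 * k) * (k + 1 + d * z'), ?_⟩
    rw [hk]
    push_cast
    linear_combination -(2 + 3 * (k : ℤ)) * h'

lemma odd_of_two_mul_eq_mod_four {c : ℤ} {k m : ℕ} (hc : 2 * c = (m : ℤ) * (m - 1)) 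
    (hk : k % 4 = m % 4) : Odd c ↔ k % 4 = 2 ∨ k % 4 = 3 := by
  obtain ⟨q, r, hr, rfl⟩ : ∃ q r : ℕ, r < 4 ∧ m = 4 * q + r := ⟨m / 4, m % 4, by omega, by omega⟩
  have hkr : k % 4 = r := by omega
  rw [hkr, Int.odd_iff]
  interval_cases r
  · have : c = 2 * (q * (4 * q - 1)) := by push_cast at hc; linarith
    omega
  · have : c = 2 * (q * (4 * q + 1)) := by push_cast at hc; linarith
    omega
  · have : c = 2 * (q * (4 * q + 3)) + 1 := by push_cast at hc; linarith
    omega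
  · have : c = 2 * (q * (4 * q + 5) + 1) + 1 := by push_cast at hc; linarith
    omega

/-- Modulo 2d the product κU_n is n + dc up to sign of dc: the cross terms nk, respectively n(k +
1), are even, and multiples of d² disappear because d is even. Thus the parity in question is that
of the triangular number c, which depends on k mod 4, that is on n mod 12. -/
lemma ratio_mul_lucU_even {T d κ : ℤ} (hd : d ≠ 0) (hde : Even d) (hT : T = d - 1) {n : ℕ}
    (hn3 : Nat.Coprime n 3) (hκ : d * κ = lucV T n + 1) :
    (∃ e z, κ * lucU T n = n + d * e + 2 * d * z ∧
      (Odd e ↔ n % 12 = 2 ∨ n % 12 = 10 ∨ n % 12 = 5 ∨ n % 12 = 7)) ∧ Even (κ - n) := by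
  obtain ⟨d', hd'⟩ := hde
  obtain ⟨k, rfl | rfl⟩ := exists_three_mul_of_coprime hn3
  · obtain ⟨c, z, hc, h⟩ := lucV_congr_one_even hT ⟨d', hd'⟩ k
    obtain ⟨z', h'⟩ := lucU_congr_one hT k
    have hk : κ = 1 + 3 * k + d * c + 2 * d * z := mul_left_cancel₀ hd (by rw [hκ, h]; ring)
    refine ⟨⟨c, z * lucU T (1 + 3 * k) + (1 + 3 * k) * d' * z' + c * d' * (k + d * z') +
      2 * k + 3 * c, ?_, ?_⟩, ?_⟩
    · rw [hk, add_mul, h']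
      push_cast
      linear_combination (-3 * d) * hc + (d * z' * (1 + 3 * k) + d * c * (k + d * z')) * hd'
    · rw [odd_of_two_mul_eq_mod_four hc rfl]; omega
    · exact ⟨d' * c + d * z, by rw [hk]; push_cast; linear_combination c * hd'⟩
  · obtain ⟨c, z, hc, h⟩ := lucV_congr_two_even hT ⟨d', hd'⟩ k
    obtain ⟨z', h'⟩ := lucU_congr_two hT k
    have hk : κ = -(2 + 3 * k) + d * c + 2 * d * z := mul_left_cancel₀ hd (by rw [hκ, h]; ring)
    refine ⟨⟨c, z * lucU T (2 + 3 * k) - (2 + 3 * k) * d' * z' - c + c * d' * (k + 1 + d * z') -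
      (3 * c - 2 * k - 2), ?_, ?_⟩, ?_⟩
    · rw [hk, add_mul, h']
      push_cast
      linear_combination (3 * d) * hc + (-d * z' * (2 + 3 * k) + d * c * (k + 1 + d * z')) * hd'
    · have hc' : 2 * c = ((k + 2 : ℕ) : ℤ) * ((k + 2 : ℕ) - 1) := by push_cast; linarith
      rw [odd_of_two_mul_eq_mod_four hc' rfl]; omega
    · exact ⟨d' * c + d * z - (2 + 3 * k), by rw [hk]; push_cast; linear_combination c * hd'⟩

/-! ### The dimension towers -/

/-- The numbers attached to the unit `x = ε^j`: `T = x + x⁻¹`, and `f` is the conductor `f_j`. -/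
structure Tower (D j : ℕ) (T f : ℤ) (x : ℝ) : Prop where
  one_lt : 1 < x
  add_inv : x + x⁻¹ = T
  sub_inv : x - x⁻¹ = f * √(fundDisc D : ℝ)
  condSeq_eq : (condSeq D j : ℤ) = f
  f_pos : 0 < f
  pell : T ^ 2 = fundDisc D * f ^ 2 + 4
  dimTower_eq : (dimTower D j : ℤ) = T + 1
  rankGrid_eq : rankGrid D j 1 = 1

lemma fundDisc_pos {D : ℕ} (hD : 1 < D) : 0 < fundDisc D := by
  unfold fundDisc; split_ifs <;> omega

/-- Exactness of the conductor sequence. -/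
lemma condSeq_cast {D : ℕ} (hD : 1 < D) {T f : ℤ} (hf : 0 < f) (hT : 2 ≤ T)
    (h1 : fundUnit D + (fundUnit D)⁻¹ = T)
    (h2 : fundUnit D - (fundUnit D)⁻¹ = f * √(fundDisc D : ℝ)) (h0 : fundUnit D ≠ 0) (k : ℕ) :
    (condSeq D k : ℤ) = f * lucU T k := by
  have hs : (0 : ℝ) < √(fundDisc D : ℝ) := Real.sqrt_pos.2 (by exact_mod_cast fundDisc_pos hD)
  have hnn : 0 ≤ lucU T k := by
    rcases k with _ | k
    · simp [lucU]
    · exact (lucU_pos_lucV_ge hT k).1.le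
  have hval : (fundUnit D ^ k - (fundUnit D ^ k)⁻¹) / √(fundDisc D : ℝ) =
      ((f * lucU T k).toNat : ℝ) := by
    have e : (((f * lucU T k).toNat : ℕ) : ℝ) = ((f * lucU T k : ℤ) : ℝ) := by
      exact_mod_cast Int.toNat_of_nonneg (mul_nonneg hf.le hnn)
    have := lucU_spec (mul_inv_cancel₀ h0) h1 k
    rw [e, ← inv_pow, this, h2, div_eq_iff hs.ne']
    push_cast; ring
  rw [condSeq, hval, Nat.floor_natCast, Int.toNat_of_nonneg (mul_nonneg hf.le hnn)]

/-- Everything is a Lucas number for ε: f_j is f₁U_j, and U_{jm} = U_j · U_m(V_j), so the rank grid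
is an exact quotient and d_j = r_{j,2} + r_{j,1} = V_j + 1. -/
lemma Tower.of_fundUnit {D : ℕ} (hD : 1 < D) (hsq : Squarefree D)
    (hne : (posNormUnits D).Nonempty) {j : ℕ} (hj : 0 < j) :
    ∃ T f : ℤ, Tower D j T f (fundUnit D ^ j) := by
  have hmem := fundUnit_mem hD hsq hne
  obtain ⟨T, f, hT, hf, hpell, hx, hi⟩ := posNormUnits_spec hD hsq hmem
  have h1 : fundUnit D + (fundUnit D)⁻¹ = T := by rw [hi]; nth_rewrite 1 [hx]; ring
  have h2 : fundUnit D - (fundUnit D)⁻¹ = f * √(fundDisc D : ℝ) := by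
    rw [hi]; nth_rewrite 1 [hx]; ring
  have hgt := hmem.1
  have h0 : fundUnit D ≠ 0 := by linarith
  have hT2 : 2 ≤ T := by
    have : 0 < (fundDisc D : ℤ) * f ^ 2 := by
      have : (0 : ℤ) < fundDisc D := by exact_mod_cast fundDisc_pos hD
      positivity
    nlinarith
  have hc := condSeq_cast hD hf hT2 h1 h2 h0
  have hxy := mul_inv_cancel₀ h0
  have hUj : 0 < lucU T j := by
    obtain ⟨k, rfl⟩ : ∃ k, j = k + 1 := ⟨j - 1, by omega⟩
    exact (lucU_pos_lucV_ge hT2 k).1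
  have hVj := lucV_spec hxy h1 j
  have hgrid : ∀ m, (rankGrid D j m : ℤ) = lucU (lucV T j) m := by
    intro m
    have hxyj : fundUnit D ^ j * (fundUnit D)⁻¹ ^ j = 1 := by rw [← mul_pow, hxy, one_pow]
    have e1 := lucU_spec hxy h1 (j * m)
    have e2 := lucU_spec hxyj hVj m
    have e3 := lucU_spec hxy h1 j
    have hne' : fundUnit D - (fundUnit D)⁻¹ ≠ 0 := by
      have := inv_lt_one_of_one_lt₀ hgt
      linarith
    rw [← pow_mul, ← pow_mul, e1, e3, mul_assoc] at e2
    have e4 : lucU T (j * m) = lucU T j * lucU (lucV T j) m := by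
      exact_mod_cast mul_left_cancel₀ hne' e2
    have e5 : (condSeq D (j * m) : ℤ) = condSeq D j * lucU (lucV T j) m := by
      rw [hc, hc, e4]; ring
    have hcj : (condSeq D j : ℤ) ≠ 0 := by rw [hc]; positivity
    rw [rankGrid, Int.natCast_div, e5, Int.mul_ediv_cancel_left _ hcj]
  refine ⟨lucV T j, f * lucU T j, one_lt_pow₀ hgt hj.ne', ?_, ?_, hc j, by positivity, ?_, ?_, ?_⟩
  · rw [← inv_pow, hVj]
  · rw [← inv_pow, lucU_spec hxy h1 j, h2]; push_cast; ring
  · rw [(lucV_sq T j).1, hpell]; ring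
  · rw [dimTower, dimGrid]
    push_cast
    rw [hgrid, hgrid]
    simp [lucU]
  · have := hgrid 1
    simp only [lucU] at this
    exact_mod_cast this

lemma Tower.mul {D j : ℕ} (hD : 1 < D) (hsq : Squarefree D) (hne : (posNormUnits D).Nonempty)
    (hj : 0 < j) {T f : ℤ} (h : Tower D j T f (fundUnit D ^ j)) {n : ℕ} (hn : 0 < n) :
    Tower D (n * j) (lucV T n) (f * lucU T n) (fundUnit D ^ (n * j)) := by
  obtain ⟨T', f', h'⟩ := Tower.of_fundUnit hD hsq hne (Nat.mul_pos hn hj)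
  have h0 : fundUnit D ^ j ≠ 0 := by have := h.one_lt; linarith
  have hs : √(fundDisc D : ℝ) ≠ 0 :=
    (Real.sqrt_pos.2 (by exact_mod_cast fundDisc_pos hD)).ne'
  have e1 : T' = lucV T n := by
    have := lucV_spec (mul_inv_cancel₀ h0) h.add_inv n
    rw [inv_pow, ← pow_mul, mul_comm j n, h'.add_inv] at this
    exact_mod_cast this
  have e2 : f' = f * lucU T n := by
    have := lucU_spec (mul_inv_cancel₀ h0) h.add_inv n
    rw [inv_pow, ← pow_mul, mul_comm j n, h'.sub_inv, h.sub_inv] at this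
    have h3 : (f' : ℝ) = f * lucU T n := mul_right_cancel₀ hs (by rw [this]; ring)
    exact_mod_cast h3
  rw [← e1, ← e2]
  exact h'

/-- If there were no such unit, the infimum of the empty set would be 0, the conductors would vanish
and d would be 0, contrary to admissibility of the pair. So no existence theorem for units is
required. -/
lemma posNormUnits_nonempty_of_admissible {D j : ℕ} {Q : QForm}
    (ht : (rankOneTuple D j Q).IsAdmissible) : (posNormUnits D).Nonempty := by
  by_contra hne
  rw [Set.not_nonempty_iff_eq_empty] at hne
  have hj : j ≠ 0 := ht.j_pos.ne'
  have hf : fundUnit D = 0 := by rw [fundUnit, hne, Real.sInf_empty]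
  have hc : condSeq D j = 0 := by rw [condSeq, hf, zero_pow hj]; simp
  obtain ⟨n, -, -, h, -⟩ := ht.pair
  have hd : dimTower D j = 0 := by simp [dimTower, dimGrid, rankGrid, hc]
  change (2 : ℤ) * ((1 : ℕ) : ℤ) < ((dimTower D j : ℕ) : ℤ) - 1 at h
  rw [hd] at h
  norm_num at h

/-! ### Discriminants and conductors of forms -/

lemma sqfreePart_eq {a b : ℕ} (ha : Squarefree a) (hb : b ≠ 0) : sqfreePart (b ^ 2 * a) = a := by
  have ha0 : a ≠ 0 := ha.ne_zero
  have hfac : ∀ p, (b ^ 2 * a).factorization p = 2 * b.factorization p + a.factorization p := by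
    intro p
    rw [Nat.factorization_mul (pow_ne_zero 2 hb) ha0, Nat.factorization_pow]
    simp
  have hset : {p ∈ (b ^ 2 * a).primeFactors | Odd ((b ^ 2 * a).factorization p)} =
      a.primeFactors := by
    ext p
    rw [Finset.mem_filter, hfac]
    have hle := (Nat.squarefree_iff_factorization_le_one ha0).1 ha p
    constructor
    · rintro ⟨-, hodd⟩
      rw [← Nat.support_factorization, Finsupp.mem_support_iff]
      intro h
      rw [h, add_zero] at hodd
      exact (Nat.not_odd_iff_even.2 (even_two_mul _)) hodd
    · intro hp
      have hp' := hp
      rw [← Nat.support_factorization, Finsupp.mem_support_iff] at hp'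
      refine ⟨?_, ?_⟩
      · rw [Nat.mem_primeFactors] at hp ⊢
        exact ⟨hp.1, Dvd.dvd.mul_left hp.2.1 _, by positivity⟩
      · have : a.factorization p = 1 := by omega
        rw [this]; exact ⟨_, rfl⟩
  rw [sqfreePart, hset, Nat.prod_primeFactors_of_squarefree ha]

lemma QForm.disc_mod_four (Q : QForm) : Q.disc % 4 = 0 ∨ Q.disc % 4 = 1 := by
  unfold QForm.disc
  rcases Int.even_or_odd' Q.b with ⟨k, h | h⟩ <;> rw [h]
  · left
    have : (2 * k) ^ 2 - 4 * Q.a * Q.c = 4 * (k ^ 2 - Q.a * Q.c) := by ring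
    rw [this]; omega
  · right
    have : (2 * k + 1) ^ 2 - 4 * Q.a * Q.c = 1 + 4 * (k ^ 2 + k - Q.a * Q.c) := by ring
    rw [this]; omega

/-- The integer division and integer square root defining the conductor are exact here. -/
lemma QForm.disc_eq {Q : QForm} (hQ : Q.IsForm) :
    Q.disc = (Q.fundDisc : ℤ) * (Q.conductor : ℤ) ^ 2 := by
  obtain ⟨-, hpos, -⟩ := hQ
  obtain ⟨a, b, hab, ha⟩ := Nat.sq_mul_squarefree Q.disc.toNat
  have hdisc : ((b ^ 2 * a : ℕ) : ℤ) = Q.disc := by rw [hab]; exact Int.toNat_of_nonneg hpos.le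
  have hb : b ≠ 0 := by
    rintro rfl
    simp at hdisc
    omega
  have ha0 : 0 < a := Nat.pos_of_ne_zero ha.ne_zero
  have hsp : Q.fundDisc = SICAlign.fundDisc a := by
    rw [QForm.fundDisc, ← hab, sqfreePart_eq ha hb]
  have hcond : Q.conductor = Nat.sqrt (b ^ 2 * a / SICAlign.fundDisc a) := by
    rw [QForm.conductor, hsp, hab]
  rw [hcond, hsp, ← hdisc]
  unfold SICAlign.fundDisc
  split_ifs with hmod
  · rw [Nat.mul_div_cancel _ ha0, sq b, Nat.sqrt_eq]
    push_cast; ring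
  -- A discriminant is 0 or 1 modulo 4. If the squarefree part a is 2 or 3 modulo 4, this forces b
  -- even, so Δ is a square times 4a.
  · have hbe : Even b := by
      by_contra hodd
      rw [Nat.not_even_iff_odd] at hodd
      obtain ⟨k, rfl⟩ := hodd
      have h4 : a % 4 ≠ 0 := by
        intro h
        have := ha 2 (Nat.dvd_of_mod_eq_zero h)
        rw [Nat.isUnit_iff] at this
        omega
      have hm := Q.disc_mod_four
      rw [← hdisc] at hm
      have e : (((2 * k + 1) ^ 2 * a : ℕ) : ℤ) = a + 4 * ((k ^ 2 + k) * a) := by push_cast; ring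
      rw [e] at hm
      omega
    obtain ⟨c, rfl⟩ := hbe
    have e : (c + c) ^ 2 * a = c * c * (4 * a) := by ring
    rw [e, Nat.mul_div_cancel _ (by omega), Nat.sqrt_eq]
    push_cast; ring

/-! ### The data of a rank one tuple -/

/-- The arithmetic data of a rank one tuple `(d, 1, Q)`: `x = ε^j` and `F = f_j / f`. -/
structure LevelData (Q : QForm) (d : ℕ) (F : ℤ) (x : ℝ) : Prop where
  isForm : Q.IsForm
  four_le : 4 ≤ d
  one_lt : 1 < x
  add_inv : x + x⁻¹ = d - 1
  sub_inv : x - x⁻¹ = F * √(Q.disc : ℝ)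
  pell : F ^ 2 * Q.disc = ((d : ℤ) - 1) ^ 2 - 4

lemma Tower.levelData {D j : ℕ} {T f : ℤ} {x : ℝ} (h : Tower D j T f x) {Q : QForm}
    (hQ : Q.IsForm) (hfd : Q.fundDisc = fundDisc D) (hdvd : Q.conductor ∣ condSeq D j)
    (hT : 3 ≤ T) : LevelData Q (dimTower D j) ((condSeq D j / Q.conductor : ℕ) : ℤ) x := by
  have hdisc := QForm.disc_eq hQ
  have hpos := hQ.2.1
  obtain ⟨F, hF⟩ := hdvd
  have hc0 : 0 < Q.conductor := by
    rcases Nat.eq_zero_or_pos Q.conductor with h0 | h0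
    · rw [h0] at hdisc; simp at hdisc; omega
    · exact h0
  have hFq : condSeq D j / Q.conductor = F := by rw [hF, Nat.mul_div_cancel_left _ hc0]
  have hfF : f = Q.conductor * F := by rw [← h.condSeq_eq, hF]; push_cast; ring
  have hd := h.dimTower_eq
  have hdr : (dimTower D j : ℝ) = T + 1 := by exact_mod_cast hd
  rw [hFq]
  refine ⟨hQ, by omega, h.one_lt, ?_, ?_, ?_⟩
  · rw [h.add_inv, hdr]; ring
  · have hs : √(Q.disc : ℝ) = √(fundDisc D : ℝ) * Q.conductor := by
      rw [hdisc, hfd]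
      push_cast
      rw [Real.sqrt_mul (Nat.cast_nonneg _), Real.sqrt_sq (Nat.cast_nonneg _)]
    rw [h.sub_inv, hfF, hs]
    push_cast; ring
  · rw [hd, hdisc, hfd]
    have := h.pell
    rw [hfF] at this
    linear_combination -this

/-! ### The stabilizer of a form -/

namespace QForm

variable {Q : QForm}

lemma IsForm.a_ne_zero (hQ : Q.IsForm) : Q.a ≠ 0 := by
  intro h
  refine hQ.2.2 ⟨Q.b, ?_⟩
  rw [QForm.disc, h]; ring

lemma IsForm.irrational_sqrt (hQ : Q.IsForm) : Irrational √(Q.disc : ℝ) := by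
  rw [irrational_sqrt_intCast_iff]
  exact ⟨hQ.2.2, hQ.2.1.le⟩

lemma IsForm.irrational_rootPlus (hQ : Q.IsForm) : Irrational Q.rootPlus := by
  rintro ⟨q, hq⟩
  have ha : (Q.a : ℝ) ≠ 0 := by exact_mod_cast hQ.a_ne_zero
  refine hQ.irrational_sqrt ⟨q * (2 * Q.a) + Q.b, ?_⟩
  push_cast
  rw [hq, rootPlus]
  field_simp
  ring

lemma IsForm.two_a_mul_rootPlus (hQ : Q.IsForm) :
    2 * (Q.a : ℝ) * Q.rootPlus = -Q.b + √(Q.disc : ℝ) := by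
  have ha : (Q.a : ℝ) ≠ 0 := by exact_mod_cast hQ.a_ne_zero
  rw [rootPlus]
  field_simp

lemma IsForm.rootPlus_eq (hQ : Q.IsForm) :
    (Q.a : ℝ) * Q.rootPlus ^ 2 + Q.b * Q.rootPlus + Q.c = 0 := by
  have ha : (Q.a : ℝ) ≠ 0 := by exact_mod_cast hQ.a_ne_zero
  have h1 := hQ.two_a_mul_rootPlus
  have h2 : √(Q.disc : ℝ) ^ 2 = (Q.b : ℝ) ^ 2 - 4 * Q.a * Q.c := by
    rw [Real.sq_sqrt (by exact_mod_cast hQ.2.1.le), disc]; push_cast; ring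
  have h3 : (4 * (Q.a : ℝ)) * (Q.a * Q.rootPlus ^ 2 + Q.b * Q.rootPlus + Q.c) = 0 := by
    linear_combination (2 * Q.a * Q.rootPlus + Q.b + √(Q.disc : ℝ)) * h1 + h2
  rcases mul_eq_zero.1 h3 with h | h
  · exact absurd h (by positivity)
  · exact h

/-- `M` is the automorph of `Q` with second Pell coordinate `u`. -/
def Automorph (Q : QForm) (M : SL(2, ℤ)) (u : ℤ) : Prop :=
  M 1 0 = Q.a * u ∧ M 0 1 = -(Q.c * u) ∧ M 1 1 = M 0 0 + Q.b * u

lemma Automorph.mul {M N : SL(2, ℤ)} {u w : ℤ} (hM : Q.Automorph M u) (hN : Q.Automorph N w) :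
    Q.Automorph (M * N) (u * N 0 0 + M 0 0 * w + Q.b * u * w) := by
  obtain ⟨m1, m2, m3⟩ := hM
  obtain ⟨n1, n2, n3⟩ := hN
  refine ⟨?_, ?_, ?_⟩ <;> simp only [sl_mul, m1, m2, m3, n1, n2, n3] <;> ring

lemma automorph_one : Q.Automorph 1 0 := by simp [Automorph]

lemma sl_inv_entries (M : SL(2, ℤ)) : M⁻¹ 0 0 = M 1 1 ∧ M⁻¹ 0 1 = -M 0 1 ∧ M⁻¹ 1 0 = -M 1 0 ∧
    M⁻¹ 1 1 = M 0 0 := by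
  simp [Matrix.SpecialLinearGroup.coe_inv, Matrix.adjugate_fin_two]

lemma Automorph.inv {M : SL(2, ℤ)} {u : ℤ} (hM : Q.Automorph M u) : Q.Automorph M⁻¹ (-u) := by
  obtain ⟨m1, m2, m3⟩ := hM
  obtain ⟨i0, i1, i2, i3⟩ := sl_inv_entries M
  refine ⟨?_, ?_, ?_⟩
  · rw [i2, m1]; ring
  · rw [i1, m2]; ring
  · rw [i3, i0, m3]; ring

/-- The group of proper automorphs of `Q`. -/
def automorphs (Q : QForm) : Subgroup SL(2, ℤ) where
  carrier := {M | ∃ u, Q.Automorph M u}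
  mul_mem' := fun ⟨_, hM⟩ ⟨_, hN⟩ => ⟨_, hM.mul hN⟩
  one_mem' := ⟨0, automorph_one⟩
  inv_mem' := fun ⟨_, hM⟩ => ⟨_, hM.inv⟩

lemma mem_automorphs {M : SL(2, ℤ)} : M ∈ Q.automorphs ↔ ∃ u, Q.Automorph M u := Iff.rfl

lemma mem_stab_iff_eqs {M : SL(2, ℤ)} : (M : GL (Fin 2) ℤ) ∈ Q.stab ↔
    Q.a * M 0 0 ^ 2 + Q.b * M 0 0 * M 1 0 + Q.c * M 1 0 ^ 2 = Q.a ∧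
    2 * Q.a * M 0 0 * M 0 1 + Q.b * (M 0 0 * M 1 1 + M 0 1 * M 1 0) + 2 * Q.c * M 1 0 * M 1 1
      = Q.b ∧
    Q.a * M 0 1 ^ 2 + Q.b * M 0 1 * M 1 1 + Q.c * M 1 1 ^ 2 = Q.c := by
  have hdet : (M : GL (Fin 2) ℤ).1.det = 1 := M.2
  have hval : (M : GL (Fin 2) ℤ).1 = M.1 := rfl
  rw [stab, Set.mem_ofPred_eq, hdet, hval]
  simp only [Int.cast_one, one_smul]
  rw [← Matrix.ext_iff]
  simp only [Fin.forall_fin_two, Matrix.mul_apply, Fin.sum_univ_two, Matrix.transpose_apply,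
    Matrix.map_apply, toMatrix, Matrix.of_apply, Matrix.cons_val_zero, Matrix.cons_val_one,
    Matrix.cons_val', Matrix.cons_val_fin_one]
  constructor
  · rintro ⟨⟨h1, h2⟩, h3, h4⟩
    refine ⟨?_, ?_, ?_⟩
    · have : (Q.a * M 0 0 ^ 2 + Q.b * M 0 0 * M 1 0 + Q.c * M 1 0 ^ 2 : ℚ) = Q.a := by
        linear_combination h1
      exact_mod_cast this
    · have : (2 * Q.a * M 0 0 * M 0 1 + Q.b * (M 0 0 * M 1 1 + M 0 1 * M 1 0) +
          2 * Q.c * M 1 0 * M 1 1 : ℚ) = Q.b := by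
        linear_combination h2 + h3
      exact_mod_cast this
    · have : (Q.a * M 0 1 ^ 2 + Q.b * M 0 1 * M 1 1 + Q.c * M 1 1 ^ 2 : ℚ) = Q.c := by
        linear_combination h4
      exact_mod_cast this
  · rintro ⟨h1, h2, h3⟩
    have h1' : (Q.a * M 0 0 ^ 2 + Q.b * M 0 0 * M 1 0 + Q.c * M 1 0 ^ 2 : ℚ) = Q.a := by
      exact_mod_cast h1
    have h2' : (2 * Q.a * M 0 0 * M 0 1 + Q.b * (M 0 0 * M 1 1 + M 0 1 * M 1 0) +
        2 * Q.c * M 1 0 * M 1 1 : ℚ) = Q.b := by exact_mod_cast h2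
    have h3' : (Q.a * M 0 1 ^ 2 + Q.b * M 0 1 * M 1 1 + Q.c * M 1 1 ^ 2 : ℚ) = Q.c := by
      exact_mod_cast h3
    refine ⟨⟨?_, ?_⟩, ?_, ?_⟩
    · linear_combination h1'
    · linear_combination h2' / 2
    · linear_combination h2' / 2
    · linear_combination h3'

/-- The stabilizing equations, combined using det M = 1, say that (γ, δ - α, -β) is proportional to
(a, b, c). -/
lemma mem_stab_iff (hQ : Q.IsForm) {M : SL(2, ℤ)} :
    (M : GL (Fin 2) ℤ) ∈ Q.stab ↔ M ∈ Q.automorphs := by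
  have hdet := sl_det M
  rw [mem_stab_iff_eqs, mem_automorphs]
  constructor
  · rintro ⟨h1, h2, h3⟩
    have e1 : Q.a * M 0 1 = -(Q.c * M 1 0) := by
      refine mul_left_cancel₀ (two_ne_zero (α := ℤ)) ?_
      linear_combination M 1 1 * h2 - 2 * M 1 0 * h3 - (2 * Q.a * M 0 1 + Q.b * M 1 1) * hdet
    have e2 : Q.a * (M 1 1 - M 0 0) = Q.b * M 1 0 := by
      refine mul_left_cancel₀ (two_ne_zero (α := ℤ)) ?_
      linear_combination (2 * Q.a * M 0 0 + Q.b * M 1 0) * hdet - 2 * M 1 1 * h1 + M 1 0 * h2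
    have e3 : Q.c * (M 1 1 - M 0 0) = -(Q.b * M 0 1) := by
      refine mul_left_cancel₀ (two_ne_zero (α := ℤ)) ?_
      linear_combination 2 * M 0 0 * h3 - M 0 1 * h2 - (Q.b * M 0 1 + 2 * Q.c * M 1 1) * hdet
    -- Primitivity gives a Bézout relation, which turns the rational proportionality factor into an
    -- explicit integer u.
    obtain ⟨x, y, z, hxyz⟩ : ∃ x y z : ℤ, x * Q.a + y * Q.b + z * Q.c = 1 := by
      have hg := hQ.1
      have g1 := Int.gcd_eq_gcd_ab (Int.gcd Q.a Q.b) Q.c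
      have g2 := Int.gcd_eq_gcd_ab Q.a Q.b
      rw [hg] at g1
      refine ⟨Int.gcdA (Int.gcd Q.a Q.b) Q.c * Int.gcdA Q.a Q.b,
        Int.gcdA (Int.gcd Q.a Q.b) Q.c * Int.gcdB Q.a Q.b,
        Int.gcdB (Int.gcd Q.a Q.b) Q.c, ?_⟩
      push_cast at g1
      linear_combination -g1 - Int.gcdA (Int.gcd Q.a Q.b) Q.c * g2
    refine ⟨x * M 1 0 + y * (M 1 1 - M 0 0) - z * M 0 1, ?_, ?_, ?_⟩
    · linear_combination (-M 1 0) * hxyz - y * e2 + z * e1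
    · linear_combination (-M 0 1) * hxyz + x * e1 + y * e3
    · linear_combination (-(M 1 1 - M 0 0)) * hxyz + x * e2 + z * e3
  · rintro ⟨u, m1, m2, m3⟩
    rw [m1, m2, m3] at hdet ⊢
    refine ⟨?_, ?_, ?_⟩
    · linear_combination Q.a * hdet
    · linear_combination Q.b * hdet
    · linear_combination Q.c * hdet

/-- The eigenvalue `γ ρ + δ` of an automorph. -/
def eigen (Q : QForm) (M : SL(2, ℤ)) : ℝ := (M 1 0 : ℝ) * Q.rootPlus + M 1 1

lemma eigen_one : Q.eigen 1 = 1 := by simp [eigen]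

/-- The vector (ρ, 1) is an eigenvector of every automorph, with eigenvalue γρ + δ. -/
lemma eigen_mul (hQ : Q.IsForm) {M N : SL(2, ℤ)} (hM : M ∈ Q.automorphs) (hN : N ∈ Q.automorphs) :
    Q.eigen (M * N) = Q.eigen M * Q.eigen N := by
  obtain ⟨u, m1, m2, m3⟩ := hM
  obtain ⟨w, n1, n2, n3⟩ := hN
  have h := hQ.rootPlus_eq
  unfold eigen
  rw [sl_mul, sl_mul, m3, n3, m1, n1, n2]
  push_cast
  linear_combination (-(Q.a : ℝ) * u * w) * h

lemma eigen_pos_inv (hQ : Q.IsForm) {M : SL(2, ℤ)} (hM : M ∈ Q.automorphs) :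
    Q.eigen M * Q.eigen M⁻¹ = 1 := by
  rw [← eigen_mul hQ hM (inv_mem hM), mul_inv_cancel, eigen_one]

lemma eigen_ne_zero (hQ : Q.IsForm) {M : SL(2, ℤ)} (hM : M ∈ Q.automorphs) : Q.eigen M ≠ 0 :=
  left_ne_zero_of_mul_eq_one (eigen_pos_inv hQ hM)

lemma eigen_inv (hQ : Q.IsForm) {M : SL(2, ℤ)} (hM : M ∈ Q.automorphs) :
    Q.eigen M⁻¹ = (Q.eigen M)⁻¹ :=
  eq_inv_of_mul_eq_one_right (eigen_pos_inv hQ hM)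

lemma eigen_pow (hQ : Q.IsForm) {M : SL(2, ℤ)} (hM : M ∈ Q.automorphs) (n : ℕ) :
    Q.eigen (M ^ n) = Q.eigen M ^ n := by
  induction n with
  | zero => rw [pow_zero, pow_zero, eigen_one]
  | succ n ih => rw [pow_succ, pow_succ, eigen_mul hQ (pow_mem hM n) hM, ih]

lemma eigen_zpow (hQ : Q.IsForm) {M : SL(2, ℤ)} (hM : M ∈ Q.automorphs) (n : ℤ) :
    Q.eigen (M ^ n) = Q.eigen M ^ n := by
  cases n with
  | ofNat n => simpa using eigen_pow hQ hM n
  | negSucc n =>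
    rw [zpow_negSucc, zpow_negSucc, eigen_inv hQ (pow_mem hM _), eigen_pow hQ hM]

lemma eigen_eq (hQ : Q.IsForm) {M : SL(2, ℤ)} {u : ℤ} (hM : Q.Automorph M u) :
    Q.eigen M = ((M 0 0 + M 1 1 : ℤ) + u * √(Q.disc : ℝ)) / 2 := by
  obtain ⟨m1, m2, m3⟩ := hM
  have h := hQ.two_a_mul_rootPlus
  unfold eigen
  rw [m3, m1]
  push_cast
  linear_combination (u : ℝ) / 2 * h

lemma eigen_inv_eq (hQ : Q.IsForm) {M : SL(2, ℤ)} {u : ℤ} (hM : Q.Automorph M u) :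
    (Q.eigen M)⁻¹ = ((M 0 0 + M 1 1 : ℤ) - u * √(Q.disc : ℝ)) / 2 := by
  rw [← eigen_inv hQ ⟨u, hM⟩, eigen_eq hQ hM.inv]
  obtain ⟨i0, i1, i2, i3⟩ := sl_inv_entries M
  rw [i0, i3]
  push_cast
  ring

/-- The eigenvalue is (tr M + u√Δ)/2 and its inverse is the conjugate; together they recover the
trace and u, hence all entries. -/
lemma eigen_injective (hQ : Q.IsForm) {M N : SL(2, ℤ)} (hM : M ∈ Q.automorphs)
    (hN : N ∈ Q.automorphs) (h : Q.eigen M = Q.eigen N) : M = N := by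
  obtain ⟨u, hu⟩ := hM
  obtain ⟨w, hw⟩ := hN
  have h1 := eigen_eq hQ hu
  have h2 := eigen_eq hQ hw
  have h3 := eigen_inv_eq hQ hu
  have h4 := eigen_inv_eq hQ hw
  rw [h] at h1 h3
  have hs : √(Q.disc : ℝ) ≠ 0 := (Real.sqrt_pos.2 (by exact_mod_cast hQ.2.1)).ne'
  have huw : u = w := by
    have : (u : ℝ) * √(Q.disc : ℝ) = w * √(Q.disc : ℝ) := by linarith
    exact_mod_cast mul_right_cancel₀ hs this
  have htr : M 0 0 + M 1 1 = N 0 0 + N 1 1 := by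
    have : (((M 0 0 + M 1 1 : ℤ)) : ℝ) = ((N 0 0 + N 1 1 : ℤ) : ℝ) := by linarith
    exact_mod_cast this
  obtain ⟨m1, m2, m3⟩ := hu
  obtain ⟨n1, n2, n3⟩ := hw
  subst huw
  have h0 : M 0 0 = N 0 0 := by linarith
  ext i k
  fin_cases i <;> fin_cases k
  · exact h0
  · exact m2.trans n2.symm
  · exact m1.trans n1.symm
  · exact (by rw [m3, n3, h0] : M 1 1 = N 1 1)

lemma moeb_rootPlus (hQ : Q.IsForm) {M : SL(2, ℤ)} (hM : M ∈ Q.automorphs) :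
    moeb M (Q.rootPlus : ℂ) = (Q.rootPlus : ℂ) := by
  have hj : jden M (Q.rootPlus : ℂ) = ((Q.eigen M : ℝ) : ℂ) := by
    unfold jden eigen; push_cast; ring
  have hne : jden M (Q.rootPlus : ℂ) ≠ 0 := by
    rw [hj]; exact_mod_cast eigen_ne_zero hQ hM
  obtain ⟨u, m1, m2, m3⟩ := hM
  have h : (Q.a : ℂ) * (Q.rootPlus : ℂ) ^ 2 + Q.b * (Q.rootPlus : ℂ) + Q.c = 0 := by
    exact_mod_cast congrArg (Complex.ofReal) hQ.rootPlus_eq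
  rw [moeb, div_eq_iff hne]
  unfold jden
  rw [m1, m2, m3]
  push_cast
  linear_combination (-u : ℂ) * h

end QForm

/-! ### The generator of the level `d` stabilizer -/

namespace LevelData

variable {Q : QForm} {d : ℕ} {F : ℤ} {x : ℝ}

/-- The parity that makes the upper left entry 1 + dE of the generator integral; for odd d it
follows from bF being even by the Pell equation. -/
lemma exists_half (h : LevelData Q d F x) :
    ∃ E : ℤ, 2 * E = (d : ℤ) * (d - 3) - Q.b * F * (d - 2) := by
  have hp := h.pell
  rw [QForm.disc] at hp
  have hmod : Even ((d : ℤ) * (d - 3) - Q.b * F * (d - 2)) := by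
    rcases Int.even_or_odd (d : ℤ) with hd | hd
    · refine Even.sub (hd.mul_right _) (Even.mul_left ?_ _)
      exact hd.sub (by norm_num)
    · have hbF : Even (Q.b * F) := by
        have : Even ((Q.b * F) ^ 2) := by
          have e : (Q.b * F) ^ 2 = ((d : ℤ) - 1) ^ 2 + 2 * (2 * (F ^ 2 * Q.a * Q.c - 1)) := by
            linear_combination hp
          rw [e]
          exact ((hd.sub_odd odd_one).pow_of_ne_zero two_ne_zero).add (even_two_mul _)
        exact (Int.even_pow.1 this).1
      refine Even.sub (Even.mul_left ?_ _) (hbF.mul_right _)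
      exact hd.sub_odd (by decide)
  obtain ⟨E, hE⟩ := hmod
  exact ⟨E, by rw [hE]; ring⟩

/-- With T = d - 1, x³ + x⁻³ = T³ - 3T = 2 + d²(d - 3) and x³ - x⁻³ = (x - x⁻¹)(T² - 1) = F√Δ·d(d -
2). These dictate the trace and u, and the resulting matrix is visibly the identity modulo d. -/
lemma exists_generator (h : LevelData Q d F x) : ∃ B : SL(2, ℤ),
    Q.Automorph B (F * d * (d - 2)) ∧ B ∈ CongruenceSubgroup.Gamma d ∧ Q.eigen B = x ^ 3 := by
  obtain ⟨E, hE⟩ := h.exists_half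
  have hp := h.pell
  rw [QForm.disc] at hp
  set u : ℤ := F * d * (d - 2) with hu
  have hdet : (!![1 + d * E, -(Q.c * u); Q.a * u, 1 + d * E + Q.b * u] :
      Matrix (Fin 2) (Fin 2) ℤ).det = 1 := by
    rw [Matrix.det_fin_two_of]
    refine mul_left_cancel₀ (four_ne_zero (α := ℤ)) ?_
    rw [hu]
    linear_combination (-((d : ℤ) * (d - 2)) ^ 2) * hp +
      (4 * d + d ^ 2 * (2 * E + d * (d - 3) - Q.b * F * (d - 2)) +
        2 * Q.b * (F * d * (d - 2)) * d : ℤ) * hE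
  obtain ⟨B, b0, b1, b2, b3⟩ : ∃ B : SL(2, ℤ), B 0 0 = 1 + d * E ∧ B 0 1 = -(Q.c * u) ∧
      B 1 0 = Q.a * u ∧ B 1 1 = 1 + d * E + Q.b * u := ⟨⟨_, hdet⟩, rfl, rfl, rfl, rfl⟩
  have hB : Q.Automorph B u := ⟨b2, b1, by rw [b3, b0]⟩
  refine ⟨B, hB, ?_, ?_⟩
  · rw [CongruenceSubgroup.Gamma_mem, b0, b1, b2, b3]
    have hudz : ((u : ℤ) : ZMod d) = 0 := by rw [hu]; simp
    refine ⟨by simp, ?_, ?_, ?_⟩ <;> push_cast <;> rw [hudz] <;> simp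
  · rw [QForm.eigen_eq h.isForm hB, b0, b3]
    have hx0 : x ≠ 0 := by have := h.one_lt; linarith
    have htr : (1 + d * E) + (1 + d * E + Q.b * u) = 2 + (d : ℤ) ^ 2 * (d - 3) := by
      rw [hu]; linear_combination (d : ℤ) * hE
    rw [htr, hu]
    have ha := h.add_inv
    have hs := h.sub_inv
    have hxx := mul_inv_cancel₀ hx0
    push_cast
    have hd : (d : ℝ) = x + x⁻¹ + 1 := by linarith
    have e : (F : ℝ) * d * (d - 2) * √(Q.disc : ℝ) = d * (d - 2) * (x - x⁻¹) := by
      rw [hs]; ring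
    rw [e, hd]
    generalize x⁻¹ = y at *
    linear_combination (3 * (x + y) + (x - y)) / 2 * hxx

/-- Writing M = I + dN, the condition det M = 1 reads tr N = -d det N after division by d, so the
trace is 2 not merely modulo d but modulo d². -/
lemma trace_eq {M : SL(2, ℤ)} (hM : M ∈ CongruenceSubgroup.Gamma d) :
    ∃ m : ℤ, M 0 0 + M 1 1 = 2 + (d : ℤ) ^ 2 * m := by
  rw [CongruenceSubgroup.Gamma_mem] at hM
  obtain ⟨h1, h2, h3, h4⟩ := hM
  have hdvd : ∀ {k : ℤ} {c : ℤ}, (k : ZMod d) = (c : ZMod d) → ∃ e, k = c + d * e := by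
    intro k c hk
    obtain ⟨e, he⟩ := (ZMod.intCast_eq_intCast_iff_dvd_sub c k d).1 hk.symm
    exact ⟨e, by linarith⟩
  obtain ⟨e1, h1⟩ := hdvd (c := 1) (by simpa using h1)
  obtain ⟨e2, h2⟩ := hdvd (c := 0) (by simpa using h2)
  obtain ⟨e3, h3⟩ := hdvd (c := 0) (by simpa using h3)
  obtain ⟨e4, h4⟩ := hdvd (c := 1) (by simpa using h4)
  have hdet := sl_det M
  rw [h1, h2, h3, h4] at hdet
  exact ⟨-(e1 * e4 - e2 * e3), by rw [h1, h4]; linear_combination hdet⟩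

/-- The bounds give |tr M| ≤ x² + x⁻² = (d - 1)² - 2, which is less than d² - 2; as the trace is 2
modulo d², it must be 2, and then the eigenvalue is 1. Absolute values also dispose of negative
eigenvalues. -/
lemma eq_one_of_eigen_small (h : LevelData Q d F x) {M : SL(2, ℤ)} (hM : M ∈ Q.automorphs)
    (hG : M ∈ CongruenceSubgroup.Gamma d) (h1 : |Q.eigen M| ≤ x ^ 2)
    (h2 : (x ^ 2)⁻¹ ≤ |Q.eigen M|) : M = 1 := by
  have hx1 := h.one_lt
  have hx0 : x ≠ 0 := by linarith
  have hv0 := QForm.eigen_ne_zero h.isForm hM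
  have hv : 0 < |Q.eigen M| := abs_pos.2 hv0
  obtain ⟨u, hu⟩ := hM
  have e1 := QForm.eigen_eq h.isForm hu
  have e2 := QForm.eigen_inv_eq h.isForm hu
  have htr : |((M 0 0 + M 1 1 : ℤ) : ℝ)| ≤ x ^ 2 + (x ^ 2)⁻¹ := by
    have e3 : ((M 0 0 + M 1 1 : ℤ) : ℝ) = Q.eigen M + (Q.eigen M)⁻¹ := by rw [e2]; linarith
    rw [e3]
    refine (abs_add_le _ _).trans ?_
    rw [abs_inv]
    generalize |Q.eigen M| = w at *
    have h4 : (w - x ^ 2) * (w - (x ^ 2)⁻¹) ≤ 0 :=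
      mul_nonpos_of_nonpos_of_nonneg (by linarith) (by linarith)
    have h5 : x ^ 2 * (x ^ 2)⁻¹ = 1 := mul_inv_cancel₀ (pow_ne_zero 2 hx0)
    have h6 : w * (w + w⁻¹ - (x ^ 2 + (x ^ 2)⁻¹)) ≤ 0 := by
      have : w * w⁻¹ = 1 := mul_inv_cancel₀ hv.ne'
      nlinarith
    have := nonpos_of_mul_nonpos_right h6 hv
    linarith
  have hV2 : x ^ 2 + (x ^ 2)⁻¹ = ((d : ℝ) - 1) ^ 2 - 2 := by
    have := mul_inv_cancel₀ hx0
    rw [← h.add_inv, ← inv_pow]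
    linear_combination -2 * this
  rw [hV2] at htr
  have htrZ : |M 0 0 + M 1 1| ≤ ((d : ℤ) - 1) ^ 2 - 2 := by exact_mod_cast htr
  obtain ⟨m, hm⟩ := trace_eq hG
  have hd4 : (4 : ℤ) ≤ d := by exact_mod_cast h.four_le
  have hm0 : m = 0 := by
    rw [hm, abs_le] at htrZ
    obtain ⟨l1, l2⟩ := htrZ
    rcases lt_trichotomy m 0 with hlt | heq | hgt
    · nlinarith [mul_le_mul_of_nonneg_left (show m ≤ -1 by omega) (sq_nonneg (d : ℤ))]
    · exact heq
    · nlinarith [mul_le_mul_of_nonneg_left (show 1 ≤ m by omega) (sq_nonneg (d : ℤ))]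
  rw [hm0, mul_zero, add_zero] at hm
  refine QForm.eigen_injective h.isForm ⟨u, hu⟩ (one_mem _) ?_
  rw [QForm.eigen_one]
  have hsum : Q.eigen M + (Q.eigen M)⁻¹ = 2 := by
    rw [e2, e1, hm]; push_cast; ring
  have : (Q.eigen M - 1) ^ 2 = 0 := by
    have := mul_inv_cancel₀ hv0
    linear_combination (Q.eigen M) * hsum - this
  have := pow_eq_zero_iff two_ne_zero |>.1 this
  linarith

lemma mem_stabLevel (h : LevelData Q d F x) {M : SL(2, ℤ)} :
    M ∈ Q.stabLevel d ↔ M ∈ CongruenceSubgroup.Gamma d ∧ M ∈ Q.automorphs := by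
  rw [QForm.stabLevel, Set.mem_ofPred_eq, QForm.mem_stab_iff h.isForm]

lemma zpowers_generator (h : LevelData Q d F x) {B : SL(2, ℤ)} (hB : B ∈ Q.automorphs)
    (hBG : B ∈ CongruenceSubgroup.Gamma d) (hBx : Q.eigen B = x ^ 3) :
    (Subgroup.zpowers B : Set SL(2, ℤ)) = Q.stabLevel d := by
  have hx1 := h.one_lt
  have hx0 : 0 < x := by linarith
  ext M
  rw [h.mem_stabLevel, SetLike.mem_coe, Subgroup.mem_zpowers_iff]
  constructor
  · rintro ⟨k, rfl⟩
    exact ⟨zpow_mem hBG k, zpow_mem hB k⟩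
  · rintro ⟨hG, hM⟩
    have hv : 0 < |Q.eigen M| := abs_pos.2 (QForm.eigen_ne_zero h.isForm hM)
    have hx3 : 1 < x ^ 3 := one_lt_pow₀ hx1 (by norm_num)
    obtain ⟨k, hk1, hk2⟩ := exists_mem_Ico_zpow hv hx3
    have hred : ∀ l : ℤ, (x ^ 2)⁻¹ ≤ |Q.eigen M| * ((x ^ 3) ^ l)⁻¹ →
        |Q.eigen M| * ((x ^ 3) ^ l)⁻¹ ≤ x ^ 2 → ∃ k : ℤ, B ^ k = M := by
      intro l l1 l2
      have hN : M * (B ^ l)⁻¹ ∈ Q.automorphs := mul_mem hM (inv_mem (zpow_mem hB l))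
      have hval : |Q.eigen (M * (B ^ l)⁻¹)| = |Q.eigen M| * ((x ^ 3) ^ l)⁻¹ := by
        rw [QForm.eigen_mul h.isForm hM (inv_mem (zpow_mem hB l)),
          QForm.eigen_inv h.isForm (zpow_mem hB l), QForm.eigen_zpow h.isForm hB, hBx, abs_mul,
          abs_of_pos (inv_pos.2 (zpow_pos (pow_pos hx0 3) l))]
      have h1 := h.eq_one_of_eigen_small hN (mul_mem hG (inv_mem (zpow_mem hBG l)))
        (by rw [hval]; exact l2) (by rw [hval]; exact l1)
      exact ⟨l, (mul_inv_eq_one.1 h1).symm⟩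
    have hp : 0 < (x ^ 3) ^ k := zpow_pos (pow_pos hx0 3) k
    have hx2inv : (x ^ 2)⁻¹ ≤ 1 := inv_le_one_of_one_le₀ (one_le_pow₀ hx1.le)
    -- After division by (x³)^k the modulus lies in [1, x³). If it exceeds x², one further division
    -- by x³ brings it into (x⁻¹, 1), which is again within the range [x⁻², x²] of the rigidity
    -- lemma.
    by_cases hle : |Q.eigen M| * ((x ^ 3) ^ k)⁻¹ ≤ x ^ 2
    · refine hred k ?_ hle
      refine hx2inv.trans ?_
      rw [← div_eq_mul_inv, one_le_div hp]
      exact hk1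
    · push Not at hle
      have e : |Q.eigen M| * ((x ^ 3) ^ (k + 1))⁻¹ = |Q.eigen M| * ((x ^ 3) ^ k)⁻¹ * (x ^ 3)⁻¹ := by
        rw [zpow_add_one₀ (pow_pos hx0 3).ne', mul_inv, mul_assoc]
      refine hred (k + 1) ?_ ?_
      · rw [e]
        have h3 : x ^ 2 * (x ^ 3)⁻¹ ≤ |Q.eigen M| * ((x ^ 3) ^ k)⁻¹ * (x ^ 3)⁻¹ :=
          mul_le_mul_of_nonneg_right hle.le (by positivity)
        refine le_trans ?_ h3
        have e1 : x ^ 2 * (x ^ 3)⁻¹ = x⁻¹ := by field_simp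
        rw [e1]
        exact inv_anti₀ hx0 (by nlinarith)
      · refine le_trans ?_ (one_le_pow₀ hx1.le : (1 : ℝ) ≤ x ^ 2)
        rw [← div_eq_mul_inv, div_le_one (zpow_pos (pow_pos hx0 3) _)]
        exact hk2.le

lemma eigen_pow_signs (hQ : Q.IsForm) {M : SL(2, ℤ)} (hM : M ∈ Q.automorphs)
    (h1 : 1 < Q.eigen M) : (M 1 0).sign = Q.a.sign ∧ M 1 0 ≠ 0 ∧ 0 < M 0 0 + M 1 1 := by
  obtain ⟨u, hu⟩ := hM
  have e1 := QForm.eigen_eq hQ hu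
  have e2 := QForm.eigen_inv_eq hQ hu
  have hi0 : 0 < (Q.eigen M)⁻¹ := inv_pos.2 (by linarith)
  have hi1 : (Q.eigen M)⁻¹ < 1 := inv_lt_one_of_one_lt₀ h1
  have hu0 : 0 < u := by
    have hpos : 0 < (u : ℝ) * √(Q.disc : ℝ) := by linarith
    by_contra hneg
    have h3 : (u : ℝ) ≤ 0 := by exact_mod_cast not_lt.1 hneg
    have := mul_nonneg (neg_nonneg.2 h3) (Real.sqrt_nonneg (Q.disc : ℝ))
    linarith
  refine ⟨?_, ?_, ?_⟩
  · rw [hu.1, Int.sign_mul, Int.sign_eq_one_of_pos hu0, mul_one]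
  · rw [hu.1]; exact mul_ne_zero hQ.a_ne_zero hu0.ne'
  · have : (0 : ℝ) < ((M 0 0 + M 1 1 : ℤ) : ℝ) := by linarith
    exact_mod_cast this

/-- The associated stabilizer is the automorph with eigenvalue `x³`. -/
theorem assocStab_spec (h : LevelData Q d F x) : assocStab d Q ∈ Q.automorphs ∧
    assocStab d Q ∈ CongruenceSubgroup.Gamma d ∧ Q.eigen (assocStab d Q) = x ^ 3 := by
  obtain ⟨B, hBu, hBG, hBx⟩ := h.exists_generator
  have hB : B ∈ Q.automorphs := ⟨_, hBu⟩
  have hz := h.zpowers_generator hB hBG hBx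
  have hx3 : 1 < x ^ 3 := one_lt_pow₀ h.one_lt (by norm_num)
  have hs := eigen_pow_signs h.isForm hB (by rw [hBx]; exact hx3)
  have hex : ∃ A : SL(2, ℤ), (Subgroup.zpowers A : Set SL(2, ℤ)) = Q.stabLevel d ∧
      matSign A = Q.a.sign := ⟨B, hz, by rw [matSign, if_neg hs.2.1]; exact hs.1⟩
  obtain ⟨hA1, hA2⟩ := Classical.epsilon_spec hex
  change (Subgroup.zpowers (assocStab d Q) : Set SL(2, ℤ)) = Q.stabLevel d at hA1
  change matSign (assocStab d Q) = Q.a.sign at hA2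
  -- Two generators of the same infinite cyclic group are equal or mutually inverse; inversion
  -- negates the lower left entry, so the sign condition selects B.
  suffices hAB : assocStab d Q = B by rw [hAB]; exact ⟨hB, hBG, hBx⟩
  generalize assocStab d Q = A at *
  have hA : A ∈ Q.stabLevel d := by
    rw [← hA1]; exact Subgroup.mem_zpowers A
  have hBmem : B ∈ Q.stabLevel d := by
    rw [← hz]; exact Subgroup.mem_zpowers B
  rw [← hz, SetLike.mem_coe, Subgroup.mem_zpowers_iff] at hA
  rw [← hA1, SetLike.mem_coe, Subgroup.mem_zpowers_iff] at hBmem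
  obtain ⟨k, hk⟩ := hA
  obtain ⟨l, hl⟩ := hBmem
  have hkl : k * l = 1 := by
    have h1 : Q.eigen (B ^ (k * l)) = Q.eigen (B ^ (1 : ℤ)) := by
      rw [zpow_mul, hk, hl, zpow_one]
    rw [QForm.eigen_zpow h.isForm hB, QForm.eigen_zpow h.isForm hB, hBx] at h1
    exact zpow_right_injective₀ (by linarith) hx3.ne' h1
  rcases Int.eq_one_or_neg_one_of_mul_eq_one hkl with hk1 | hk1
  · rw [← hk, hk1, zpow_one]
  · exfalso
    rw [hk1, zpow_neg_one] at hk
    have e : A 1 0 = -B 1 0 := by rw [← hk]; exact (QForm.sl_inv_entries B).2.2.1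
    have hne : A 1 0 ≠ 0 := by rw [e]; exact neg_ne_zero.2 hs.2.1
    rw [matSign, if_neg hne, e, Int.sign_neg, hs.1] at hA2
    have := Int.sign_eq_zero_iff_zero.1 (by omega : Q.a.sign = 0)
    exact h.isForm.a_ne_zero this

/-- The associated stabilizers of a tower are powers of one another. -/
theorem assocStab_pow (h : LevelData Q d F x) {d' : ℕ} {F' : ℤ} {n : ℕ}
    (h' : LevelData Q d' F' (x ^ n)) : assocStab d' Q = assocStab d Q ^ n := by
  obtain ⟨h1, -, h2⟩ := h.assocStab_spec
  obtain ⟨h1', -, h2'⟩ := h'.assocStab_spec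
  refine QForm.eigen_injective h.isForm h1' (pow_mem h1 n) ?_
  rw [h2', QForm.eigen_pow h.isForm h1, h2]
  ring

theorem rademacher_assocStab_pow (h : LevelData Q d F x) {n : ℕ} (hn : 0 < n) :
    rademacher (assocStab d Q ^ n) = n * rademacher (assocStab d Q) := by
  obtain ⟨h1, -, h2⟩ := h.assocStab_spec
  have hk : ∀ k : ℕ, 0 < k → 1 < Q.eigen (assocStab d Q ^ k) := by
    intro k hk
    rw [QForm.eigen_pow h.isForm h1, h2, ← pow_mul]
    exact one_lt_pow₀ h.one_lt (by omega)
  exact rademacher_pow (e := Q.a.sign)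
    (fun k hk0 => (eigen_pow_signs h.isForm (pow_mem h1 k) (hk k hk0)).1)
    (fun k hk0 => (eigen_pow_signs h.isForm (pow_mem h1 k) (hk k hk0)).2.2) hn

end LevelData

/-! ### Roots of unity -/

lemma neg_one_zpow_congr {a b : ℤ} (h : Even (a - b)) : (-1 : ℂ) ^ a = (-1 : ℂ) ^ b := by
  have e : a = b + (a - b) := by ring
  rw [e, zpow_add₀ (by norm_num), h.neg_one_zpow, mul_one]

lemma xi_ne_zero (d : ℕ) : xi d ≠ 0 := neg_ne_zero.2 (Complex.exp_ne_zero _)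

lemma xi_zpow_self {d : ℕ} (hd : d ≠ 0) : xi d ^ (d : ℤ) = (-1 : ℂ) ^ ((d : ℤ) + 1) := by
  have hd' : (d : ℂ) ≠ 0 := by exact_mod_cast hd
  rw [xi, zpow_natCast, neg_pow, ← Complex.exp_nat_mul, mul_div_cancel₀ _ hd', Complex.exp_pi_mul_I,
    zpow_add_one₀ (by norm_num), zpow_natCast]

/-- Exponents of ξ_d may be reduced modulo d at the price of a sign, which is present only for even
d. -/
lemma xi_zpow_add_mul {d : ℕ} (hd : d ≠ 0) (a e : ℤ) :
    xi d ^ (a + d * e) = xi d ^ a * (-1 : ℂ) ^ (((d : ℤ) + 1) * e) := by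
  rw [zpow_add₀ (xi_ne_zero d), zpow_mul, xi_zpow_self hd, ← zpow_mul]

lemma xi_mul_zpow {d κ : ℕ} (hd : d ≠ 0) (hκ : κ ≠ 0) :
    xi (d * κ) ^ (κ : ℤ) = (-1 : ℂ) ^ ((κ : ℤ) + 1) * xi d := by
  have hd' : (d : ℂ) ≠ 0 := by exact_mod_cast hd
  have hκ' : (κ : ℂ) ≠ 0 := by exact_mod_cast hκ
  have e : (κ : ℂ) * (Real.pi * Complex.I / ((d * κ : ℕ) : ℂ)) = Real.pi * Complex.I / d := by
    push_cast; field_simp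
  rw [xi, zpow_natCast, neg_pow, ← Complex.exp_nat_mul, e, zpow_add_one₀ (by norm_num),
    zpow_natCast, xi]
  ring

lemma xi_sq (d : ℕ) : xi d ^ (2 : ℤ) = omega d := by
  rw [xi, omega]
  have : (-Complex.exp (Real.pi * Complex.I / d)) ^ (2 : ℤ) =
      Complex.exp (Real.pi * Complex.I / d) * Complex.exp (Real.pi * Complex.I / d) := by
    rw [show (2 : ℤ) = ((2 : ℕ) : ℤ) from rfl, zpow_natCast]; ring
  rw [this, ← Complex.exp_add]
  congr 1
  ring

lemma dbar_ne_zero {d : ℕ} (hd : d ≠ 0) : dbar d ≠ 0 := by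
  unfold dbar; split_ifs <;> omega

/-- ξ_d = exp(2πi(d + 1)/(2d)): for even d the number d + 1 is prime to 2d, while for odd d = 2k + 1
it is exp(2πi(k + 1)/d) with k + 1 prime to d. -/
lemma isPrimitiveRoot_xi {d : ℕ} (hd : d ≠ 0) : IsPrimitiveRoot (xi d) (dbar d) := by
  have hd' : (d : ℂ) ≠ 0 := by exact_mod_cast hd
  have hxi : xi d = Complex.exp (Real.pi * Complex.I / d + Real.pi * Complex.I) := by
    rw [xi, Complex.exp_add, Complex.exp_pi_mul_I]; ring
  unfold dbar
  split_ifs with he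
  · have hc : Nat.Coprime (d + 1) (2 * d) := by
      rw [Nat.coprime_mul_iff_right]
      refine ⟨?_, by simp⟩
      rw [Nat.coprime_two_right]
      exact he.add_one
    have := Complex.isPrimitiveRoot_exp_of_coprime (d + 1) (2 * d) (by omega) hc
    convert this using 1
    rw [hxi]
    congr 1
    push_cast
    field_simp
    ring
  · rw [Nat.not_even_iff_odd] at he
    obtain ⟨k, hk⟩ := he
    have hc : Nat.Coprime (k + 1) d := by
      have h2 : Nat.Coprime (2 * (k + 1)) d := by
        rw [show 2 * (k + 1) = d + 1 by omega]; simp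
      exact Nat.Coprime.coprime_dvd_left (Dvd.intro_left 2 rfl) h2
    have := Complex.isPrimitiveRoot_exp_of_coprime (k + 1) d hd hc
    convert this using 1
    rw [hxi]
    congr 1
    have hk' : (d : ℂ) = 2 * k + 1 := by exact_mod_cast hk
    rw [hk'] at hd' ⊢
    push_cast
    field_simp
    ring

/-! ### Normalized ghost overlaps in rank one -/

/-- The normalized ghost overlaps of a rank one tuple, in terms of `d`, `Q` and `F = f_j / f`. -/
def ghostNu (Q : QForm) (d : ℕ) (F : ℤ) (p : Fin 2 → ℤ) : ℂ :=
  (-1 : ℂ) ^ ((d : ℤ) + (1 + (d : ℤ)) * (1 + p 0) * (1 + p 1))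
    * Complex.exp (-(Real.pi * Complex.I / 12) * (rademacher (assocStab d Q) : ℂ))
    * xi d ^ (-(F * Q.eval p))
    * sfModular (fun i => (p i : ℚ) / (d : ℚ)) (assocStab d Q) (Q.rootPlus : ℂ)

lemma normGhostOverlap_rankOne (D j : ℕ) (Q : QForm) (p : Fin 2 → ℤ) :
    (rankOneTuple D j Q).normGhostOverlap p =
      ghostNu Q (dimTower D j) ((condSeq D j / Q.conductor : ℕ) : ℤ) p := by
  unfold QTuple.normGhostOverlap QTuple.sfPhase ghostNu
  simp only [rankOneTuple, mul_one]
  rfl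

namespace LevelData

variable {Q : QForm} {d : ℕ} {F : ℤ} {x : ℝ}

lemma d_ne_zero (h : LevelData Q d F x) : d ≠ 0 := by have := h.four_le; omega

/-- If `d` is even then `F` and the coefficients of `Q` are odd. -/
lemma odd_coeffs (h : LevelData Q d F x) (hd : Even d) :
    Odd F ∧ Odd Q.a ∧ Odd Q.b ∧ Odd Q.c := by
  have hp := h.pell
  obtain ⟨e, he⟩ := hd
  have hodd : Odd (F ^ 2 * Q.disc) := by
    rw [hp, he]
    exact ⟨2 * e ^ 2 - 2 * e - 2, by push_cast; ring⟩
  rw [Int.odd_mul] at hodd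
  obtain ⟨hF2, hdisc⟩ := hodd
  have hF : Odd F := (Int.odd_pow' two_ne_zero).1 hF2
  have hb : Odd Q.b := by
    have : Odd (Q.b ^ 2) := by
      have e : Q.b ^ 2 = Q.disc + 2 * (2 * Q.a * Q.c) := by rw [QForm.disc]; ring
      rw [e]; exact hdisc.add_even (even_two_mul _)
    exact (Int.odd_pow' two_ne_zero).1 this
  have hac : Odd (Q.a * Q.c) := by
    by_contra hne
    rw [Int.not_odd_iff_even] at hne
    obtain ⟨k, hk⟩ := hne
    -- Odd squares are 1 modulo 8, so the Pell equation gives Δ ≡ 5 mod 8, which excludes even ac.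
    have h8 : ∀ m : ℤ, Odd m → ∃ r, m ^ 2 = 1 + 8 * r := by
      rintro m ⟨s, rfl⟩
      obtain ⟨r, hr⟩ := Int.even_mul_succ_self s
      exact ⟨r, by linear_combination 4 * hr⟩
    obtain ⟨r1, h1⟩ := h8 F hF
    obtain ⟨r2, h2⟩ := h8 Q.b hb
    obtain ⟨r3, h3⟩ := h8 ((d : ℤ) - 1) ⟨e - 1, by rw [he]; push_cast; ring⟩
    rw [QForm.disc, h3, h1, h2] at hp
    have : (1 + 8 * r1) * (1 + 8 * r2 - 4 * Q.a * Q.c) =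
        1 + 8 * (r2 + r1 + 8 * r1 * r2 - k - 8 * r1 * k) := by
      linear_combination (-4 * (1 + 8 * r1)) * hk
    omega
  rw [Int.odd_mul] at hac
  exact ⟨hF, hac.1, hb, hac.2⟩

lemma nonIntegral_of_not_zeroMod (h : LevelData Q d F x) {p : Fin 2 → ℤ} (hp : ¬ VecZeroMod d p) :
    NonIntegral fun i => (p i : ℚ) / (d : ℚ) := by
  rintro ⟨N, hN⟩
  refine hp fun i => ⟨N i, ?_⟩
  have hd : (d : ℚ) ≠ 0 := by exact_mod_cast h.d_ne_zero
  have := hN i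
  rw [div_eq_iff hd] at this
  have h2 : p i = N i * d := by exact_mod_cast this
  rw [h2, mul_comm]

lemma fixesMod_of_mem_Gamma (h : LevelData Q d F x) {A : SL(2, ℤ)}
    (hA : A ∈ CongruenceSubgroup.Gamma d) (p : Fin 2 → ℤ) :
    FixesMod A fun i => (p i : ℚ) / (d : ℚ) := by
  rw [CongruenceSubgroup.Gamma_mem] at hA
  obtain ⟨h1, h2, h3, h4⟩ := hA
  have hd : (d : ℚ) ≠ 0 := by exact_mod_cast h.d_ne_zero
  have hdvd : ∀ {k : ℤ} {c : ℤ}, (k : ZMod d) = (c : ZMod d) → ∃ e, k = c + d * e := by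
    intro k c hk
    obtain ⟨e, he⟩ := (ZMod.intCast_eq_intCast_iff_dvd_sub c k d).1 hk.symm
    exact ⟨e, by linarith⟩
  obtain ⟨e1, h1⟩ := hdvd (c := 1) (by simpa using h1)
  obtain ⟨e2, h2⟩ := hdvd (c := 0) (by simpa using h2)
  obtain ⟨e3, h3⟩ := hdvd (c := 0) (by simpa using h3)
  obtain ⟨e4, h4⟩ := hdvd (c := 1) (by simpa using h4)
  refine ⟨![e1 * p 0 + e2 * p 1, e3 * p 0 + e4 * p 1], fun i => ?_⟩
  fin_cases i
  · simp only [Fin.zero_eta, Matrix.cons_val_zero]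
    rw [h1, h2]
    push_cast
    field_simp
    ring
  · simp only [Fin.mk_one, Matrix.cons_val_one, Matrix.cons_val_fin_one]
    rw [h3, h4]
    push_cast
    field_simp
    ring

lemma eigen_assocStab_pos (h : LevelData Q d F x) :
    0 < ((assocStab d Q) 1 0 : ℝ) * Q.rootPlus + (assocStab d Q) 1 1 := by
  have := h.assocStab_spec.2.2
  rw [QForm.eigen] at this
  rw [this]
  have := h.one_lt
  positivity

/-- Quasi-periodicity of the ghost overlaps. -/
theorem ghostNu_add (h : LevelData Q d F x) {p : Fin 2 → ℤ} (hp : ¬ VecZeroMod d p)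
    (q : Fin 2 → ℤ) : ghostNu Q d F (fun i => p i + d * q i) =
      (-1 : ℂ) ^ (((d : ℤ) + 1) * (p 0 * q 1 + p 1 * q 0)) * ghostNu Q d F p := by
  obtain ⟨hA1, hA2, -⟩ := h.assocStab_spec
  have hd : (d : ℚ) ≠ 0 := by exact_mod_cast h.d_ne_zero
  have hsf := sfModular_add_int (h.nonIntegral_of_not_zeroMod hp) h.isForm.irrational_rootPlus
    h.eigen_assocStab_pos (h.fixesMod_of_mem_Gamma hA2 p) (QForm.moeb_rootPlus h.isForm hA1) q
  have hvec : (fun i => ((p i + d * q i : ℤ) : ℚ) / (d : ℚ)) = fun i => (p i : ℚ) / d + q i := by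
    funext i; push_cast; field_simp
  unfold ghostNu
  rw [hvec, hsf]
  have hev : -(F * Q.eval fun i => p i + d * q i) = -(F * Q.eval p) + d * (-(F *
      (2 * (Q.a * p 0 * q 0 + Q.c * p 1 * q 1) + Q.b * (p 0 * q 1 + p 1 * q 0) + d * Q.eval q))) := by
    unfold QForm.eval; ring
  rw [hev, xi_zpow_add_mul h.d_ne_zero]
  set m := p 0 * q 1 + p 1 * q 0 with hm
  have hsign : (-1 : ℂ) ^ ((d : ℤ) + (1 + d) * (1 + (p 0 + d * q 0)) * (1 + (p 1 + d * q 1))) *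
      (-1 : ℂ) ^ (((d : ℤ) + 1) * (-(F *
      (2 * (Q.a * p 0 * q 0 + Q.c * p 1 * q 1) + Q.b * m + d * Q.eval q)))) =
      (-1 : ℂ) ^ (((d : ℤ) + 1) * m) * (-1 : ℂ) ^ ((d : ℤ) + (1 + d) * (1 + p 0) * (1 + p 1)) := by
    rw [← zpow_add₀ (by norm_num), ← zpow_add₀ (by norm_num)]
    refine neg_one_zpow_congr ?_
    rcases Nat.even_or_odd d with he | ho
    · obtain ⟨⟨f, hf⟩, -, ⟨b, hb⟩, -⟩ := h.odd_coeffs he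
      obtain ⟨e, he⟩ := he
      have he' : (d : ℤ) = 2 * e := by rw [he]; push_cast; ring
      rw [hf, hb, he']
      refine ⟨(1 + 2 * e) * (e * q 0 * (1 + p 1) + e * q 1 * (1 + p 0) + 2 * e ^ 2 * q 0 * q 1) -
        (2 * e + 1) * ((2 * f + 1) * (Q.a * p 0 * q 0 + Q.c * p 1 * q 1 + e * Q.eval q) +
          (2 * f * b + f + b + 1) * m), ?_⟩
      ring
    · obtain ⟨e, he⟩ := ho
      have he' : (d : ℤ) + 1 = 2 * (e + 1) := by rw [he]; push_cast; ring
      refine ⟨(e + 1) * ((1 + (p 0 + d * q 0)) * (1 + (p 1 + d * q 1)) - (F *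
      (2 * (Q.a * p 0 * q 0 + Q.c * p 1 * q 1) + Q.b * m + d * Q.eval q)) - m -
        (1 + p 0) * (1 + p 1)), ?_⟩
      linear_combination ((1 + (p 0 + d * q 0)) * (1 + (p 1 + d * q 1)) - (F *
      (2 * (Q.a * p 0 * q 0 + Q.c * p 1 * q 1) + Q.b * m + d * Q.eval q)) - m -
        (1 + p 0) * (1 + p 1)) * he'
  linear_combination (Complex.exp (-(Real.pi * Complex.I / 12) * (rademacher (assocStab d Q) : ℂ))
    * xi d ^ (-(F * Q.eval p))
    * sfModular (fun i => (p i : ℚ) / (d : ℚ)) (assocStab d Q) (Q.rootPlus : ℂ)) * hsign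

/-- With all coefficients odd, FQ(p) has the parity of p₁² + p₁p₂ + p₂², which is odd unless p ≡ 0
mod 2. -/
lemma eval_parity (h : LevelData Q d F x) (hd : Even d) (p : Fin 2 → ℤ) :
    ∃ w, F * Q.eval p = 1 + (1 + p 0) * (1 + p 1) + 2 * w := by
  obtain ⟨⟨f, hf⟩, ⟨a, ha⟩, ⟨b, hb⟩, ⟨c, hc⟩⟩ := h.odd_coeffs hd
  obtain ⟨u, hu⟩ := Int.even_mul_succ_self (p 0)
  obtain ⟨v, hv⟩ := Int.even_mul_succ_self (p 1)
  refine ⟨f * Q.eval p + a * p 0 ^ 2 + b * p 0 * p 1 + c * p 1 ^ 2 + u - p 0 + v - p 1 - 1, ?_⟩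
  unfold QForm.eval
  rw [hf, ha, hb, hc]
  linear_combination hu + hv

/-- Parity bookkeeping for the tower relation: phase sign at the upper level plus the sign from
reducing the exponent of ξ_d, compared with ℓ(p) plus n times the phase sign at the lower level. -/
lemma even_sign_of_not_even {d κ n e : ℤ} (hd : Even d) (hκ : Even κ ↔ Even n) (he : ¬ Even e)
    (z w p q : ℤ) : Even (d * κ + (1 + d * κ) * (1 + κ * p) * (1 + κ * q) +
      (d + 1) * (-((e + 2 * z) * (1 + (1 + p) * (1 + q) + 2 * w))) -
      (n + (1 + p) * (1 + q) + n * (d + (1 + d) * (1 + p) * (1 + q)))) := by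
  by_cases h1 : Even p <;> by_cases h2 : Even q <;> by_cases h3 : Even n <;>
    simp [Int.even_add, Int.even_sub, Int.even_mul, hd, hκ, he, h1, h2, h3]

lemma even_sign_of_even {d κ n e : ℤ} (hd : Even d) (hκ : Even κ ↔ Even n) (he : Even e)
    (z w p q : ℤ) : Even (d * κ + (1 + d * κ) * (1 + κ * p) * (1 + κ * q) +
      (d + 1) * (-((e + 2 * z) * (1 + (1 + p) * (1 + q) + 2 * w))) -
      (n + 1 + n * (d + (1 + d) * (1 + p) * (1 + q)))) := by
  by_cases h1 : Even p <;> by_cases h2 : Even q <;> by_cases h3 : Even n <;>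
    simp [Int.even_add, Int.even_sub, Int.even_mul, hd, hκ, he, h1, h2, h3] <;>
    exact Int.not_even_iff_odd.1 h3

/-- The relation between the ghost overlaps of two levels of a tower. -/
theorem ghostNu_mul (h : LevelData Q d F x) {n κ : ℕ} (hn : 0 < n) (hn3 : Nat.Coprime n 3)
    (hκ : (d : ℤ) * κ = lucV ((d : ℤ) - 1) n + 1)
    (h' : LevelData Q (d * κ) (F * lucU ((d : ℤ) - 1) n) (x ^ n))
    {p : Fin 2 → ℤ} (hp : ¬ VecZeroMod d p) :
    ghostNu Q (d * κ) (F * lucU ((d : ℤ) - 1) n) (fun i => κ * p i) =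
      (-1 : ℂ) ^ signExp d n p * ghostNu Q d F p ^ n := by
  obtain ⟨hA1, hA2, -⟩ := h.assocStab_spec
  have hd0 := h.d_ne_zero
  have hκ0 : κ ≠ 0 := by
    rintro rfl
    exact h'.d_ne_zero (by simp)
  have hdz : (d : ℤ) ≠ 0 := by exact_mod_cast hd0
  have hsf := sfModular_pow (h.nonIntegral_of_not_zeroMod hp) h.isForm.irrational_rootPlus
    h.eigen_assocStab_pos (h.fixesMod_of_mem_Gamma hA2 p) (QForm.moeb_rootPlus h.isForm hA1) n
  have hvec : (fun i => ((κ * p i : ℤ) : ℚ) / ((d * κ : ℕ) : ℚ)) = fun i => (p i : ℚ) / d := by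
    have h1 : (d : ℚ) ≠ 0 := by exact_mod_cast hd0
    have h2 : (κ : ℚ) ≠ 0 := by exact_mod_cast hκ0
    funext i; push_cast; field_simp
  unfold ghostNu
  rw [h.assocStab_pow h', hvec, hsf, h.rademacher_assocStab_pow hn]
  have hexp : Complex.exp (-(Real.pi * Complex.I / 12) *
      (((n : ℚ) * rademacher (assocStab d Q) : ℚ) : ℂ)) =
      Complex.exp (-(Real.pi * Complex.I / 12) * (rademacher (assocStab d Q) : ℂ)) ^ n := by
    rw [← Complex.exp_nat_mul]; congr 1; push_cast; ring
  rw [hexp]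
  set r := lucU ((d : ℤ) - 1) n with hr
  -- Q(κp) = κ²Q(p), so a factor κ of the exponent converts ξ_{dκ} into (-1)^{κ+1}ξ_d. The remaining
  -- factor κ makes the total sign trivial, κ(κ + 1) being even.
  have hxi : xi (d * κ) ^ (-(F * r * Q.eval fun i => κ * p i)) =
      xi d ^ (-((κ * r) * (F * Q.eval p))) := by
    have e : -(F * r * Q.eval fun i => κ * p i) = (κ : ℤ) * (-((κ * r) * (F * Q.eval p))) := by
      unfold QForm.eval; ring
    rw [e, zpow_mul, xi_mul_zpow hd0 hκ0, mul_zpow, ← zpow_mul]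
    have hev : Even (((κ : ℤ) + 1) * (-((κ * r) * (F * Q.eval p)))) := by
      have : ((κ : ℤ) + 1) * (-((κ * r) * (F * Q.eval p))) =
          (κ * (κ + 1)) * (-(r * (F * Q.eval p))) := by ring
      rw [this]
      exact (Int.even_mul_succ_self _).mul_right _
    rw [hev.neg_one_zpow, one_mul]
  rw [hxi]
  -- The integer e is (κU_n - n)/d. For even d its parity, together with that of FQ(p), enters the
  -- sign and yields the two cases of ℓ(p); for odd d all the signs are governed by n alone.
  have hκr : ∃ e, (κ : ℤ) * r = n + d * e ∧
      Even (((d * κ : ℕ) : ℤ) + (1 + ((d * κ : ℕ) : ℤ)) * (1 + κ * p 0) * (1 + κ * p 1) +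
        ((d : ℤ) + 1) * (-(e * (F * Q.eval p))) -
        (signExp d n p + n * ((d : ℤ) + (1 + d) * (1 + p 0) * (1 + p 1)))) := by
    rcases Nat.even_or_odd d with he | ho
    · obtain ⟨⟨e, z, h1, h2⟩, h3⟩ := ratio_mul_lucU_even hdz (by exact_mod_cast he) rfl hn3 hκ
      obtain ⟨w, hw⟩ := h.eval_parity he p
      refine ⟨e + 2 * z, by rw [hr, h1]; ring, ?_⟩
      have hdZ : Even (d : ℤ) := by exact_mod_cast he
      rw [Int.even_sub] at h3
      rw [hw, signExp]
      split_ifs with hcond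
      · have hodd : ¬ Even e := Int.not_even_iff_odd.2 (h2.2 hcond.2)
        push_cast
        exact even_sign_of_not_even hdZ h3 hodd z w _ _
      · have heven : Even e := by
          by_contra hne
          exact hcond ⟨he, h2.1 (Int.not_even_iff_odd.1 hne)⟩
        push_cast
        exact even_sign_of_even hdZ h3 heven z w _ _
    · obtain ⟨e, h1⟩ := ratio_mul_lucU hdz rfl hn3 hκ
      refine ⟨e, by linarith, ?_⟩
      have hdZ : ¬ Even (d : ℤ) := by exact_mod_cast Nat.not_even_iff_odd.2 ho
      have hV : Even (lucV ((d : ℤ) - 1) n) :=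
        even_lucV (by rw [Int.even_sub]; simp [hdZ]) n
      have hdκ : ¬ Even (((d * κ : ℕ) : ℤ)) := by
        push_cast
        rw [hκ, Int.even_add]
        simp [hV]
      rw [signExp, if_neg (fun hc => Nat.not_even_iff_odd.2 ho hc.1)]
      simp only [Int.even_add, Int.even_sub, Int.even_mul, even_neg, Int.not_even_one,
        hdZ, hdκ]
      tauto
  obtain ⟨e, he, hpar⟩ := hκr
  have hxi2 : xi d ^ (-((κ * r) * (F * Q.eval p))) =
      (xi d ^ (-(F * Q.eval p))) ^ n * (-1 : ℂ) ^ (((d : ℤ) + 1) * (-(e * (F * Q.eval p)))) := by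
    rw [← zpow_natCast, ← zpow_mul, ← xi_zpow_add_mul hd0, he]
    congr 1
    ring
  have hsign := neg_one_zpow_congr hpar
  rw [zpow_add₀ (by norm_num), zpow_add₀ (by norm_num : (-1 : ℂ) ≠ 0) (signExp d n p),
    mul_comm (n : ℤ), zpow_mul (-1 : ℂ) ((d : ℤ) + (1 + d) * (1 + p 0) * (1 + p 1)) (n : ℤ),
    zpow_natCast] at hsign
  rw [hxi2, mul_pow, mul_pow, mul_pow]
  linear_combination (Complex.exp (-(Real.pi * Complex.I / 12) *
    (rademacher (assocStab d Q) : ℂ)) ^ n * (xi d ^ (-(F * Q.eval p))) ^ n *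
    sfModular (fun i => (p i : ℚ) / (d : ℚ)) (assocStab d Q) (Q.rootPlus : ℂ) ^ n) * hsign

end LevelData

/-! ### Applying Galois automorphisms -/

section Gal

variable {E : IntermediateField ℚ ℂ} (g : E ≃ₐ[ℚ] E)

lemma galApply_of_mem {x : ℂ} (hx : x ∈ E) : galApply g x = (g ⟨x, hx⟩ : ℂ) := dif_pos hx

lemma galApply_mul {x y : ℂ} (hx : x ∈ E) (hy : y ∈ E) :
    galApply g (x * y) = galApply g x * galApply g y := by
  rw [galApply_of_mem g hx, galApply_of_mem g hy, galApply_of_mem g (mul_mem hx hy)]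
  exact congrArg Subtype.val (map_mul g ⟨x, hx⟩ ⟨y, hy⟩)

lemma galApply_add {x y : ℂ} (hx : x ∈ E) (hy : y ∈ E) :
    galApply g (x + y) = galApply g x + galApply g y := by
  rw [galApply_of_mem g hx, galApply_of_mem g hy, galApply_of_mem g (add_mem hx hy)]
  exact congrArg Subtype.val (map_add g ⟨x, hx⟩ ⟨y, hy⟩)

lemma galApply_ratCast (q : ℚ) : galApply g (q : ℂ) = q := by
  have hq : (q : ℂ) ∈ E := E.algebraMap_mem q
  rw [galApply_of_mem g hq]
  exact congrArg Subtype.val (g.commutes q)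

lemma galApply_zero : galApply g 0 = 0 := by simpa using galApply_ratCast g 0

lemma galApply_sum {ι : Type*} (s : Finset ι) {f : ι → ℂ} (hf : ∀ i ∈ s, f i ∈ E) :
    galApply g (∑ i ∈ s, f i) = ∑ i ∈ s, galApply g (f i) := by
  classical
  induction s using Finset.induction_on with
  | empty => simp [galApply_zero]
  | insert a s ha ih =>
    rw [Finset.sum_insert ha, Finset.sum_insert ha,
      galApply_add g (hf a (Finset.mem_insert_self a s))
        (sum_mem fun i hi => hf i (Finset.mem_insert_of_mem hi)),
      ih fun i hi => hf i (Finset.mem_insert_of_mem hi)]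

lemma galApply_pow {x : ℂ} (hx : x ∈ E) (n : ℕ) : galApply g (x ^ n) = galApply g x ^ n := by
  rw [galApply_of_mem g hx, galApply_of_mem g (pow_mem hx n)]
  exact congrArg Subtype.val (map_pow g ⟨x, hx⟩ n)

lemma galApply_zpow {x : ℂ} (hx : x ∈ E) (n : ℤ) : galApply g (x ^ n) = galApply g x ^ n := by
  rw [galApply_of_mem g hx, galApply_of_mem g (zpow_mem hx n)]
  exact congrArg Subtype.val (map_zpow₀ g ⟨x, hx⟩ n)

lemma galApply_neg_one_zpow_mul {x : ℂ} (hx : x ∈ E) (m : ℤ) :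
    galApply g ((-1 : ℂ) ^ m * x) = (-1 : ℂ) ^ m * galApply g x := by
  have e : (-1 : ℂ) ^ m = (((-1 : ℚ) ^ m : ℚ) : ℂ) := by push_cast; rfl
  rw [e, galApply_mul g (show ((((-1 : ℚ) ^ m : ℚ) : ℂ)) ∈ E from E.algebraMap_mem _) hx, galApply_ratCast]

/-- An automorphism maps a primitive root of unity to a power of it with exponent h invertible
modulo its order; k is the inverse exponent. -/
lemma exists_galApply_xi {d : ℕ} (hd : d ≠ 0) (hxi : xi d ∈ E) :
    ∃ h k : ℤ, galApply g (xi d) = xi d ^ h ∧ (dbar d : ℤ) ∣ h * k - 1 := by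
  have hne : NeZero (dbar d) := ⟨dbar_ne_zero hd⟩
  have hprim := isPrimitiveRoot_xi hd
  have h1 : IsPrimitiveRoot (⟨xi d, hxi⟩ : E) (dbar d) :=
    IsPrimitiveRoot.of_map_of_injective (f := algebraMap E ℂ) hprim (algebraMap E ℂ).injective
  have h2 : IsPrimitiveRoot (galApply g (xi d)) (dbar d) := by
    rw [galApply_of_mem g hxi]
    exact (h1.map_of_injective g.injective).map_of_injective (algebraMap E ℂ).injective
  obtain ⟨i, -, hi, he⟩ := (hprim.isPrimitiveRoot_iff).1 h2
  obtain ⟨u, v, huv⟩ := Nat.isCoprime_iff_coprime.2 hi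
  exact ⟨i, u, by rw [← he, zpow_natCast], ⟨-v, by linear_combination huv⟩⟩

end Gal

/-! ### Displacement operators -/

/-- Integer matrix powers involve the nonsingular inverse; exhibiting the powers as an additive
family avoids computing it. -/
lemma matrix_zpow_of_hom {n : Type*} [Fintype n] [DecidableEq n] (f : ℤ → Matrix n n ℂ)
    (h0 : f 0 = 1) (hadd : ∀ a b, f (a + b) = f a * f b) (k : ℤ) : f 1 ^ k = f k := by
  have hnat : ∀ m : ℕ, f 1 ^ m = f m := by
    intro m
    induction m with
    | zero => rw [pow_zero, Nat.cast_zero, h0]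
    | succ m ih => rw [pow_succ, ih, Nat.cast_succ, hadd]
  cases k with
  | ofNat m => rw [Int.ofNat_eq_natCast, zpow_natCast, hnat]
  | negSucc m =>
    rw [zpow_negSucc, hnat]
    refine Matrix.inv_eq_right_inv ?_
    rw [← hadd, Int.negSucc_eq]
    push_cast
    rw [← h0]
    congr 1
    ring

lemma int_dvd_of_eq {d x y : ℤ} (h : d ∣ x) (e : x = y) : d ∣ y := e ▸ h

lemma exists_fin_congr {d : ℕ} (hd : d ≠ 0) (m : ℤ) : ∃ c : Fin d, (d : ℤ) ∣ m - (c : ℕ) := by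
  have hd' : (0 : ℤ) < d := by omega
  have h1 := Int.emod_nonneg m hd'.ne'
  have h2 := Int.emod_lt_of_pos m hd'
  refine ⟨⟨(m % d).toNat, by omega⟩, ?_⟩
  simp only [Int.toNat_of_nonneg h1]
  exact Int.dvd_self_sub_emod

lemma fin_eq_of_congr {d : ℕ} {a b : Fin d} (h : (d : ℤ) ∣ (a : ℕ) - (b : ℕ)) : a = b := by
  have ha := a.2
  have hb := b.2
  obtain ⟨k, hk⟩ := h
  have hk0 : k = 0 := by
    by_contra hne
    rcases lt_or_gt_of_ne hne with hlt | hgt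
    · nlinarith [mul_le_mul_of_nonneg_left (show k ≤ -1 by omega) (Int.natCast_nonneg d)]
    · nlinarith [mul_le_mul_of_nonneg_left (show 1 ≤ k by omega) (Int.natCast_nonneg d)]
  rw [hk0, mul_zero] at hk
  exact Fin.ext (by omega)

open Classical in
lemma shiftX_zpow_apply {d : ℕ} (hd : d ≠ 0) (k : ℤ) (a b : Fin d) :
    (shiftX d ^ k) a b = if (d : ℤ) ∣ (a : ℕ) - (b : ℕ) - k then 1 else 0 := by
  set f : ℤ → Matrix (Fin d) (Fin d) ℂ := fun k =>
    Matrix.of fun a b => if (d : ℤ) ∣ (a : ℕ) - (b : ℕ) - k then 1 else 0 with hf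
  have h0 : f 0 = 1 := by
    ext a b
    simp only [hf, Matrix.of_apply, sub_zero, Matrix.one_apply]
    by_cases hab : a = b
    · subst hab; simp
    · rw [if_neg hab, if_neg fun h => hab (fin_eq_of_congr h)]
  have h1 : f 1 = shiftX d := by
    ext a b
    simp only [hf, Matrix.of_apply, shiftX]
    refine if_congr ?_ rfl rfl
    have ha := a.2
    constructor
    · intro h
      have h2 : ((a : ℕ) : ℤ) ≡ (((b : ℕ) + 1 : ℕ) : ℤ) [ZMOD d] := by
        refine Int.ModEq.symm ((Int.modEq_iff_dvd).2 ?_)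
        push_cast
        rwa [← sub_sub]
      have h3 := (Int.natCast_modEq_iff).1 h2
      rw [← Nat.mod_eq_of_lt ha]
      exact h3
    · intro h
      have h3 : (a : ℕ) ≡ (b : ℕ) + 1 [MOD d] := by
        rw [Nat.ModEq, Nat.mod_eq_of_lt ha]; exact h
      have h2 := (Int.modEq_iff_dvd).1 ((Int.natCast_modEq_iff).2 h3).symm
      push_cast at h2
      rwa [← sub_sub] at h2
  have hadd : ∀ k l, f (k + l) = f k * f l := by
    intro k l
    ext a b
    rw [Matrix.mul_apply]
    obtain ⟨c, hc⟩ := exists_fin_congr hd ((b : ℕ) + l)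
    simp only [hf, Matrix.of_apply]
    rw [Finset.sum_eq_single c]
    · have h2 : (d : ℤ) ∣ (c : ℕ) - (b : ℕ) - l := by
        exact int_dvd_of_eq (Int.dvd_neg.2 hc) (by ring)
      rw [if_pos h2, mul_one]
      refine if_congr ?_ rfl rfl
      have e : ((a : ℕ) : ℤ) - (b : ℕ) - (k + l) =
        ((a : ℕ) - (c : ℕ) - k) + ((c : ℕ) - (b : ℕ) - l) := by ring
      rw [e, dvd_add_left h2]
    · intro c' _ hne
      rw [if_neg (c := (d : ℤ) ∣ (c' : ℕ) - (b : ℕ) - l), mul_zero]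
      intro h
      refine hne (fin_eq_of_congr ?_)
      exact int_dvd_of_eq (Int.dvd_add hc h) (by ring)
    · intro h; exact absurd (Finset.mem_univ c) h
  rw [← h1, matrix_zpow_of_hom f h0 hadd]
  rfl

lemma omega_ne_zero (d : ℕ) : omega d ≠ 0 := Complex.exp_ne_zero _

lemma clockZ_zpow (d : ℕ) (k : ℤ) :
    clockZ d ^ k = Matrix.diagonal fun b : Fin d => omega d ^ (k * (b : ℕ)) := by
  set f : ℤ → Matrix (Fin d) (Fin d) ℂ := fun k =>
    Matrix.diagonal fun b : Fin d => omega d ^ (k * (b : ℕ)) with hf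
  have h0 : f 0 = 1 := by simp [hf]
  have h1 : f 1 = clockZ d := by simp [hf, clockZ]
  have hadd : ∀ k l, f (k + l) = f k * f l := by
    intro k l
    simp only [hf, Matrix.diagonal_mul_diagonal]
    congr 1
    funext b
    rw [add_mul, zpow_add₀ (omega_ne_zero d)]
  rw [← h1, matrix_zpow_of_hom f h0 hadd]

open Classical in
lemma displacement_apply {d : ℕ} (hd : d ≠ 0) (p : Fin 2 → ℤ) (a b : Fin d) :
    displacement d p a b =
      if (d : ℤ) ∣ (a : ℕ) - (b : ℕ) - p 0 then xi d ^ (p 0 * p 1 + 2 * (p 1 * (b : ℕ))) else 0 := by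
  rw [displacement, Matrix.smul_apply, clockZ_zpow, Matrix.mul_diagonal, shiftX_zpow_apply hd]
  split_ifs
  · rw [one_mul, smul_eq_mul, zpow_add₀ (xi_ne_zero d), zpow_mul (xi d) 2, xi_sq]
  · simp

lemma star_xi_zpow (d : ℕ) (m : ℤ) : star (xi d ^ m) = xi d ^ (-m) := by
  have h : star (xi d) = (xi d)⁻¹ := by
    have hn : ‖xi d‖ = 1 := by
      rw [xi, norm_neg]
      have : (Real.pi : ℂ) * Complex.I / d = ((Real.pi / d : ℝ) : ℂ) * Complex.I := by
        push_cast; ring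
      rw [this, Complex.norm_exp_ofReal_mul_I]
    rw [Complex.inv_eq_conj hn]
    rfl
  rw [star_zpow₀, h, inv_zpow, zpow_neg]

open Classical in
lemma sum_omega_zpow {d : ℕ} (hd : d ≠ 0) (m : ℤ) :
    ∑ b : Fin d, omega d ^ (m * (b : ℕ)) = if (d : ℤ) ∣ m then (d : ℂ) else 0 := by
  have hprim : IsPrimitiveRoot (omega d) d := Complex.isPrimitiveRoot_exp d hd
  have e : ∀ b : ℕ, omega d ^ (m * (b : ℤ)) = (omega d ^ m) ^ b := by
    intro b; rw [zpow_mul, zpow_natCast]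
  simp only [e]
  rw [Fin.sum_univ_eq_sum_range (fun b => (omega d ^ m) ^ b) d]
  split_ifs with h
  · rw [(hprim.zpow_eq_one_iff_dvd m).2 h]; simp
  · have h1 : omega d ^ m ≠ 1 := fun h' => h ((hprim.zpow_eq_one_iff_dvd m).1 h')
    have h2 : (omega d ^ m) ^ d = 1 := by
      rw [← zpow_natCast, ← zpow_mul, mul_comm, zpow_mul, zpow_natCast, hprim.pow_eq_one, one_zpow]
    rw [geom_sum_eq h1, h2, sub_self, zero_div]

open Classical in
/-- The Galois-twisted orthogonality of the displacement operators. -/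
lemma sum_displacement {d : ℕ} (hd : d ≠ 0) (h : ℤ) (k q : Fin 2 → ℤ) :
    ∑ a : Fin d, ∑ b : Fin d,
      (if (d : ℤ) ∣ (a : ℕ) - (b : ℕ) - k 0 then
        xi d ^ (h * (k 0 * k 1 + 2 * (k 1 * (b : ℕ)))) else 0) * star (displacement d q a b) =
      if (d : ℤ) ∣ k 0 - q 0 ∧ (d : ℤ) ∣ h * k 1 - q 1 then
        d * xi d ^ (h * (k 0 * k 1) - q 0 * q 1) else 0 := by
  simp only [displacement_apply hd]
  rw [Finset.sum_comm]
  by_cases h0 : (d : ℤ) ∣ k 0 - q 0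
  · have hin : ∀ b : Fin d, (∑ a : Fin d, (if (d : ℤ) ∣ (a : ℕ) - (b : ℕ) - k 0 then
        xi d ^ (h * (k 0 * k 1 + 2 * (k 1 * (b : ℕ)))) else 0) *
        star (if (d : ℤ) ∣ (a : ℕ) - (b : ℕ) - q 0 then
          xi d ^ (q 0 * q 1 + 2 * (q 1 * (b : ℕ))) else 0)) =
        xi d ^ (h * (k 0 * k 1) - q 0 * q 1) * omega d ^ ((h * k 1 - q 1) * (b : ℕ)) := by
      intro b
      obtain ⟨c, hc⟩ := exists_fin_congr hd ((b : ℕ) + k 0)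
      have hc' : (d : ℤ) ∣ (c : ℕ) - (b : ℕ) - k 0 := by
        exact int_dvd_of_eq (Int.dvd_neg.2 hc) (by ring)
      have hc'' : (d : ℤ) ∣ (c : ℕ) - (b : ℕ) - q 0 := by
        exact int_dvd_of_eq (Int.dvd_add hc' h0) (by ring)
      rw [Finset.sum_eq_single c]
      · rw [if_pos hc', if_pos hc'', star_xi_zpow, ← zpow_add₀ (xi_ne_zero d), ← xi_sq, ← zpow_mul,
          ← zpow_add₀ (xi_ne_zero d)]
        congr 1
        ring
      · intro a _ hne
        rw [if_neg, zero_mul]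
        intro ha
        refine hne (fin_eq_of_congr ?_)
        exact int_dvd_of_eq (Int.dvd_sub ha hc') (by ring)
      · intro hh; exact absurd (Finset.mem_univ c) hh
    rw [Finset.sum_congr rfl fun b _ => hin b, ← Finset.mul_sum, sum_omega_zpow hd]
    by_cases h1 : (d : ℤ) ∣ h * k 1 - q 1
    · rw [if_pos h1, if_pos ⟨h0, h1⟩, mul_comm]
    · rw [if_neg h1, if_neg fun hh => h1 hh.2, mul_zero]
  · rw [if_neg fun hh => h0 hh.1]
    refine Finset.sum_eq_zero fun b _ => Finset.sum_eq_zero fun a _ => ?_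
    by_cases ha : (d : ℤ) ∣ (a : ℕ) - (b : ℕ) - k 0
    · rw [if_neg (c := (d : ℤ) ∣ (a : ℕ) - (b : ℕ) - q 0), star_zero, mul_zero]
      intro hq
      exact h0 (int_dvd_of_eq (Int.dvd_sub hq ha) (by ring))
    · rw [if_neg ha, zero_mul]

/-! ### Overlaps of rank one fiducial data -/

/-- The quotient `F = f_j / f`. -/
def condQuot (D j : ℕ) (Q : QForm) : ℤ := ((condSeq D j / Q.conductor : ℕ) : ℤ)

lemma QTuple.field_le_galField (t : QTuple) : t.field ≤ t.galField := by
  unfold QTuple.galField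
  split_ifs
  · exact le_sup_right.trans (IntermediateField.le_normalClosure _)
  · exact le_top

lemma QTuple.xi_mem (t : QTuple) : xi t.d ∈ t.galField :=
  t.field_le_galField (IntermediateField.subset_adjoin ℚ _ (Or.inl rfl))

section RankOne

variable {D j : ℕ} {Q : QForm} {x : ℝ}

lemma ghostOverlap_eq (h : LevelData Q (dimTower D j) (condQuot D j Q) x) {p : Fin 2 → ℤ}
    (hp : ¬ VecZeroMod (dimTower D j) p) :
    (rankOneTuple D j Q).ghostOverlap p =
      ((√((dimTower D j : ℝ) + 1) : ℝ) : ℂ)⁻¹ * ghostNu Q (dimTower D j) (condQuot D j Q) p := by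
  have hp' : ¬ VecZeroMod (rankOneTuple D j Q).d p := hp
  rw [QTuple.ghostOverlap, if_neg hp', normGhostOverlap_rankOne]
  have hd : (4 : ℝ) ≤ (dimTower D j : ℝ) := by exact_mod_cast h.four_le
  have e : (((1 : ℕ) : ℝ)) * ((dimTower D j : ℝ) - ((1 : ℕ) : ℝ)) / ((dimTower D j : ℝ) ^ 2 - 1) =
      ((dimTower D j : ℝ) + 1)⁻¹ := by
    have h1 : (dimTower D j : ℝ) + 1 ≠ 0 := by positivity
    have h2 : (dimTower D j : ℝ) ^ 2 - 1 ≠ 0 := by nlinarith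
    rw [div_eq_iff h2]
    push_cast
    field_simp
    ring
  change ((√((((1 : ℕ) : ℝ)) * ((dimTower D j : ℝ) - ((1 : ℕ) : ℝ)) /
    ((dimTower D j : ℝ) ^ 2 - 1)) : ℝ) : ℂ) * _ = _
  rw [e, Real.sqrt_inv, Complex.ofReal_inv]
  rfl

lemma vecZeroMod_add_iff {d : ℕ} (p q : Fin 2 → ℤ) :
    VecZeroMod d (fun i => p i + d * q i) ↔ VecZeroMod d p := by
  unfold VecZeroMod
  refine forall_congr' fun i => ?_
  rw [Int.dvd_add_left (Int.dvd_mul_right _ _)]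

lemma ghostOverlap_add (h : LevelData Q (dimTower D j) (condQuot D j Q) x) (p q : Fin 2 → ℤ) :
    (rankOneTuple D j Q).ghostOverlap (fun i => p i + dimTower D j * q i) =
      (-1 : ℂ) ^ (((dimTower D j : ℤ) + 1) * (p 0 * q 1 + p 1 * q 0)) *
        (rankOneTuple D j Q).ghostOverlap p := by
  by_cases hp : VecZeroMod (dimTower D j) p
  · have hp1 : VecZeroMod (rankOneTuple D j Q).d p := hp
    have hp2 : VecZeroMod (rankOneTuple D j Q).d (fun i => p i + dimTower D j * q i) :=
      (vecZeroMod_add_iff p q).2 hp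
    rw [QTuple.ghostOverlap, QTuple.ghostOverlap, if_pos hp1, if_pos hp2, Even.neg_one_zpow,
      one_mul]
    obtain ⟨u, hu⟩ := hp 0
    obtain ⟨v, hv⟩ := hp 1
    rw [hu, hv]
    have e : ((dimTower D j : ℤ) + 1) * (dimTower D j * u * q 1 + dimTower D j * v * q 0) =
        dimTower D j * (dimTower D j + 1) * (u * q 1 + v * q 0) := by ring
    rw [e]
    exact (Int.even_mul_succ_self _).mul_right _
  · rw [ghostOverlap_eq h hp, ghostOverlap_eq h (fun h' => hp ((vecZeroMod_add_iff p q).1 h')),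
      h.ghostNu_add hp]
    ring

/-- The field is generated by the overlaps in the box 0 ≤ p₁, p₂ < d only; quasi-periodicity reaches
the others up to a sign. -/
lemma ghostOverlap_mem (h : LevelData Q (dimTower D j) (condQuot D j Q) x) (p : Fin 2 → ℤ) :
    (rankOneTuple D j Q).ghostOverlap p ∈ (rankOneTuple D j Q).galField := by
  set d := dimTower D j with hd
  have hd0 : (0 : ℤ) < d := by have := h.four_le; omega
  by_cases hp : VecZeroMod d p
  · have hp1 : VecZeroMod (rankOneTuple D j Q).d p := hp
    rw [QTuple.ghostOverlap, if_pos hp1]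
    exact natCast_mem _ _
  · have hvec : p = fun i => (fun i => p i % d) i + d * (fun i => p i / d) i := by
      funext i; exact (Int.emod_add_mul_ediv (p i) d).symm
    rw [hvec, ghostOverlap_add h]
    refine mul_mem (zpow_mem (neg_mem (one_mem _)) _) ?_
    refine (rankOneTuple D j Q).field_le_galField (IntermediateField.subset_adjoin ℚ _ (Or.inr
      ⟨_, ⟨?_, fun i => ⟨Int.emod_nonneg _ hd0.ne', Int.emod_lt_of_pos _ hd0⟩⟩, rfl⟩))
    intro h0
    refine hp fun i => Int.dvd_of_emod_eq_zero ?_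
    exact congrFun h0 i

/-- Modulo 2 the pairing u₁v₂ + u₂v₁ is the determinant of (u, v), and det G is odd. Hence the
quasi-periodicity sign is unaffected by G. -/
lemma even_mulVec_cross (G : GL (Fin 2) ℤ) (u v : Fin 2 → ℤ) :
    Even ((G.1.mulVec u 0 * G.1.mulVec v 1 + G.1.mulVec u 1 * G.1.mulVec v 0) -
      (u 0 * v 1 + u 1 * v 0)) := by
  have hdet : Odd (G.1.det) := by
    have : IsUnit G.1.det := (Matrix.isUnit_iff_isUnit_det _).1 G.isUnit
    rcases Int.isUnit_iff.1 this with h | h <;> rw [h] <;> decide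
  rw [Matrix.det_fin_two] at hdet
  obtain ⟨k, hk⟩ := hdet
  simp only [Matrix.mulVec, dotProduct, Fin.sum_univ_two]
  refine ⟨G.1 0 0 * G.1 1 0 * u 0 * v 0 + G.1 0 1 * G.1 1 1 * u 1 * v 1 +
    (k + G.1 0 1 * G.1 1 0) * (u 0 * v 1 + u 1 * v 0), ?_⟩
  linear_combination (u 0 * v 1 + u 1 * v 0) * hk

end RankOne

section Overlap

variable {t : QTuple} (s : FiducialDatum t)

lemma fiducial_apply (hmem : ∀ p, t.ghostOverlap p ∈ t.galField) (hd : t.d ≠ 0) (a b : Fin t.d) :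
    s.fiducial a b = (t.d : ℂ)⁻¹ * ∑ k : Fin t.d × Fin t.d,
        galApply s.g (t.ghostOverlap (s.G.1.mulVec ![((k.1 : ℕ) : ℤ), ((k.2 : ℕ) : ℤ)])) *
        galApply s.g (displacement t.d ![((k.1 : ℕ) : ℤ), ((k.2 : ℕ) : ℤ)] a b) := by
  have hdis : ∀ k : Fin 2 → ℤ, displacement t.d k a b ∈ t.galField := by
    classical
    intro k
    rw [displacement_apply hd]
    split_ifs
    · exact zpow_mem t.xi_mem _
    · exact zero_mem _
  have hinv : (t.d : ℂ)⁻¹ = (((t.d : ℚ)⁻¹ : ℚ) : ℂ) := by push_cast; rfl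
  have hinvmem : (t.d : ℂ)⁻¹ ∈ t.galField := inv_mem (natCast_mem _ _)
  have hentry : s.ghostFiducial a b = (t.d : ℂ)⁻¹ * ∑ k : Fin t.d × Fin t.d,
        (t.ghostOverlap (s.G.1.mulVec ![((k.1 : ℕ) : ℤ), ((k.2 : ℕ) : ℤ)])) *
        (displacement t.d ![((k.1 : ℕ) : ℤ), ((k.2 : ℕ) : ℤ)] a b) := by
    unfold FiducialDatum.ghostFiducial
    rw [Matrix.smul_apply, Matrix.sum_apply, smul_eq_mul, one_div]
    rfl
  change galApply s.g (s.ghostFiducial a b) = _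
  rw [hentry, galApply_mul s.g hinvmem (sum_mem fun k _ => mul_mem (hmem _) (hdis _)),
    galApply_sum s.g _ fun k _ => mul_mem (hmem _) (hdis _), hinv, galApply_ratCast]
  congr 1
  exact Finset.sum_congr rfl fun k _ => galApply_mul s.g (hmem _) (hdis _)

-- Applying g entrywise replaces ξ_d by ξ_d^e in each displacement operator, and the trace against
-- D_q† then leaves only the terms with k₁ ≡ q₁ and ek₂ ≡ q₂ mod d.
open Classical in
lemma overlap_eq_sum (hmem : ∀ p, t.ghostOverlap p ∈ t.galField) (hd : t.d ≠ 0) {e : ℤ}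
    (he : galApply s.g (xi t.d) = xi t.d ^ e) (p : Fin 2 → ℤ) :
    s.overlap p = ∑ k : Fin t.d × Fin t.d,
      galApply s.g (t.ghostOverlap (s.G.1.mulVec ![((k.1 : ℕ) : ℤ), ((k.2 : ℕ) : ℤ)])) *
      (if (t.d : ℤ) ∣ (k.1 : ℕ) - (s.G⁻¹).1.mulVec p 0 ∧
          (t.d : ℤ) ∣ e * (k.2 : ℕ) - (s.G⁻¹).1.mulVec p 1 then
        xi t.d ^ (e * ((k.1 : ℕ) * (k.2 : ℕ)) - (s.G⁻¹).1.mulVec p 0 * (s.G⁻¹).1.mulVec p 1)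
        else 0) := by
  set q := (s.G⁻¹).1.mulVec p with hq
  have hd' : (t.d : ℂ) ≠ 0 := by exact_mod_cast hd
  have hgal : ∀ (k : Fin 2 → ℤ) (a b : Fin t.d), galApply s.g (displacement t.d k a b) =
      if (t.d : ℤ) ∣ (a : ℕ) - (b : ℕ) - k 0 then
        xi t.d ^ (e * (k 0 * k 1 + 2 * (k 1 * (b : ℕ)))) else 0 := by
    intro k a b
    rw [displacement_apply hd]
    split_ifs
    · rw [galApply_zpow s.g t.xi_mem, he, ← zpow_mul]
    · exact galApply_zero s.g
  have htrace : s.overlap p = ∑ a : Fin t.d, ∑ b : Fin t.d,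
      s.fiducial a b * star (displacement t.d q a b) := by
    unfold FiducialDatum.overlap
    rw [Matrix.trace]
    refine Finset.sum_congr rfl fun a _ => ?_
    rw [Matrix.diag_apply, Matrix.mul_apply]
    rfl
  rw [htrace]
  simp only [fiducial_apply s hmem hd, Finset.mul_sum, Finset.sum_mul]
  rw [Finset.sum_congr rfl fun a _ => Finset.sum_comm, Finset.sum_comm]
  refine Finset.sum_congr rfl fun k _ => ?_
  have hpull : ∀ a b : Fin t.d, (t.d : ℂ)⁻¹ *
      (galApply s.g (t.ghostOverlap (s.G.1.mulVec ![((k.1 : ℕ) : ℤ), ((k.2 : ℕ) : ℤ)])) *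
        galApply s.g (displacement t.d ![((k.1 : ℕ) : ℤ), ((k.2 : ℕ) : ℤ)] a b)) *
        star (displacement t.d q a b) =
      galApply s.g (t.ghostOverlap (s.G.1.mulVec ![((k.1 : ℕ) : ℤ), ((k.2 : ℕ) : ℤ)])) *
        (t.d : ℂ)⁻¹ * (galApply s.g (displacement t.d ![((k.1 : ℕ) : ℤ), ((k.2 : ℕ) : ℤ)] a b) *
          star (displacement t.d q a b)) := fun a b => by ring
  simp only [hpull, ← Finset.mul_sum]
  rw [mul_assoc]
  congr 1
  simp only [hgal]
  rw [sum_displacement hd e ![((k.1 : ℕ) : ℤ), ((k.2 : ℕ) : ℤ)] q, mul_ite, mul_zero,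
    inv_mul_cancel_left₀ hd']
  exact if_congr Iff.rfl rfl rfl

/-- The overlaps of a fiducial datum are Galois conjugates of ghost overlaps. -/
theorem overlap_eq (hmem : ∀ p, t.ghostOverlap p ∈ t.galField) (hd : t.d ≠ 0)
    (hadd : ∀ p q : Fin 2 → ℤ, t.ghostOverlap (fun i => p i + t.d * q i) =
      (-1 : ℂ) ^ (((t.d : ℤ) + 1) * (p 0 * q 1 + p 1 * q 0)) * t.ghostOverlap p) {e f : ℤ}
    (he : galApply s.g (xi t.d) = xi t.d ^ e) (hef : (dbar t.d : ℤ) ∣ e * f - 1)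
    (p : Fin 2 → ℤ) :
    s.overlap p = galApply s.g (t.ghostOverlap
      (s.G.1.mulVec ![(s.G⁻¹).1.mulVec p 0, f * (s.G⁻¹).1.mulVec p 1])) := by
  classical
  rw [overlap_eq_sum s hmem hd he]
  set q := (s.G⁻¹).1.mulVec p with hq
  have hdef : (t.d : ℤ) ∣ e * f - 1 := by
    refine dvd_trans ?_ hef
    unfold dbar
    split_ifs
    · push_cast; exact Dvd.intro_left 2 rfl
    · exact dvd_rfl
  obtain ⟨c0, u, hu⟩ := exists_fin_congr hd (q 0)
  obtain ⟨c1, v, hv⟩ := exists_fin_congr hd (f * q 1)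
  obtain ⟨w, hw⟩ := hef
  obtain ⟨w', hw'⟩ := hdef
  -- The surviving index is the reduction of (q₁, fq₂) modulo d. The sign from undoing this
  -- reduction in the ghost overlap cancels the sign left over from the power of ξ_d; for even d
  -- this uses that e is odd.
  rw [Finset.sum_eq_single (c0, c1)]
  · rw [if_pos ⟨⟨-u, by linear_combination -hu⟩,
      ⟨w' * q 1 - e * v, by linear_combination q 1 * hw' - e * hv⟩⟩]
    have hvec : s.G.1.mulVec ![((c0 : ℕ) : ℤ), ((c1 : ℕ) : ℤ)] = fun i =>
        s.G.1.mulVec ![q 0, f * q 1] i + t.d * s.G.1.mulVec ![-u, -v] i := by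
      funext i
      simp only [Matrix.mulVec, dotProduct, Fin.sum_univ_two, Matrix.cons_val_zero,
        Matrix.cons_val_one]
      linear_combination -s.G.1 i 0 * hu - s.G.1 i 1 * hv
    rw [hvec, hadd, galApply_neg_one_zpow_mul s.g (hmem _), mul_right_comm]
    have hpar := even_mulVec_cross s.G ![q 0, f * q 1] ![-u, -v]
    simp only [Matrix.cons_val_zero, Matrix.cons_val_one] at hpar
    obtain ⟨m, hm⟩ := hpar
    have hexp : e * (((c0 : ℕ) : ℤ) * ((c1 : ℕ) : ℤ)) - q 0 * q 1 =
        (dbar t.d : ℤ) * (w * (q 0 * q 1)) +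
          t.d * (e * (t.d * u * v - q 0 * v - u * (f * q 1))) := by
      have h0 : ((c0 : ℕ) : ℤ) = q 0 - t.d * u := by linarith
      have h1 : ((c1 : ℕ) : ℤ) = f * q 1 - t.d * v := by linarith
      rw [h0, h1]
      linear_combination q 0 * q 1 * hw
    rw [hexp, xi_zpow_add_mul hd, zpow_mul (xi t.d), zpow_natCast, (isPrimitiveRoot_xi hd).pow_eq_one,
      one_zpow, one_mul, ← zpow_add₀ (by norm_num), Even.neg_one_zpow, one_mul]
    rw [← mul_add]
    rcases Nat.even_or_odd t.d with hev | hodd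
    · refine Even.mul_left ?_ _
      have he1 : Odd e := by
        rw [dbar, if_pos hev] at hw
        have : Odd (e * f) := ⟨t.d * w, by push_cast at hw; linear_combination hw⟩
        exact (Int.odd_mul.1 this).1
      obtain ⟨e', he'⟩ := he1
      obtain ⟨d', hd''⟩ := hev
      have hdz : (t.d : ℤ) = d' + d' := by exact_mod_cast hd''
      refine ⟨m + e * d' * u * v - (e' + 1) * (q 0 * v + u * (f * q 1)), ?_⟩
      linear_combination hm + (e * u * v) * hdz - (q 0 * v + u * (f * q 1)) * he'
    · refine Even.mul_right ?_ _
      have : Odd (t.d : ℤ) := by exact_mod_cast hodd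
      exact this.add_one
  · intro k _ hne
    rw [if_neg, mul_zero]
    rintro ⟨⟨y, hy⟩, ⟨z, hz⟩⟩
    refine hne (Prod.ext (fin_eq_of_congr ?_) (fin_eq_of_congr ?_))
    · exact ⟨y + u, by linear_combination hy + hu⟩
    · exact ⟨f * z - w' * (k.2 : ℕ) + v, by linear_combination f * hz - (k.2 : ℕ) * hw' + hv⟩
  · intro hh; exact absurd (Finset.mem_univ _) hh

end Overlap

/-! ### Comparison of two levels of a tower -/

lemma VecZeroMod.mulVec {m : ℕ} {v : Fin 2 → ℤ} (hv : VecZeroMod m v)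
    (M : Matrix (Fin 2) (Fin 2) ℤ) : VecZeroMod m (M.mulVec v) := by
  intro i
  simp only [Matrix.mulVec, dotProduct, Fin.sum_univ_two]
  exact Int.dvd_add (Dvd.dvd.mul_left (hv 0) _) (Dvd.dvd.mul_left (hv 1) _)

lemma inv_mulVec_mulVec (G : GL (Fin 2) ℤ) (v : Fin 2 → ℤ) :
    (G⁻¹).1.mulVec (G.1.mulVec v) = v := by
  rw [Matrix.mulVec_mulVec]
  have : (G⁻¹).1 * G.1 = 1 := Units.inv_mul G
  rw [this, Matrix.one_mulVec]

lemma mulVec_inv_mulVec (G : GL (Fin 2) ℤ) (v : Fin 2 → ℤ) :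
    G.1.mulVec ((G⁻¹).1.mulVec v) = v := by
  rw [Matrix.mulVec_mulVec]
  have : G.1 * (G⁻¹).1 = 1 := Units.mul_inv G
  rw [this, Matrix.one_mulVec]

/-- The vector `G diag(1, f) G⁻¹ p`. -/
def twistVec (G : GL (Fin 2) ℤ) (f : ℤ) (p : Fin 2 → ℤ) : Fin 2 → ℤ :=
  G.1.mulVec ![(G⁻¹).1.mulVec p 0, f * (G⁻¹).1.mulVec p 1]

lemma twistVec_smul (G : GL (Fin 2) ℤ) (f c : ℤ) (p : Fin 2 → ℤ) :
    twistVec G f (c • p) = fun i => c * twistVec G f p i := by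
  funext i
  simp only [twistVec, Matrix.mulVec, dotProduct, Fin.sum_univ_two, Matrix.cons_val_zero,
    Matrix.cons_val_one, Pi.smul_apply, smul_eq_mul]
  ring

lemma vecZeroMod_twistVec {m : ℕ} {e f : ℤ} (hef : (m : ℤ) ∣ e * f - 1) (G : GL (Fin 2) ℤ)
    (p : Fin 2 → ℤ) : VecZeroMod m (twistVec G f p) ↔ VecZeroMod m p := by
  constructor
  · intro h
    have h1 := h.mulVec (G⁻¹).1
    rw [twistVec, inv_mulVec_mulVec] at h1
    have h2 : VecZeroMod m ((G⁻¹).1.mulVec p) := by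
      intro i
      fin_cases i
      · exact h1 0
      · have h3 : (m : ℤ) ∣ f * (G⁻¹).1.mulVec p 1 := h1 1
        exact int_dvd_of_eq (Int.dvd_sub (Dvd.dvd.mul_left h3 e)
          (Dvd.dvd.mul_right hef ((G⁻¹).1.mulVec p 1)))
          (by simp only [Fin.mk_one]; ring)
    have h4 := h2.mulVec G.1
    rwa [mulVec_inv_mulVec] at h4
  · intro h
    have h1 := h.mulVec (G⁻¹).1
    refine VecZeroMod.mulVec ?_ G.1
    intro i
    fin_cases i
    · exact h1 0
    · exact Dvd.dvd.mul_left (h1 1) f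

/-- The exponent depends on p only through whether p ≡ 0 mod 2, and that only for even d, when f is
odd and the twist is invertible modulo 2. -/
lemma neg_one_zpow_signExp_twistVec {d : ℕ} {e f : ℤ} (hef : (dbar d : ℤ) ∣ e * f - 1)
    (G : GL (Fin 2) ℤ) (n : ℕ) (p : Fin 2 → ℤ) :
    (-1 : ℂ) ^ signExp d n (twistVec G f p) = (-1 : ℂ) ^ signExp d n p := by
  refine neg_one_zpow_congr ?_
  unfold signExp
  split_ifs with hc
  · have h2 : ((2 : ℕ) : ℤ) ∣ e * f - 1 := by
      refine dvd_trans ?_ hef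
      rw [dbar, if_pos hc.1]
      push_cast
      exact Dvd.intro _ rfl
    have hiff := vecZeroMod_twistVec h2 G p
    have hE : ∀ v : Fin 2 → ℤ, VecZeroMod 2 v ↔ Even (v 0) ∧ Even (v 1) := by
      intro v
      unfold VecZeroMod
      rw [Fin.forall_fin_two, even_iff_two_dvd, even_iff_two_dvd]
      rfl
    rw [hE, hE] at hiff
    have e : (n : ℤ) + (1 + twistVec G f p 0) * (1 + twistVec G f p 1) -
        (n + (1 + p 0) * (1 + p 1)) =
        (1 + twistVec G f p 0) * (1 + twistVec G f p 1) - (1 + p 0) * (1 + p 1) := by ring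
    rw [e]
    simp only [Int.even_sub, Int.even_mul, Int.even_add, Int.not_even_one, false_iff]
    tauto
  · simp

/-- By the duplication identities d' + 1 = V_n + 2 is V_k² for n = 2k and (d + 1)W² for n = 2k + 1,
so √(d' + 1) and √(d + 1)ⁿ are rationally proportional. -/
lemma exists_rat_sqrt {d d' : ℕ} (hd : 4 ≤ d) {n : ℕ} (hn : 0 < n)
    (hd' : (d' : ℤ) = lucV ((d : ℤ) - 1) n + 1) :
    ∃ c : ℚ, c ≠ 0 ∧ √((d : ℝ) + 1) ^ n = c * √((d' : ℝ) + 1) := by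
  have hd'' : (d' : ℝ) + 1 = ((lucV ((d : ℤ) - 1) n + 2 : ℤ) : ℝ) := by
    have : ((d' : ℤ) : ℝ) = ((lucV ((d : ℤ) - 1) n + 1 : ℤ) : ℝ) := by rw [hd']
    push_cast at this ⊢
    linarith
  have hT : (2 : ℤ) ≤ (d : ℤ) - 1 := by omega
  have hVpos : 0 < lucV ((d : ℤ) - 1) n + 2 := by
    obtain ⟨k, rfl⟩ : ∃ k, n = k + 1 := ⟨n - 1, by omega⟩
    have := (lucU_pos_lucV_ge hT k).2.2.1
    omega
  have hs : √((d : ℝ) + 1) ^ 2 = (d : ℝ) + 1 := Real.sq_sqrt (by positivity)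
  have hdne : (d : ℚ) + 1 ≠ 0 := by positivity
  rcases Nat.even_or_odd' n with ⟨k, rfl | rfl⟩
  · have h1 := (lucV_two_mul ((d : ℤ) - 1) k).1
    have hV0 : lucV ((d : ℤ) - 1) k ≠ 0 := by
      intro h0
      rw [h1, h0] at hVpos
      simp at hVpos
    have hV0' : |lucV ((d : ℤ) - 1) k| ≠ 0 := abs_ne_zero.2 hV0
    refine ⟨((d : ℚ) + 1) ^ k / (|lucV ((d : ℤ) - 1) k| : ℤ), ?_, ?_⟩
    · exact div_ne_zero (pow_ne_zero _ hdne) (by exact_mod_cast hV0')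
    · rw [hd'', h1, pow_mul, hs]
      have hne : ((|lucV ((d : ℤ) - 1) k| : ℤ) : ℝ) ≠ 0 := by exact_mod_cast hV0'
      push_cast at hne ⊢
      rw [Real.sqrt_sq_eq_abs]
      field_simp
  · have h1 := lucV_two_mul_add_one ((d : ℤ) - 1) k
    set W := lucU ((d : ℤ) - 1) (k + 1) - lucU ((d : ℤ) - 1) k with hW
    have hW0 : W ≠ 0 := by
      intro h0
      rw [h1, h0] at hVpos
      simp at hVpos
    have hW0' : |W| ≠ 0 := abs_ne_zero.2 hW0
    refine ⟨((d : ℚ) + 1) ^ k / (|W| : ℤ), ?_, ?_⟩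
    · exact div_ne_zero (pow_ne_zero _ hdne) (by exact_mod_cast hW0')
    · have e : (((d : ℤ) - 1 + 2) * W ^ 2 : ℤ) = ((d : ℤ) + 1) * W ^ 2 := by ring
      rw [hd'', h1, pow_succ, pow_mul, hs, e]
      have hne : ((|W| : ℤ) : ℝ) ≠ 0 := by exact_mod_cast hW0'
      push_cast at hne ⊢
      rw [Real.sqrt_mul (by positivity), Real.sqrt_sq_eq_abs]
      field_simp

/-- In rank one the normalization (d² - 1)/(d - 1) is d + 1. The square root stays outside g, since
it is not known to lie in the field on which g acts. -/
lemma normOverlap_eq {D j : ℕ} {Q : QForm} {x : ℝ}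
    (h : LevelData Q (dimTower D j) (condQuot D j Q) x) (s : FiducialDatum (rankOneTuple D j Q))
    {e f : ℤ} (he : galApply s.g (xi (dimTower D j)) = xi (dimTower D j) ^ e)
    (hef : (dbar (dimTower D j) : ℤ) ∣ e * f - 1) (p : Fin 2 → ℤ) :
    s.normOverlap p = ((√((dimTower D j : ℝ) + 1) : ℝ) : ℂ) *
      galApply s.g ((rankOneTuple D j Q).ghostOverlap (twistVec s.G f p)) := by
  have hd : (4 : ℝ) ≤ (dimTower D j : ℝ) := by exact_mod_cast h.four_le
  have e1 : ((dimTower D j : ℝ) ^ 2 - 1) / ((((1 : ℕ) : ℝ)) *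
      ((dimTower D j : ℝ) - ((1 : ℕ) : ℝ))) = (dimTower D j : ℝ) + 1 := by
    have h1 : (dimTower D j : ℝ) - 1 ≠ 0 := by linarith
    push_cast
    rw [one_mul, div_eq_iff h1]
    ring
  have hov := overlap_eq s (ghostOverlap_mem h) h.d_ne_zero (ghostOverlap_add h) he hef p
  rw [FiducialDatum.normOverlap, hov]
  change ((√(((dimTower D j : ℝ) ^ 2 - 1) / ((((1 : ℕ) : ℝ)) *
      ((dimTower D j : ℝ) - ((1 : ℕ) : ℝ)))) : ℝ) : ℂ) * _ = _
  rw [e1]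
  rfl

lemma odd_of_dvd_sub_one {m e f : ℤ} (hm : Even m) (h : m ∣ e * f - 1) : Odd e := by
  obtain ⟨w, hw⟩ := h
  obtain ⟨k, hk⟩ := hm
  have : Odd (e * f) := ⟨k * w, by rw [hk] at hw; linear_combination hw⟩
  exact (Int.odd_mul.1 this).1

lemma dbar_dvd_mul (d κ : ℕ) (hodd : Odd d → Odd κ) : dbar d ∣ dbar (d * κ) := by
  unfold dbar
  by_cases hd : Even d
  · rw [if_pos hd, if_pos (hd.mul_right κ), ← mul_assoc]
    exact Dvd.intro _ rfl
  · have ho := Nat.not_even_iff_odd.1 hd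
    rw [if_neg hd, if_neg (Nat.not_even_iff_odd.2 (ho.mul (hodd ho)))]
    exact Dvd.intro _ rfl

/-- The power relation between the overlaps at two levels of a tower. -/
theorem normOverlap_tower {D j n κ : ℕ} {Q : QForm} {x : ℝ} (hn : 0 < n) (hn3 : Nat.Coprime n 3)
    (h : LevelData Q (dimTower D j) (condQuot D j Q) x)
    (h' : LevelData Q (dimTower D (n * j)) (condQuot D (n * j) Q) (x ^ n))
    (hκ : dimTower D (n * j) = dimTower D j * κ)
    (hV : (dimTower D (n * j) : ℤ) = lucV ((dimTower D j : ℤ) - 1) n + 1)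
    (hF : condQuot D (n * j) Q = condQuot D j Q * lucU ((dimTower D j : ℤ) - 1) n)
    (s : FiducialDatum (rankOneTuple D j Q)) (s' : FiducialDatum (rankOneTuple D (n * j) Q))
    (hss : SameTwistAndGalois s s') {p : Fin 2 → ℤ} (hp : ¬ VecZeroMod (dimTower D j) p) :
    s'.normOverlap ((κ : ℤ) • p) =
      (-1 : ℂ) ^ signExp (dimTower D j) n p * s.normOverlap p ^ n := by
  obtain ⟨hG, hgal⟩ := hss
  have hd0 := h.d_ne_zero
  have hd0' := h'.d_ne_zero
  have hκ0 : κ ≠ 0 := by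
    rintro rfl
    exact hd0' (by rw [hκ, mul_zero])
  have hxi : xi (dimTower D j) ∈ (rankOneTuple D j Q).galField := (rankOneTuple D j Q).xi_mem
  have hxi' : xi (dimTower D (n * j)) ∈ (rankOneTuple D (n * j) Q).galField :=
    (rankOneTuple D (n * j) Q).xi_mem
  -- The exponents are chosen at the upper level, where the congruence is modulo the larger order;
  -- they then serve at the lower level too.
  obtain ⟨e, f, he', hef'⟩ := exists_galApply_xi s'.g hd0' hxi'
  have hodd : Odd (dimTower D j) → Odd κ := by
    intro ho
    have hEv : Even (lucV ((dimTower D j : ℤ) - 1) n) := by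
      refine even_lucV ?_ n
      have : Odd (dimTower D j : ℤ) := by exact_mod_cast ho
      exact this.sub_odd odd_one
    have h1 : Odd ((dimTower D j : ℤ) * κ) := by
      have : ((dimTower D (n * j) : ℕ) : ℤ) = (dimTower D j : ℤ) * κ := by rw [hκ]; push_cast; ring
      rw [← this, hV]
      exact hEv.add_one
    exact_mod_cast (Int.odd_mul.1 h1).2
  have hef : (dbar (dimTower D j) : ℤ) ∣ e * f - 1 := by
    refine dvd_trans ?_ hef'
    rw [hκ]
    exact_mod_cast dbar_dvd_mul _ _ hodd
  have hxieq : xi (dimTower D j) =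
      (-1 : ℂ) ^ ((κ : ℤ) + 1) * xi (dimTower D (n * j)) ^ (κ : ℤ) := by
    rw [hκ, xi_mul_zpow hd0 hκ0, ← mul_assoc, ← zpow_add₀ (by norm_num),
      Even.neg_one_zpow ⟨_, rfl⟩, one_mul]
  have hxi'' : xi (dimTower D j) ∈ (rankOneTuple D (n * j) Q).galField := by
    rw [hxieq]
    exact mul_mem (zpow_mem (neg_mem (one_mem _)) _) (zpow_mem hxi' _)
  -- ξ_d lies in both fields, so the two automorphisms agree on it, and it is ± the κ-th power of
  -- ξ_{dκ}. The sign (-1)^{(κ+1)(e+1)} that arises is trivial: e is odd when d is even, and κ is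
  -- odd when d is odd.
  have he : galApply s.g (xi (dimTower D j)) = xi (dimTower D j) ^ e := by
    rw [← hgal _ ⟨hxi, hxi''⟩]
    conv_lhs => rw [hxieq]
    rw [galApply_neg_one_zpow_mul s'.g (zpow_mem hxi' _), galApply_zpow s'.g hxi', he', ← zpow_mul,
      mul_comm e, zpow_mul, hκ, xi_mul_zpow hd0 hκ0, mul_zpow, ← zpow_mul, ← mul_assoc,
      ← zpow_add₀ (by norm_num), Even.neg_one_zpow, one_mul]
    have e1 : (κ : ℤ) + 1 + (κ + 1) * e = (κ + 1) * (e + 1) := by ring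
    rw [e1]
    rcases Nat.even_or_odd (dimTower D j) with hev | ho
    · refine Even.mul_left ?_ _
      have : Even ((dbar (dimTower D j) : ℕ) : ℤ) := by
        rw [dbar, if_pos hev]; push_cast; exact even_two_mul _
      exact (odd_of_dvd_sub_one this hef).add_one
    · refine Even.mul_right ?_ _
      have : Odd (κ : ℤ) := by exact_mod_cast hodd ho
      exact this.add_one
  rw [normOverlap_eq h' s' he' hef', normOverlap_eq h s he hef, twistVec_smul, hG]
  set P := twistVec s.G f p with hP
  have hdvd : ((dimTower D j : ℕ) : ℤ) ∣ e * f - 1 := by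
    refine dvd_trans ?_ hef
    unfold dbar
    split_ifs
    · push_cast; exact Dvd.intro_left 2 rfl
    · exact dvd_rfl
  have hPz : ¬ VecZeroMod (dimTower D j) P := fun hz =>
    hp ((vecZeroMod_twistVec hdvd s.G p).1 hz)
  have hκz : (κ : ℤ) ≠ 0 := by exact_mod_cast hκ0
  have hPz' : ¬ VecZeroMod (dimTower D (n * j)) fun i => κ * P i := by
    intro hz
    refine hPz fun i => ?_
    obtain ⟨w, hw⟩ := hz i
    refine ⟨w, mul_left_cancel₀ hκz ?_⟩
    have hw : (κ : ℤ) * P i = (dimTower D (n * j) : ℤ) * w := hw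
    rw [hw, hκ]; push_cast; ring
  have hmain : ghostNu Q (dimTower D (n * j)) (condQuot D (n * j) Q) (fun i => κ * P i) =
      (-1 : ℂ) ^ signExp (dimTower D j) n P *
        ghostNu Q (dimTower D j) (condQuot D j Q) P ^ n := by
    have h'2 := h'
    rw [hF, hκ] at h'2
    have := h.ghostNu_mul hn hn3 (κ := κ) (by rw [← hV, hκ]; push_cast; ring) h'2 hPz
    rw [hF, hκ]
    exact this
  rw [neg_one_zpow_signExp_twistVec hef] at hmain
  obtain ⟨c, hc0, hc⟩ := exists_rat_sqrt h.four_le hn hV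
  have hA : ((√((dimTower D j : ℝ) + 1) : ℝ) : ℂ) ≠ 0 := by
    exact_mod_cast (Real.sqrt_pos.2 (by positivity : (0 : ℝ) < (dimTower D j : ℝ) + 1)).ne'
  have hA' : ((√((dimTower D (n * j) : ℝ) + 1) : ℝ) : ℂ) ≠ 0 := by
    exact_mod_cast (Real.sqrt_pos.2 (by positivity : (0 : ℝ) < (dimTower D (n * j) : ℝ) + 1)).ne'
  have hcC : ((√((dimTower D j : ℝ) + 1) : ℝ) : ℂ) ^ n =
      (c : ℂ) * ((√((dimTower D (n * j) : ℝ) + 1) : ℝ) : ℂ) := by exact_mod_cast hc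
  have hμ := ghostOverlap_eq h hPz
  have hμ' := ghostOverlap_eq h' hPz'
  have hmem := ghostOverlap_mem h P
  have hmem' := ghostOverlap_mem h' (fun i => κ * P i)
  set μ := (rankOneTuple D j Q).ghostOverlap P with hμdef
  -- In terms of the unnormalized overlaps the square roots combine to the rational number c, so
  -- every quantity to which g is applied lies in the fields concerned.
  have hrel : (rankOneTuple D (n * j) Q).ghostOverlap (fun i => κ * P i) =
      (-1 : ℂ) ^ signExp (dimTower D j) n p * ((c : ℂ) * μ ^ n) := by
    have hν : ghostNu Q (dimTower D j) (condQuot D j Q) P =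
        ((√((dimTower D j : ℝ) + 1) : ℝ) : ℂ) * μ := by rw [hμ, mul_inv_cancel_left₀ hA]
    rw [hμ', hmain, hν, mul_pow, hcC]
    field_simp
  have hcmem : (c : ℂ) ∈ (rankOneTuple D (n * j) Q).galField :=
    (rankOneTuple D (n * j) Q).galField.algebraMap_mem c
  have hcne : (c : ℂ) ≠ 0 := by exact_mod_cast hc0
  have hone : (-1 : ℂ) ^ signExp (dimTower D j) n p ≠ 0 := zpow_ne_zero _ (by norm_num)
  -- μ is only known to lie in the lower field, but the relation just proved puts μⁿ in the upper
  -- one as well; on μⁿ the two automorphisms may therefore be compared.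
  have hμn : μ ^ n ∈ (rankOneTuple D (n * j) Q).galField := by
    have e1 : μ ^ n = (c : ℂ)⁻¹ * (((-1 : ℂ) ^ signExp (dimTower D j) n p)⁻¹ *
        (rankOneTuple D (n * j) Q).ghostOverlap (fun i => κ * P i)) := by
      rw [hrel, inv_mul_cancel_left₀ hone, inv_mul_cancel_left₀ hcne]
    rw [e1]
    exact mul_mem (inv_mem hcmem) (mul_mem (inv_mem (zpow_mem (neg_mem (one_mem _)) _)) hmem')
  rw [hrel, galApply_neg_one_zpow_mul s'.g (mul_mem hcmem hμn), galApply_mul s'.g hcmem hμn,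
    galApply_ratCast, hgal _ ⟨pow_mem hmem n, hμn⟩, galApply_pow s.g hmem, mul_pow, hcC]
  ring

lemma condQuot_mul {D j : ℕ} {f : ℤ} {Q : QForm} (hdvd : Q.conductor ∣ condSeq D j)
    (hf : (condSeq D j : ℤ) = f) {j' : ℕ} {u : ℤ} (hf' : (condSeq D j' : ℤ) = f * u) (hf0 : 0 < f) :
    condQuot D j' Q = condQuot D j Q * u := by
  obtain ⟨F, hF⟩ := hdvd
  have hc : (Q.conductor : ℤ) ≠ 0 := by
    intro h0
    have : Q.conductor = 0 := by exact_mod_cast h0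
    rw [hF, this] at hf
    simp at hf
    omega
  unfold condQuot
  rw [Int.natCast_div, Int.natCast_div, hf', ← hf, hF]
  push_cast
  rw [Int.mul_ediv_cancel_left _ hc, mul_assoc, Int.mul_ediv_cancel_left _ hc]

end SICAlign

end

/-! ### Assembly of the tower theorem -/

theorem mainTheorem11 (D j : ℕ) (Q : QForm) (ht : (rankOneTuple D j Q).IsAdmissible)
    (n : ℕ) (hn : 0 < n) (hn3 : Nat.Coprime n 3) :
    (rankOneTuple D (n * j) Q).IsAdmissible ∧
    dimTower D j ∣ dimTower D (n * j) ∧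
    ∀ (s : FiducialDatum (rankOneTuple D j Q)) (s' : FiducialDatum (rankOneTuple D (n * j) Q)),
      SameTwistAndGalois s s' →
      ∀ p : Fin 2 → ℤ, ¬ VecZeroMod (dimTower D j) p →
        s'.normOverlap (((dimTower D (n * j) / dimTower D j : ℕ) : ℤ) • p) =
          (-1 : ℂ) ^ signExp (dimTower D j) n p * s.normOverlap p ^ n := by
  have hD : 1 < D := ht.one_lt_D
  have hsq : Squarefree D := ht.squarefree_D
  have hj : 0 < j := ht.j_pos
  have hne := posNormUnits_nonempty_of_admissible ht
  have hdvd : Q.conductor ∣ condSeq D j := ht.conductor_dvd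
  obtain ⟨T, f, hT⟩ := Tower.of_fundUnit hD hsq hne hj
  have hT' := hT.mul hD hsq hne hj hn
  have hT3 : 3 ≤ T := by
    obtain ⟨m, -, -, h2, -⟩ := ht.pair
    have h2 : (2 : ℤ) * ((1 : ℕ) : ℤ) < ((dimTower D j : ℕ) : ℤ) - 1 := h2
    have := hT.dimTower_eq
    push_cast at h2
    omega
  have hTd : T = (dimTower D j : ℤ) - 1 := by have := hT.dimTower_eq; omega
  have hT3' : 3 ≤ lucV T n := by
    obtain ⟨k, rfl⟩ : ∃ k, n = k + 1 := ⟨n - 1, by omega⟩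
    have := (lucU_pos_lucV_ge (by omega : 2 ≤ T) k).2.2.1
    omega
  have hdvd' : Q.conductor ∣ condSeq D (n * j) := by
    have h1 : (Q.conductor : ℤ) ∣ condSeq D (n * j) := by
      rw [hT'.condSeq_eq, ← hT.condSeq_eq]
      exact Dvd.dvd.mul_right (by exact_mod_cast hdvd) _
    exact_mod_cast h1
  have hL := hT.levelData ht.isForm ht.fundDisc_eq hdvd hT3
  have hL' := hT'.levelData ht.isForm ht.fundDisc_eq hdvd' hT3'
  have hdd : dimTower D j ∣ dimTower D (n * j) := by
    have h1 : (dimTower D j : ℤ) ∣ dimTower D (n * j) := by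
      rw [hT'.dimTower_eq]
      exact dvd_lucV_add_one hTd hn3
    exact_mod_cast h1
  refine ⟨⟨hD, hsq, Nat.mul_pos hn hj, one_pos, ?_, rfl, hT'.rankGrid_eq.symm, ht.isForm,
    ht.fundDisc_eq, hdvd'⟩, hdd, ?_⟩
  · have hd4 : (4 : ℤ) ≤ dimTower D (n * j) := by exact_mod_cast hL'.four_le
    change IsAdmissiblePair ((dimTower D (n * j) : ℕ) : ℤ) ((1 : ℕ) : ℤ)
    -- For r = 1 the integer required by admissibility is d' + 1, as (d' + 1)(d' - 1) = d'² - 1.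
    refine ⟨dimTower D (n * j) + 1, by omega, by norm_num, by push_cast; omega, ?_⟩
    push_cast
    ring
  · intro s s' hss p hp
    -- Only the unit is to change, into (ε^j)ⁿ; the next rewriting restores n * j in the remaining
    -- arguments.
    rw [mul_comm n j, pow_mul] at hL'
    rw [mul_comm j n] at hL'
    exact normOverlap_tower hn hn3 hL hL' (Nat.mul_div_cancel' hdd).symm
      (by rw [hT'.dimTower_eq, hTd])
      (by rw [← hTd]; exact condQuot_mul hdvd hT.condSeq_eq hT'.condSeq_eq hT.f_pos)
      s s' hss hp
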